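/- Let $\Omega=[0,2\pi]^2$ be the two-dimensional flat torus, so that all functions are $2\pi$-periodic in each coordinate, and let $H^m(\Omega)$ be the Sobolev space of functions in $L^2(\Omega)$ whose (periodic) weak partial derivatives up to order $m$ are in $L^2(\Omega)$. Put $$H=\Big\{u\in L^2(\Omega)^2:\ \nabla\cdot u=0,\ \int_\Omega u=0\Big\},\qquad V=H\cap H^1(\Omega)^2,\qquad \|u\|_V=\|\nabla u\|_{L^2},$$ where $\nabla\cdot u$ is taken in the sense of periodic distributions. Let $P$ be the orthogonal projection of $L^2(\Omega)^2$ onto $H$, let $A=-P\Delta$ be the Stokes operator with domain $\mathcal D(A)=H^2(\Omega)^2\cap V$ and norm $\|Au\|_{L^2}$, and let $B(u,v)=P[(u\cdot\nabla)v]$, where $(u\cdot\nabla)v=\sum_{i=1}^2u_i\,\partial v/\partial x_i$. Let $\nu>0$, $T>0$ and $f\in V$ (independent of time). A strong solution on $[0,T]$ of the two-dimensional periodic Navier–Stokes equations $$\frac{du}{dt}+\nu Au+B(u,u)=f,\qquad u(0)=\theta, \qquad (\ast)$$ with $\theta\in V$ is a map $u\in C([0,T],V)\cap L^2((0,T],\mathcal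 D(A))$ with $du/dt\in L^2((0,T],H)$ and $u(0)=\theta$ for which the equation holds in $H$ for almost every $t\in(0,T]$. **A)** For every $\theta\in V$ the equations $(\ast)$ have a unique strong solution $u$. For every $U>0$ there is a constant $c_U=c(U,\|f\|_{L^2},\nu,T)<\infty$, depending only on the quantities in brackets, such that $\|u(0)\|_V\le U$ implies $$\sup_{0\le t\le T}\|u(t)\|_V+\int_0^T\|u(t)\|_{H^2(\Omega)}^2\,dt\le c_U .$$ Moreover, for every $m>0$ there is a constant $c=c(m,\|f\|_{H^1},\nu,T)\in(0,\infty)$, depending only on the quantities in brackets, such that for all $u(0)\in\mathcal D(A)$ with $\|Au(0)\|_{L^2}\le m$ the field $u(t)$ has, for every $t\in[0,T]$, a continuous periodic version $u(t,\cdot)$, and $$\sup_{u(0)\in\mathcal D(A):\ \|Au(0)\|_{L^2}\le m}\ \ \sup_{0\le t\le T,\ x\in\Omega}|u(t,x)|\le c .$$ **B)** For every $U>0$ there is a constant $K=K(U,\|f\|_{L^2},\nu,T)<\infty$, depending only on the quantities in brackets, such that for all $u(0)\in V$ with $\|u(0)\|_V\le U$ and all $v(0)\in V$ the corresponding strong solutions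 $u,v$ of $(\ast)$ satisfy $$\sup_{0\le t\le T}\|u(t)-v(t)\|_{L^2(\Omega)}\le K\,\|u(0)-v(0)\|_{L^2(\Omega)} .$$ -/

import Mathlib

open MeasureTheory Set Filter Topology
open scoped ContDiff

noncomputable section

namespace NSTorus

/-- Points of the plane; functions on the flat torus are `2π`-periodic functions of such points. -/
abbrev Pt : Type := Fin 2 → ℝ

/-- Values of vector fields, with the Euclidean norm. -/
abbrev Vec : Type := EuclideanSpace ℝ (Fin 2)

/-- The fundamental domain `Ω = [0,2π]²` of the flat torus. -/
def Ω : Set Pt := Icc (fun _ => 0) (fun _ => 2 * Real.pi)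

/-- Lebesgue measure `dx` on `Ω`. -/
def dx : Measure Pt := volume.restrict Ω

instance : IsFiniteMeasure dx :=
  ⟨by
    rw [dx, Measure.restrict_apply_univ]
    exact (isCompact_Icc (α := Pt)).measure_lt_top⟩

/-- `L²(Ω)²`, with norm `(∫_Ω |u(x)|² dx)^{1/2}`. -/
abbrev L2 : Type := Lp Vec 2 dx

/-- Periodicity: `φ(· + 2π e_i) = φ` for `i = 1, 2`. -/
def Periodic {E : Type*} (φ : Pt → E) : Prop :=
  ∀ (i : Fin 2) (x : Pt), φ (x + Pi.single i (2 * Real.pi)) = φ x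

/-- `φ ∈ C^∞(Ω)`: smooth and periodic. -/
def IsTest (φ : Pt → ℝ) : Prop := ContDiff ℝ ∞ φ ∧ Periodic φ

/-- The classical partial derivative `∂φ/∂x_j`. -/
def partialD (j : Fin 2) (φ : Pt → ℝ) (x : Pt) : ℝ := fderiv ℝ φ x (Pi.single j 1)

/-- The classical gradient of a scalar function. -/
def grad (φ : Pt → ℝ) (x : Pt) : Vec := WithLp.toLp 2 (fun j => partialD j φ x)

lemma memLp_of_continuous {E : Type*} [NormedAddCommGroup E] {ψ : Pt → E} (hψ : Continuous ψ)
    [SecondCountableTopology E] : MemLp ψ 2 dx := by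
  obtain ⟨C, hC⟩ := (isCompact_Icc (α := Pt) (a := fun _ => 0)
    (b := fun _ => 2 * Real.pi)).exists_bound_of_continuousOn hψ.continuousOn
  refine MemLp.of_bound hψ.aestronglyMeasurable C ?_
  exact (ae_restrict_iff' measurableSet_Icc).2 (Eventually.of_forall hC)

lemma IsTest.continuous_partialD {φ : Pt → ℝ} (h : IsTest φ) (j : Fin 2) :
    Continuous (partialD j φ) :=
  (h.1.continuous_fderiv (by simp)).clm_apply continuous_const

lemma IsTest.continuous_grad {φ : Pt → ℝ} (h : IsTest φ) : Continuous (grad φ) :=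
  (PiLp.continuous_toLp 2 _).comp (continuous_pi fun j => h.continuous_partialD j)

/-- `g = ∂u/∂x_j` in the sense of periodic distributions. -/
def HasWeakPartial (j : Fin 2) (u g : L2) : Prop :=
  ∀ φ : Pt → ℝ, IsTest φ → ∫ x, partialD j φ x • u x ∂dx = - ∫ x, φ x • g x ∂dx

open Classical in
/-- The weak partial derivative `∂u/∂x_j ∈ L²(Ω)²`. It is unique when it exists; the value `0` is
used when there is none, and is never relevant for `u ∈ H¹`. -/
def weakD (j : Fin 2) (u : L2) : L2 :=
  if h : ∃ g, HasWeakPartial j u g then h.choose else 0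

/-- `u ∈ H¹(Ω)²`. -/
def MemH1 (u : L2) : Prop := ∀ j, ∃ g, HasWeakPartial j u g

/-- `u ∈ H²(Ω)²`. -/
def MemH2 (u : L2) : Prop := MemH1 u ∧ ∀ j, MemH1 (weakD j u)

/-- `∇ · u = 0` in the sense of periodic distributions. -/
def DivFree (u : L2) : Prop := ∀ φ : Pt → ℝ, IsTest φ → ∫ x, inner ℝ (grad φ x) (u x) ∂dx = 0

lemma integral_inner_eq {ψ : Pt → Vec} (hψ : Continuous ψ) (u : L2) :
    ∫ x, inner ℝ (ψ x) (u x) ∂dx = inner ℝ ((memLp_of_continuous hψ).toLp ψ) u := by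
  rw [L2.inner_def]
  refine integral_congr_ae ?_
  filter_upwards [(memLp_of_continuous hψ).coeFn_toLp] with x hx
  rw [hx]

lemma integrable_L2 (u : L2) : Integrable u dx := (Lp.memLp u).integrable (by norm_num)

lemma mean_zero_iff (u : L2) : ∫ x, u x ∂dx = 0 ↔
    ∀ a : Vec, inner ℝ ((memLp_of_continuous (ψ := fun _ => a) continuous_const).toLp _) u
      = (0 : ℝ) := by
  have key : ∀ a : Vec, inner ℝ ((memLp_of_continuous (ψ := fun _ => a) continuous_const).toLp _) u
      = (inner ℝ a (∫ x, u x ∂dx) : ℝ) := fun a => by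
    rw [← integral_inner_eq continuous_const u, integral_inner (integrable_L2 u)]
  simp_rw [key]
  exact ⟨fun h a => by rw [h, inner_zero_right], fun h => inner_self_eq_zero.1 (h _)⟩

/-- The space `H` of square-integrable, divergence-free vector fields with mean zero. -/
def H : Submodule ℝ L2 where
  carrier := {u | DivFree u ∧ ∫ x, u x ∂dx = 0}
  zero_mem' :=
    ⟨fun φ hφ => by rw [integral_inner_eq hφ.continuous_grad, inner_zero_right],
      (mean_zero_iff 0).2 fun a => inner_zero_right _⟩
  add_mem' := by
    rintro u v ⟨hu, hu'⟩ ⟨hv, hv'⟩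
    refine ⟨fun φ hφ => ?_, (mean_zero_iff _).2 fun a => ?_⟩
    · have h1 := hu φ hφ
      have h2 := hv φ hφ
      rw [integral_inner_eq hφ.continuous_grad] at h1 h2 ⊢
      rw [inner_add_right, h1, h2, add_zero]
    · rw [inner_add_right, (mean_zero_iff u).1 hu' a, (mean_zero_iff v).1 hv' a, add_zero]
  smul_mem' := by
    rintro c u ⟨hu, hu'⟩
    refine ⟨fun φ hφ => ?_, (mean_zero_iff _).2 fun a => ?_⟩
    · have h1 := hu φ hφ
      rw [integral_inner_eq hφ.continuous_grad] at h1 ⊢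
      rw [inner_smul_right, h1, mul_zero]
    · rw [inner_smul_right, (mean_zero_iff u).1 hu' a, mul_zero]

lemma isClosed_H : IsClosed (H : Set L2) := by
  have : (H : Set L2) =
      (⋂ (φ : Pt → ℝ) (hφ : IsTest φ),
        {u : L2 | inner ℝ ((memLp_of_continuous hφ.continuous_grad).toLp _) u = (0 : ℝ)}) ∩
      ⋂ a : Vec, {u : L2 |
        inner ℝ ((memLp_of_continuous (ψ := fun _ => a) continuous_const).toLp _) u = (0 : ℝ)} := by
    ext u
    simp only [mem_inter_iff, mem_iInter]
    refine and_congr (forall_congr' fun φ => forall_congr' fun hφ => ?_) (mean_zero_iff u)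
    rw [integral_inner_eq hφ.continuous_grad]
    rfl
  rw [this]
  refine IsClosed.inter (isClosed_iInter fun φ => isClosed_iInter fun hφ => ?_)
    (isClosed_iInter fun a => ?_)
  all_goals exact isClosed_eq (continuous_const.inner continuous_id) continuous_const

instance : CompleteSpace H := isClosed_H.completeSpace_coe

/-- The Helmholtz-Leray projector `P`: the `L²`-orthogonal projection onto `H`. -/
def leray : L2 →L[ℝ] L2 := H.starProjection

/-- `u ∈ V`: a divergence-free `H¹` vector field with mean zero. -/
def MemV (u : L2) : Prop := MemH1 u ∧ u ∈ H

/-- `‖u‖_V = ‖∇u‖_{L²}`. -/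
def normV (u : L2) : ℝ := √(∑ j, ‖weakD j u‖ ^ 2)

/-- `‖u‖_{H¹}`. -/
def normH1 (u : L2) : ℝ := √(‖u‖ ^ 2 + ∑ j, ‖weakD j u‖ ^ 2)

/-- `‖u‖_{H²}`. -/
def normH2 (u : L2) : ℝ :=
  √(‖u‖ ^ 2 + ∑ j, ‖weakD j u‖ ^ 2 + ∑ j, ∑ k, ‖weakD k (weakD j u)‖ ^ 2)

/-- `u ∈ D(A) = H²(Ω)² ∩ V`. -/
def MemDA (u : L2) : Prop := MemH2 u ∧ MemV u

/-- The Laplacian of `u ∈ H²(Ω)²`. -/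
def laplacian (u : L2) : L2 := ∑ j, weakD j (weakD j u)

/-- The Stokes operator `A = -PΔ` on `D(A)`. -/
def stokes (u : L2) : L2 := - leray (laplacian u)

/-- The vector field `(u · ∇) v = ∑_i u_i ∂v/∂x_i`. -/
def advection (u v : L2) (x : Pt) : Vec := ∑ i, (u x) i • weakD i v x

open Classical in
/-- `B(u,v) = P[(u · ∇) v]`, for `(u · ∇) v ∈ L²(Ω)²`. By the embedding of `H²` into `L^∞`, the
latter holds for all `u ∈ D(A)`, `v ∈ V`; the value `0` in the other case is not relevant there. -/
def B (u v : L2) : L2 :=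
  if h : MemLp (advection u v) 2 dx then leray (h.toLp _) else 0

/-- `u ∈ C([0,T], V)`. -/
def ContinuousInV (T : ℝ) (u : ℝ → L2) : Prop :=
  ∀ t ∈ Icc 0 T, MemV (u t) ∧ Tendsto (fun s => normV (u s - u t)) (𝓝[Icc 0 T] t) (𝓝 0)

/-- `u ∈ L²((0,T], D(A))`, where `D(A)` has the norm `‖Au‖_{L²}`. -/
def SquareIntegrableInDA (T : ℝ) (u : ℝ → L2) : Prop :=
  (∀ᵐ t ∂volume.restrict (Ioc 0 T), MemDA (u t)) ∧
    MemLp (fun t => stokes (u t)) 2 (volume.restrict (Ioc 0 T))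

/-- `du/dt = g` on `[0,T]`, with `g ∈ L²((0,T], H)`: the path `u` is the Bochner integral
of its derivative. -/
def HasTimeDerivative (T : ℝ) (u g : ℝ → L2) : Prop :=
  (∀ᵐ t ∂volume.restrict (Ioc 0 T), g t ∈ H) ∧ MemLp g 2 (volume.restrict (Ioc 0 T)) ∧
    ∀ t ∈ Icc 0 T, u t = u 0 + ∫ s in (0 : ℝ)..t, g s

/-- `u` is a strong solution on `[0,T]` of `du/dt + ν A u + B(u,u) = f`, `u(0) = θ`: the path
lies in `C([0,T], V) ∩ L²((0,T], D(A))`, has `du/dt ∈ L²((0,T], H)`, and the equation holds in `H`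
for almost every time. Values of `u` outside `[0,T]` play no role. -/
structure IsStrongSolution (ν T : ℝ) (f θ : L2) (u : ℝ → L2) : Prop where
  continuousInV : ContinuousInV T u
  squareIntegrableInDA : SquareIntegrableInDA T u
  initial : u 0 = θ
  equation : ∃ g : ℝ → L2, HasTimeDerivative T u g ∧
    ∀ᵐ t ∂volume.restrict (Ioc 0 T), g t + ν • stokes (u t) + B (u t) (u t) = f

end NSTorus

end

open NSTorus

noncomputable section
namespace NSTorus

/-! Everything is done on Fourier coefficients. Under `fc`, weak derivatives become multiplication
by `i k_j` (`hasWeakPartial_iff`), `H` becomes the conditions `k · û(k) = 0` and `û(0) = 0`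
(`mem_H_iff`), and the Stokes operator becomes multiplication by `|k|²` (`fc_stokes`). As `∑ |k|⁻⁴`
converges over `ℤ²`, fields in `D(A)` have absolutely convergent Fourier series
(`summable_norm_fc`). The form `⟨B(u,v),w⟩` is then an absolutely convergent sum over triads `p + q
+ r = 0` (`inner_B_eq_tsum`), so its bounds and cancellations follow by permuting triads.

Two cancellations carry the estimates: `⟨B(u,v),v⟩ = 0`, and, special to two dimensions,
`⟨B(u,u),Au⟩ = 0` (`inner_B_stokes`). The second bounds `‖u‖_V` and `∫ ‖Au‖²` in terms of `‖f‖_{L²}`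
alone. Testing with `A²u` gives `(d/dt)‖Au‖² ≤ ‖f‖_V²/ν + C ‖Au‖² · ‖Au‖²`. Gronwall closes this
because the weight `‖Au‖²` is already integrable, and the resulting bound in `D(A)` is a bound in
`L^∞`.

For a difference `w` of solutions the only surviving nonlinear term is `⟨B(w,u),w⟩`, bounded by `C
‖Au‖ ‖w‖_V ‖w‖`; dissipation absorbs `‖w‖_V`, and Gronwall gives Lipschitz stability and uniqueness
(`norm_sq_sub_le`). The same inequality with an error of size `1/n` shows that the Galerkin
approximations are Cauchy in `C([0,T]; L²)`, so no compactness argument is needed. The a priori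
bounds pass to the limit through bounded cutoffs of `A` and `A^{1/2}`, the equation passes in weak
form, and an identity for `‖u(t)‖_V²` gives continuity in `V`. By uniqueness, every strong solution
inherits the bounds of the Galerkin limit. -/

/-! ### The orthonormal basis of exponentials -/

/-- Frequencies of Fourier modes on the torus. -/
abbrev Freq : Type := Fin 2 → ℤ

/-- The phase `k · x`. -/
def phase (k : Freq) (x : Pt) : ℝ := ∑ i, k i * x i

/-- The normalized exponential `(2π)⁻¹ e^{i k · x}`. -/
def expo (k : Freq) (x : Pt) : ℂ := (2 * Real.pi : ℂ)⁻¹ * Complex.exp (Complex.I * phase k x)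

lemma phase_continuous (k : Freq) : Continuous (phase k) := by unfold phase; fun_prop

lemma phase_contDiff (k : Freq) : ContDiff ℝ ∞ (phase k) := by unfold phase; fun_prop

lemma expo_continuous (k : Freq) : Continuous (expo k) := by
  unfold expo
  have := phase_continuous k
  fun_prop

lemma norm_expo (k : Freq) (x : Pt) : ‖expo k x‖ = (2 * Real.pi)⁻¹ := by
  unfold expo
  rw [norm_mul, mul_comm Complex.I, Complex.norm_exp_ofReal_mul_I, mul_one, norm_inv]
  congr 1
  rw [norm_mul, Complex.norm_real, Real.norm_of_nonneg Real.pi_pos.le]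
  simp

/-! ### Transfer of Fourier theory from the unit torus to `Ω`. -/

section Torus

open UnitAddTorus

-- The Haar measure of total mass one, for which the monomials `mFourier k` are orthonormal.
local instance : MeasureSpace UnitAddCircle := ⟨AddCircle.haarAddCircle⟩

/-- The inverse of the covering map on the fundamental domain. -/
def unroll (y : UnitAddTorus (Fin 2)) : Pt :=
  (2 * Real.pi) • ((measurableEquivPiIoc (fun _ : Fin 2 => (0 : ℝ)) y).1)

lemma measurable_rollout : Measurable
    (fun y => ((measurableEquivPiIoc (fun _ : Fin 2 => (0 : ℝ)) y).1 : Pt)) :=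
  measurable_subtype_coe.comp (measurableEquivPiIoc (fun _ : Fin 2 => (0 : ℝ))).measurable

lemma measurable_unroll : Measurable unroll := measurable_rollout.const_smul (2 * Real.pi)

/-- Scaling the unit cell by `2π` divides Lebesgue measure by `(2π)²`; the half-open cell and `Ω`
differ by a null set. -/
lemma map_unroll : Measure.map unroll volume = ENNReal.ofReal ((2 * Real.pi) ^ 2)⁻¹ • dx := by
  have hpi : (0 : ℝ) < 2 * Real.pi := by positivity
  have h1 : Measure.map
      (fun y => ((measurableEquivPiIoc (fun _ : Fin 2 => (0 : ℝ)) y).1 : Pt)) volume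
      = (volume : Measure Pt).restrict {x | ∀ i, x i ∈ Ioc (0 : ℝ) (0 + 1)} := by
    have := (measurePreserving_equivPiIoc (fun _ : Fin 2 => (0 : ℝ))).map_eq
    have h2 := congrArg (Measure.map Subtype.val) this
    rw [Measure.map_map measurable_subtype_coe (MeasurableEquiv.measurable _)] at h2
    refine h2.trans ?_
    exact map_comap_subtype_coe (α := Pt) (s := {x | ∀ i, x i ∈ Ioc (0 : ℝ) (0 + 1)})
      (MeasurableSet.univ_pi' (fun i => measurableSet_Ioc)) volume
  have h3 : unroll = (fun x : Pt => (2 * Real.pi) • x) ∘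
      (fun y => ((measurableEquivPiIoc (fun _ : Fin 2 => (0 : ℝ)) y).1 : Pt)) := rfl
  rw [h3, ← Measure.map_map (measurable_const_smul _) measurable_rollout, h1]
  have hpre : {x : Pt | ∀ i, x i ∈ Ioc (0 : ℝ) (0 + 1)} = (fun x : Pt => (2 * Real.pi) • x) ⁻¹'
      (Set.pi univ fun _ => Ioc 0 (2 * Real.pi)) := by
    ext x
    simp only [mem_ofPred_eq, mem_preimage, Set.mem_pi, mem_univ, true_imp_iff, mem_Ioc,
      Pi.smul_apply,
      smul_eq_mul, zero_add]
    refine forall_congr' fun i => ?_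
    constructor
    · rintro ⟨a, b⟩
      exact ⟨by positivity, by nlinarith⟩
    · rintro ⟨a, b⟩
      exact ⟨by by_contra! h; nlinarith, by by_contra! h; nlinarith⟩
  rw [hpre]
  have hemb : MeasurableEmbedding (fun x : Pt => (2 * Real.pi) • x) :=
    (Homeomorph.smulOfNeZero (2 * Real.pi) hpi.ne').measurableEmbedding
  rw [← hemb.restrict_map, Measure.map_addHaar_smul _ hpi.ne', Measure.restrict_smul, dx, Ω]
  simp only [Module.finrank_fintype_fun_eq_card, Fintype.card_fin]
  rw [abs_of_pos (by positivity)]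
  congr 1
  rw [Measure.restrict_congr_set]
  exact Measure.univ_pi_Ioc_ae_eq_Icc

lemma expo_unroll (k : Freq) (y : UnitAddTorus (Fin 2)) :
    expo k (unroll y) = (2 * Real.pi : ℂ)⁻¹ * mFourier k y := by
  unfold expo
  congr 1
  have hy : ∀ i, y i = (((AddCircle.equivIoc 1 (0 : ℝ) (y i) : ℝ)) : UnitAddCircle) := fun i =>
    ((AddCircle.equivIoc 1 (0 : ℝ)).symm_apply_apply (y i)).symm
  have h2 : mFourier k y = ∏ i, fourier (k i) (y i) := rfl
  rw [h2]
  simp_rw [phase]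
  push_cast
  rw [Finset.mul_sum, Complex.exp_sum]
  refine Finset.prod_congr rfl fun i _ => ?_
  conv_rhs => rw [hy i, fourier_coe_apply]
  congr 1
  have : unroll y i = 2 * Real.pi * (AddCircle.equivIoc 1 (0 : ℝ) (y i) : ℝ) := rfl
  rw [this]
  push_cast
  ring

lemma integral_dx_eq {E : Type*} [NormedAddCommGroup E] [NormedSpace ℝ E] {F : Pt → E}
    (hF : AEStronglyMeasurable F dx) :
    ∫ x, F x ∂dx = (2 * Real.pi) ^ 2 • ∫ y, F (unroll y) := by
  have hc : (0 : ℝ) < (2 * Real.pi) ^ 2 := by positivity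
  rw [← integral_map (f := F) measurable_unroll.aemeasurable, map_unroll, integral_smul_measure,
    ENNReal.toReal_ofReal (by positivity), smul_smul, mul_inv_cancel₀ hc.ne', one_smul]
  rw [map_unroll]
  exact hF.smul_measure _

/-- The exponentials as elements of `L²`. -/
def expoL (k : Freq) : Lp ℂ 2 dx := (memLp_of_continuous (expo_continuous k)).toLp _

lemma inner_expoL (k : Freq) (v : Lp ℂ 2 dx) :
    inner ℂ (expoL k) v = ∫ x, (starRingEnd ℂ) (expo k x) * v x ∂dx := by
  rw [L2.inner_def]
  refine integral_congr_ae ?_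
  filter_upwards [(memLp_of_continuous (expo_continuous k)).coeFn_toLp] with x hx
  rw [RCLike.inner_apply, expoL, hx, mul_comm]

/-- The factor is `(2π)² · (2π)⁻¹`: the area of `Ω` times the normalization of `expo`. -/
lemma integral_conj_expo_mul (k : Freq) (v : Pt → ℂ) (hv : AEStronglyMeasurable v dx) :
    ∫ x, (starRingEnd ℂ) (expo k x) * v x ∂dx
      = (2 * Real.pi : ℂ) * mFourierCoeff (fun y => v (unroll y)) k := by
  rw [integral_dx_eq]
  · simp_rw [expo_unroll, map_mul, ← mFourier_neg, mul_assoc]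
    rw [integral_const_mul, mFourierCoeff, map_inv₀, map_mul, Complex.conj_ofReal]
    simp only [smul_eq_mul, Complex.real_smul]
    have : (2 * Real.pi : ℂ) ≠ 0 := by simp [Real.pi_ne_zero]
    push_cast
    rw [show (starRingEnd ℂ) 2 = 2 from Complex.conj_ofNat 2]
    field_simp
  · exact (Complex.continuous_conj.comp (expo_continuous k)).aestronglyMeasurable.mul hv

lemma orthonormal_expoL : Orthonormal ℂ expoL := by
  rw [orthonormal_iff_ite]
  intro k l
  have h1 : inner ℂ (expoL k) (expoL l) = ∫ x, (starRingEnd ℂ) (expo k x) * expo l x ∂dx := by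
    rw [inner_expoL]
    refine integral_congr_ae ?_
    filter_upwards [(memLp_of_continuous (expo_continuous l)).coeFn_toLp] with x hx
    rw [expoL, hx]
  rw [h1, integral_conj_expo_mul k _ (expo_continuous l).aestronglyMeasurable]
  simp_rw [expo_unroll]
  have h2 := (orthonormal_iff_ite.1 (orthonormal_mFourier (d := Fin 2))) k l
  rw [ContinuousMap.inner_toLp] at h2
  have h3 : mFourierCoeff (fun y => (2 * Real.pi : ℂ)⁻¹ * mFourier l y) k
      = (2 * Real.pi : ℂ)⁻¹ * ∫ y, mFourier l y * (starRingEnd ℂ) (mFourier k y) := by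
    rw [mFourierCoeff, ← integral_const_mul]
    refine integral_congr_ae (Eventually.of_forall fun y => ?_)
    simp only [mFourier_neg, smul_eq_mul]
    ring
  rw [h3]
  have h4 : ∫ y, mFourier l y * (starRingEnd ℂ) (mFourier k y) = if k = l then (1 : ℂ) else 0 := h2
  rw [h4, ← mul_assoc, mul_inv_cancel₀, one_mul]
  simp [Real.pi_ne_zero]

/-- Completeness, inherited from `mFourierBasis`. Null sets transfer back because the density in
`map_unroll` is nonzero. -/
lemma eq_zero_of_inner_expoL (v : Lp ℂ 2 dx) (h : ∀ k, inner ℂ (expoL k) v = 0) : v = 0 := by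
  have hpi : (2 * Real.pi : ℂ) ≠ 0 := by simp [Real.pi_ne_zero]
  have hm : StronglyMeasurable v := Lp.stronglyMeasurable v
  have hc : ENNReal.ofReal ((2 * Real.pi) ^ 2)⁻¹ ≠ 0 := by
    rw [Ne, ENNReal.ofReal_eq_zero, not_le]
    positivity
  have hV : MemLp (fun y => v (unroll y)) 2 (volume : Measure (UnitAddTorus (Fin 2))) := by
    have := (memLp_map_measure_iff (p := 2) (μ := (volume : Measure (UnitAddTorus (Fin 2))))
      (g := v) (hm.aestronglyMeasurable) measurable_unroll.aemeasurable).1 (by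
        rw [map_unroll]
        exact (Lp.memLp v).smul_measure ENNReal.ofReal_ne_top)
    exact this
  have h0 : ∀ k, mFourierCoeff (fun y => v (unroll y)) k = 0 := fun k => by
    have := h k
    rw [inner_expoL, integral_conj_expo_mul k _ hm.aestronglyMeasurable] at this
    exact (mul_eq_zero.1 this).resolve_left hpi
  have h1 : hV.toLp _ = 0 := by
    rw [← mFourierBasis.repr.map_eq_zero_iff]
    ext k
    rw [mFourierBasis_repr]
    simp only [lp.coeFn_zero, Pi.zero_apply]
    rw [← h0 k]
    refine integral_congr_ae ?_
    filter_upwards [hV.coeFn_toLp] with y hy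
    rw [hy]
  have h2 : ∀ᵐ y, v (unroll y) = 0 := by
    have := hV.coeFn_toLp
    rw [h1] at this
    filter_upwards [this, Lp.coeFn_zero ℂ 2 (volume : Measure (UnitAddTorus (Fin 2)))] with y h3 h4
    rw [← h3, h4]; rfl
  have h3 : ∀ᵐ x ∂(Measure.map unroll volume), v x = 0 :=
    (ae_map_iff measurable_unroll.aemeasurable (hm.measurable (measurableSet_singleton 0))).2 h2
  rw [map_unroll] at h3
  have h4 : ∀ᵐ x ∂dx, v x = 0 := by
    rwa [Measure.ae_ennreal_smul_measure_iff hc] at h3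
  exact (Lp.eq_zero_iff_ae_eq_zero).2 h4

end Torus

/-- The Hilbert basis of normalized exponentials of `L²(Ω; ℂ)`. -/
def expoBasis : HilbertBasis Freq ℂ (Lp ℂ 2 dx) :=
  HilbertBasis.mkOfOrthogonalEqBot orthonormal_expoL (by
    rw [Submodule.eq_bot_iff]
    intro v hv
    refine eq_zero_of_inner_expoL v fun k => ?_
    exact hv _ (Submodule.subset_span ⟨k, rfl⟩))

lemma expoBasis_apply (k : Freq) : expoBasis k = expoL k := by
  rw [expoBasis, HilbertBasis.coe_mkOfOrthogonalEqBot]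

/-! ### Fourier coefficients of vector fields -/

/-- Values of Fourier coefficients of vector fields. -/
abbrev CVec : Type := EuclideanSpace ℂ (Fin 2)

/-- The `j`-th component of a real vector field, as a complex function. -/
def component (j : Fin 2) : L2 →L[ℝ] Lp ℂ 2 dx :=
  ContinuousLinearMap.compLpL 2 dx
    (Complex.ofRealCLM ∘L (EuclideanSpace.proj j : Vec →L[ℝ] ℝ))

lemma component_ae (j : Fin 2) (u : L2) : ∀ᵐ x ∂dx, component j u x = ((u x) j : ℂ) := by
  filter_upwards [ContinuousLinearMap.coeFn_compLp
    (Complex.ofRealCLM ∘L (EuclideanSpace.proj j : Vec →L[ℝ] ℝ)) u] with x hx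
  exact hx

/-- The Fourier coefficient of a vector field with respect to the normalized exponentials. -/
def fc (u : L2) (k : Freq) : CVec := WithLp.toLp 2 fun j => inner ℂ (expoL k) (component j u)

lemma fc_apply (u : L2) (k : Freq) (j : Fin 2) :
    fc u k j = inner ℂ (expoL k) (component j u) := rfl

lemma fc_add (u v : L2) (k : Freq) : fc (u + v) k = fc u k + fc v k := by
  ext j
  simp [fc_apply, inner_add_right]

lemma fc_smul (a : ℝ) (u : L2) (k : Freq) : fc (a • u) k = (a : ℂ) • fc u k := by
  ext j
  rw [fc_apply, map_smul, PiLp.smul_apply, fc_apply, inner_smul_right_eq_smul, Complex.coe_smul]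

lemma fc_zero (k : Freq) : fc 0 k = 0 := by
  ext j
  simp [fc_apply]

lemma fc_neg (u : L2) (k : Freq) : fc (-u) k = -fc u k := by
  ext j
  simp [fc_apply]

lemma fc_sub (u v : L2) (k : Freq) : fc (u - v) k = fc u k - fc v k := by
  rw [sub_eq_add_neg, fc_add, fc_neg, sub_eq_add_neg]

lemma fc_sum {ι : Type*} (s : Finset ι) (u : ι → L2) (k : Freq) :
    fc (∑ i ∈ s, u i) k = ∑ i ∈ s, fc (u i) k := by
  ext j
  simp only [fc_apply, map_sum, inner_sum]
  simp [fc_apply]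

/-- Parseval in each component. The components are real-valued, so the complex inner products of
`L²(Ω; ℂ)` add up to the real one of `L2`. -/
lemma hasSum_inner_complex (u v : L2) :
    HasSum (fun k => inner ℂ (fc u k) (fc v k)) ((inner ℝ u v : ℝ) : ℂ) := by
  have h1 : ∀ j, HasSum (fun k => inner ℂ (fc u k j) (fc v k j))
      (inner ℂ (component j u) (component j v)) := fun j => by
    have := expoBasis.hasSum_inner_mul_inner (component j u) (component j v)
    refine this.congr_fun fun k => ?_
    rw [expoBasis_apply, fc_apply, fc_apply, RCLike.inner_apply, inner_conj_symm, mul_comm]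
  have h2 := hasSum_sum (s := Finset.univ) fun j _ => h1 j
  have h3 : ((inner ℝ u v : ℝ) : ℂ) = ∑ j, inner ℂ (component j u) (component j v) := by
    simp_rw [L2.inner_def]
    rw [← integral_finsetSum _ fun j _ => L2.integrable_inner _ _]
    refine (integral_ofReal (𝕜 := ℂ)).symm.trans ?_
    refine integral_congr_ae ?_
    filter_upwards [component_ae 0 u, component_ae 0 v, component_ae 1 u, component_ae 1 v]
      with x h1 h2 h3 h4
    simp only [Fin.sum_univ_two, h1, h2, h3, h4, PiLp.inner_apply, RCLike.inner_apply,
      Complex.conj_ofReal]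
    push_cast
    simp
  rw [h3]
  refine h2.congr_fun fun k => ?_
  rw [PiLp.inner_apply]

lemma hasSum_inner (u v : L2) :
    HasSum (fun k => (inner ℂ (fc u k) (fc v k)).re) (inner ℝ u v) := by
  have := Complex.hasSum_re (hasSum_inner_complex u v)
  simpa using this

lemma hasSum_norm_sq (u : L2) : HasSum (fun k => ‖fc u k‖ ^ 2) (‖u‖ ^ 2) := by
  have := hasSum_inner u u
  rw [real_inner_self_eq_norm_sq] at this
  refine this.congr_fun fun k => ?_
  rw [inner_self_eq_norm_sq_to_K]
  norm_cast

lemma summable_norm_sq (u : L2) : Summable fun k => ‖fc u k‖ ^ 2 := (hasSum_norm_sq u).summable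

lemma fc_injective {u v : L2} (h : ∀ k, fc u k = fc v k) : u = v := by
  rw [← sub_eq_zero, ← norm_eq_zero, ← sq_eq_zero_iff]
  refine (hasSum_norm_sq _).unique ?_
  convert hasSum_zero using 2 with k
  rw [fc_sub, h, sub_self, norm_zero, zero_pow two_ne_zero]

lemma expo_neg (k : Freq) (x : Pt) : expo (-k) x = (starRingEnd ℂ) (expo k x) := by
  have h2 : (starRingEnd ℂ) (2 : ℂ) = 2 := Complex.conj_ofNat 2
  have : phase (-k) x = - phase k x := by simp [phase, Fin.sum_univ_two]
  simp only [expo, map_mul, map_inv₀, Complex.conj_ofReal, h2, ← Complex.exp_conj, Complex.conj_I,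
    this]
  push_cast
  ring_nf

lemma fc_eq_integral (u : L2) (k : Freq) (j : Fin 2) :
    fc u k j = ∫ x, (starRingEnd ℂ) (expo k x) * ((u x) j : ℂ) ∂dx := by
  rw [fc_apply, inner_expoL]
  refine integral_congr_ae ?_
  filter_upwards [component_ae j u] with x hx
  rw [hx]

lemma inner_expoL_neg_conj (k : Freq) (w w' : Lp ℂ 2 dx)
    (h : ∀ᵐ x ∂dx, w' x = (starRingEnd ℂ) (w x)) :
    inner ℂ (expoL k) w' = (starRingEnd ℂ) (inner ℂ (expoL (-k)) w) := by
  rw [inner_expoL, inner_expoL, ← integral_conj]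
  refine integral_congr_ae ?_
  filter_upwards [h] with x hx
  rw [hx, expo_neg, map_mul, Complex.conj_conj]

lemma fc_neg_freq (u : L2) (k : Freq) (j : Fin 2) :
    fc u (-k) j = (starRingEnd ℂ) (fc u k j) := by
  rw [fc_apply, fc_apply, inner_expoL_neg_conj (-k) (component j u) (component j u), neg_neg]
  filter_upwards [component_ae j u] with x hx
  rw [hx, Complex.conj_ofReal]

/-- The inclusion of the real part of a complex number as the `j`-th component of a vector. -/
def reSingle (j : Fin 2) : ℂ →L[ℝ] Vec :=
  Complex.reCLM.smulRight (EuclideanSpace.single j (1 : ℝ))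

/-- Riesz-Fischer: square summable coefficients with the reality condition are realized. -/
lemma exists_fc_eq (c : Freq → CVec) (hc : ∀ k j, c (-k) j = (starRingEnd ℂ) (c k j))
    (hs : Summable fun k => ‖c k‖ ^ 2) : ∃ u : L2, ∀ k, fc u k = c k := by
  have hm : ∀ j, Memℓp (fun k => c k j) 2 := fun j => by
    rw [memℓp_gen_iff (by norm_num)]
    simp only [ENNReal.toReal_ofNat]
    refine hs.of_nonneg_of_le (fun k => by positivity) fun k => ?_
    have := PiLp.norm_apply_le (c k) j
    norm_cast
    gcongr
  let w : Fin 2 → Lp ℂ 2 dx := fun j => expoBasis.repr.symm ⟨fun k => c k j, hm j⟩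
  have hw : ∀ k j, inner ℂ (expoL k) (w j) = c k j := fun k j => by
    rw [← expoBasis_apply, ← HilbertBasis.repr_apply_apply]
    simp [w]
  let u : L2 := ∑ j, ContinuousLinearMap.compLpL 2 dx (reSingle j) (w j)
  have hu : ∀ j, ∀ᵐ x ∂dx, component j u x = ((w j x).re : ℂ) := fun j => by
    have h0 := Lp.coeFn_add (ContinuousLinearMap.compLpL 2 dx (reSingle 0) (w 0))
      (ContinuousLinearMap.compLpL 2 dx (reSingle 1) (w 1))
    rw [← Fin.sum_univ_two (fun j => ContinuousLinearMap.compLpL 2 dx (reSingle j) (w j))] at h0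
    filter_upwards [component_ae j u, h0, ContinuousLinearMap.coeFn_compLp (reSingle 0) (w 0),
      ContinuousLinearMap.coeFn_compLp (reSingle 1) (w 1)] with x h1 h2 h3 h4
    rw [h1]
    have h5 : u x = reSingle 0 (w 0 x) + reSingle 1 (w 1 x) := by
      rw [← h3, ← h4]; exact h2
    rw [h5]
    fin_cases j <;> simp [reSingle]
  refine ⟨u, fun k => ?_⟩
  ext j
  let w' : Lp ℂ 2 dx := ContinuousLinearMap.compLpL 2 dx (Complex.conjCLE : ℂ →L[ℝ] ℂ) (w j)
  have hw' : ∀ᵐ x ∂dx, w' x = (starRingEnd ℂ) (w j x) :=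
    ContinuousLinearMap.coeFn_compLp (Complex.conjCLE : ℂ →L[ℝ] ℂ) (w j)
  -- By the reality condition `w j` and its conjugate `w'` have the same coefficients, so passing to
  -- the real part changes none of them.
  have h1 : component j u = (2⁻¹ : ℂ) • (w j + w') := by
    refine Lp.ext ?_
    filter_upwards [hu j, hw', Lp.coeFn_smul (2⁻¹ : ℂ) (w j + w'), Lp.coeFn_add (w j) w']
      with x h1 h2 h3 h4
    rw [h1, h3, Pi.smul_apply, h4, Pi.add_apply, h2, Complex.re_eq_add_conj, smul_eq_mul]
    ring
  rw [fc_apply, h1, inner_smul_right, inner_add_right, hw,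
    inner_expoL_neg_conj k (w j) w' hw', hw, hc, Complex.conj_conj]
  ring

/-! ### Test functions and integration by parts -/

lemma Periodic.mul {φ ψ : Pt → ℝ} (h : Periodic φ) (h' : Periodic ψ) :
    Periodic fun x => φ x * ψ x := fun i x => by simp only [h i x, h' i x]

lemma IsTest.mul {φ ψ : Pt → ℝ} (h : IsTest φ) (h' : IsTest ψ) : IsTest fun x => φ x * ψ x :=
  ⟨h.1.mul h'.1, h.2.mul h'.2⟩

lemma IsTest.continuous {φ : Pt → ℝ} (h : IsTest φ) : Continuous φ := h.1.continuous

lemma IsTest.differentiable {φ : Pt → ℝ} (h : IsTest φ) : Differentiable ℝ φ :=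
  h.1.differentiable (by simp)

lemma phase_add_single (k : Freq) (i : Fin 2) (x : Pt) :
    phase k (x + Pi.single i (2 * Real.pi)) = phase k x + k i * (2 * Real.pi) := by
  fin_cases i <;> simp [phase, Fin.sum_univ_two] <;> ring

lemma isTest_cos (k : Freq) : IsTest fun x => Real.cos (phase k x) :=
  ⟨Real.contDiff_cos.comp (phase_contDiff k), fun i x => by
    simp only [phase_add_single, Real.cos_add_int_mul_two_pi]⟩

lemma isTest_sin (k : Freq) : IsTest fun x => Real.sin (phase k x) :=
  ⟨Real.contDiff_sin.comp (phase_contDiff k), fun i x => by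
    simp only [phase_add_single, Real.sin_add_int_mul_two_pi]⟩

lemma hasFDerivAt_phase (k : Freq) (x : Pt) :
    HasFDerivAt (phase k) (∑ i, (k i : ℝ) • (ContinuousLinearMap.proj i : Pt →L[ℝ] ℝ)) x := by
  have : phase k = fun x => (∑ i, (k i : ℝ) • (ContinuousLinearMap.proj i : Pt →L[ℝ] ℝ)) x := by
    ext x; simp [phase]
  rw [this]
  exact ContinuousLinearMap.hasFDerivAt _

lemma partialD_cos (k : Freq) (j : Fin 2) (x : Pt) :
    partialD j (fun x => Real.cos (phase k x)) x = -(k j * Real.sin (phase k x)) := by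
  rw [partialD, ((hasFDerivAt_phase k x).cos).fderiv]
  fin_cases j <;> simp [Fin.sum_univ_two] <;> ring

lemma partialD_sin (k : Freq) (j : Fin 2) (x : Pt) :
    partialD j (fun x => Real.sin (phase k x)) x = k j * Real.cos (phase k x) := by
  rw [partialD, ((hasFDerivAt_phase k x).sin).fderiv]
  fin_cases j <;> simp [Fin.sum_univ_two] <;> ring

lemma partialD_mul {φ ψ : Pt → ℝ} (h : IsTest φ) (h' : IsTest ψ) (j : Fin 2) (x : Pt) :
    partialD j (fun x => φ x * ψ x) x = partialD j φ x * ψ x + φ x * partialD j ψ x := by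
  simp only [partialD]
  rw [((h.differentiable x).hasFDerivAt.fun_mul (h'.differentiable x).hasFDerivAt).fderiv]
  simp
  ring

/-- The divergence theorem on the box: the integrals over opposite faces cancel by periodicity. -/
lemma integral_partialD {ψ : Pt → ℝ} (h : IsTest ψ) (j : Fin 2) :
    ∫ x, partialD j ψ x ∂dx = 0 := by
  have hle : (fun _ => 0 : Pt) ≤ fun _ => 2 * Real.pi := fun _ => by positivity
  have key := integral_divergence_of_hasFDerivAt_off_countable' (E := ℝ) (n := 1)
    (fun _ => 0 : Pt) (fun _ => 2 * Real.pi) hle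
    (fun i x => if i = j then ψ x else 0) (fun i x => if i = j then fderiv ℝ ψ x else 0) ∅
    countable_empty
    (fun i => by split_ifs; exacts [h.continuous.continuousOn, continuousOn_const])
    (fun x _ i => by
      split_ifs
      exacts [(h.differentiable x).hasFDerivAt, hasFDerivAt_const _ _])
    (by
      have : (fun x => ∑ i, (if i = j then fderiv ℝ ψ x else 0) (Pi.single i 1))
          = partialD j ψ := by
        ext x
        rw [Finset.sum_eq_single j]
        · simp [partialD]
        · intro b _ hb; simp [hb]
        · simp
      rw [this]
      exact (h.continuous_partialD j).continuousOn.integrableOn_compact isCompact_Icc)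
  have h1 : ∀ x, ∑ i, (if i = j then fderiv ℝ ψ x else 0) (Pi.single i 1) = partialD j ψ x := by
    intro x
    rw [Finset.sum_eq_single j]
    · simp [partialD]
    · intro b _ hb; simp [hb]
    · simp
  simp_rw [h1] at key
  rw [dx, Ω, key]
  refine Finset.sum_eq_zero fun i _ => ?_
  rw [sub_eq_zero]
  refine integral_congr_ae (Eventually.of_forall fun y => ?_)
  dsimp only
  split_ifs
  · have : (i.insertNth (2 * Real.pi) y : Pt)
        = i.insertNth (0 : ℝ) y + Pi.single i (2 * Real.pi) := by
      ext l
      refine Fin.succAboveCases i ?_ (fun l => ?_) l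
      · simp
      · simp
    rw [this, h.2]
  · rfl

/-! ### Smooth one-component fields -/

lemma integrable_smul_L2 {φ : Pt → ℝ} (hφ : Continuous φ) (u : L2) :
    Integrable (fun x => φ x • u x) dx := by
  have := (Lp.memLp u).smul (r := 1) (memLp_of_continuous hφ)
  exact memLp_one_iff_integrable.1 this

lemma integral_smul_apply {φ : Pt → ℝ} (hφ : Continuous φ) (u : L2) (i : Fin 2) :
    (∫ x, φ x • u x ∂dx) i = ∫ x, φ x * (u x) i ∂dx := by
  have := (EuclideanSpace.proj i : Vec →L[ℝ] ℝ).integral_comp_comm (integrable_smul_L2 hφ u)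
  simpa using this.symm

/-- The field with `i`-th component `φ` and zero other component. -/
def monoField (i : Fin 2) {φ : Pt → ℝ} (hφ : Continuous φ) : L2 :=
  (memLp_of_continuous (ψ := fun x => φ x • EuclideanSpace.single i (1 : ℝ))
    (hφ.smul continuous_const)).toLp _

lemma monoField_ae (i : Fin 2) {φ : Pt → ℝ} (hφ : Continuous φ) :
    ∀ᵐ x ∂dx, monoField i hφ x = φ x • EuclideanSpace.single i (1 : ℝ) := MemLp.coeFn_toLp _

lemma inner_monoField (i : Fin 2) {φ : Pt → ℝ} (hφ : Continuous φ) (u : L2) :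
    inner ℝ (monoField i hφ) u = ∫ x, φ x * (u x) i ∂dx := by
  rw [monoField, ← integral_inner_eq (ψ := fun x => φ x • EuclideanSpace.single i (1 : ℝ))
    (hφ.smul continuous_const)]
  refine integral_congr_ae (Eventually.of_forall fun x => ?_)
  dsimp only
  rw [real_inner_smul_left, EuclideanSpace.inner_single_left]
  simp

lemma integrable_component_mul {φ : Pt → ℝ} (hφ : Continuous φ) (u : L2) (i : Fin 2) :
    Integrable (fun x => φ x * (u x) i) dx := by
  have := (EuclideanSpace.proj i : Vec →L[ℝ] ℝ).integrable_comp (integrable_smul_L2 hφ u)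
  simpa using this

/-- Test functions are real-valued, so weak identities reach `fc` by testing with the cosine and the
sine of the phase separately. -/
lemma fc_eq_cos_sin (u : L2) (k : Freq) (i : Fin 2) :
    fc u k i = (2 * Real.pi : ℂ)⁻¹ * ((∫ x, Real.cos (phase k x) * (u x) i ∂dx : ℝ)
      - Complex.I * (∫ x, Real.sin (phase k x) * (u x) i ∂dx : ℝ)) := by
  have hc := integrable_component_mul (isTest_cos k).continuous u i
  have hs := integrable_component_mul (isTest_sin k).continuous u i
  rw [fc_eq_integral]
  have e1 := integral_ofReal (𝕜 := ℂ) (f := fun x => Real.cos (phase k x) * (u x) i) (μ := dx)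
  have e2 := integral_ofReal (𝕜 := ℂ) (f := fun x => Real.sin (phase k x) * (u x) i) (μ := dx)
  have f1 : ((∫ x, Real.cos (phase k x) * (u x) i ∂dx : ℝ) : ℂ)
      = ∫ x, ((Real.cos (phase k x) * (u x) i : ℝ) : ℂ) ∂dx := e1.symm
  have f2 : ((∫ x, Real.sin (phase k x) * (u x) i ∂dx : ℝ) : ℂ)
      = ∫ x, ((Real.sin (phase k x) * (u x) i : ℝ) : ℂ) ∂dx := e2.symm
  rw [f1, f2, ← integral_const_mul, ← integral_sub, ← integral_const_mul]
  · refine integral_congr_ae (Eventually.of_forall fun x => ?_)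
    dsimp only
    rw [← expo_neg, expo]
    have : phase (-k) x = - phase k x := by simp [phase, Fin.sum_univ_two]
    rw [this, mul_comm Complex.I, Complex.exp_mul_I]
    push_cast
    rw [Complex.cos_neg, Complex.sin_neg]
    ring
  · exact hc.ofReal
  · exact hs.ofReal.const_mul _

lemma hasWeakPartial_iff_component (j : Fin 2) (u g : L2) :
    HasWeakPartial j u g ↔ ∀ φ : Pt → ℝ, IsTest φ → ∀ i,
      ∫ x, partialD j φ x * (u x) i ∂dx = - ∫ x, φ x * (g x) i ∂dx := by
  refine forall_congr' fun φ => forall_congr' fun hφ => ?_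
  constructor
  · intro h i
    have := congrArg (fun v : Vec => v i) h
    simp only [PiLp.neg_apply] at this
    rwa [integral_smul_apply (hφ.continuous_partialD j), integral_smul_apply hφ.continuous] at this
  · intro h
    ext i
    rw [PiLp.neg_apply, integral_smul_apply (hφ.continuous_partialD j),
      integral_smul_apply hφ.continuous, h]

lemma fc_of_hasWeakPartial {j : Fin 2} {u g : L2} (h : HasWeakPartial j u g) (k : Freq) :
    fc g k = (Complex.I * k j) • fc u k := by
  rw [hasWeakPartial_iff_component] at h
  ext i
  have h1 := h _ (isTest_cos k) i
  have h2 := h _ (isTest_sin k) i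
  simp_rw [partialD_cos] at h1
  simp_rw [partialD_sin] at h2
  simp_rw [neg_mul, mul_assoc] at h1
  simp_rw [mul_assoc] at h2
  rw [integral_neg, integral_const_mul, neg_inj] at h1
  rw [integral_const_mul] at h2
  rw [PiLp.smul_apply, smul_eq_mul, fc_eq_cos_sin, fc_eq_cos_sin, ← h1, ← neg_eq_iff_eq_neg.2 h2]
  push_cast
  ring_nf
  rw [Complex.I_sq]
  ring

lemma hasWeakPartial_monoField (j i : Fin 2) {φ : Pt → ℝ} (hφ : IsTest φ) :
    HasWeakPartial j (monoField i hφ.continuous) (monoField i (hφ.continuous_partialD j)) := by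
  rw [hasWeakPartial_iff_component]
  intro ψ hψ l
  have e1 : ∫ x, partialD j ψ x * (monoField i hφ.continuous x) l ∂dx
      = (EuclideanSpace.single i (1 : ℝ) : Vec) l * ∫ x, partialD j ψ x * φ x ∂dx := by
    rw [← integral_const_mul]
    refine integral_congr_ae ?_
    filter_upwards [monoField_ae i hφ.continuous] with x hx
    rw [hx, PiLp.smul_apply, smul_eq_mul]; ring
  have e2 : ∫ x, ψ x * (monoField i (hφ.continuous_partialD j) x) l ∂dx
      = (EuclideanSpace.single i (1 : ℝ) : Vec) l * ∫ x, ψ x * partialD j φ x ∂dx := by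
    rw [← integral_const_mul]
    refine integral_congr_ae ?_
    filter_upwards [monoField_ae i (hφ.continuous_partialD j)] with x hx
    rw [hx, PiLp.smul_apply, smul_eq_mul]; ring
  rw [e1, e2, ← mul_neg]
  congr 1
  rw [eq_neg_iff_add_eq_zero, ← integral_add, ← integral_partialD (hψ.mul hφ) j]
  · exact integral_congr_ae (Eventually.of_forall fun x => (partialD_mul hψ hφ j x).symm)
  · exact ((hψ.continuous_partialD j).mul hφ.continuous).continuousOn.integrableOn_compact
      isCompact_Icc
  · exact (hψ.continuous.mul (hφ.continuous_partialD j)).continuousOn.integrableOn_compact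
      isCompact_Icc

/-- For the converse, a test function is made into a field by `monoField`; Parseval and the
skew-adjointness of multiplication by `i k_j` then give integration by parts. -/
lemma hasWeakPartial_iff (j : Fin 2) (u g : L2) :
    HasWeakPartial j u g ↔ ∀ k, fc g k = (Complex.I * k j) • fc u k := by
  refine ⟨fun h k => fc_of_hasWeakPartial h k, fun h => ?_⟩
  rw [hasWeakPartial_iff_component]
  intro φ hφ i
  rw [← inner_monoField i (hφ.continuous_partialD j), ← inner_monoField i hφ.continuous]
  refine (hasSum_inner _ _).unique ?_
  refine (hasSum_inner (monoField i hφ.continuous) g).neg.congr_fun fun k => ?_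
  rw [h, fc_of_hasWeakPartial (hasWeakPartial_monoField j i hφ), inner_smul_left,
    inner_smul_right, ← Complex.neg_re]
  congr 1
  simp

lemma weakD_of_hasWeakPartial {j : Fin 2} {u g : L2} (h : HasWeakPartial j u g) :
    weakD j u = g := by
  have h' : ∃ g, HasWeakPartial j u g := ⟨g, h⟩
  rw [weakD, dif_pos h']
  refine fc_injective fun k => ?_
  rw [fc_of_hasWeakPartial h'.choose_spec, fc_of_hasWeakPartial h]

lemma fc_weakD {u : L2} (h : MemH1 u) (j : Fin 2) (k : Freq) :
    fc (weakD j u) k = (Complex.I * k j) • fc u k := by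
  obtain ⟨g, hg⟩ := h j
  rw [weakD_of_hasWeakPartial hg, fc_of_hasWeakPartial hg]

lemma norm_freq_smul (k : Freq) (j : Fin 2) (v : CVec) :
    ‖(Complex.I * k j) • v‖ ^ 2 = (k j : ℝ) ^ 2 * ‖v‖ ^ 2 := by
  rw [norm_smul, norm_mul, Complex.norm_I, one_mul, mul_pow, Complex.norm_intCast, sq_abs]

/-- `|k|²`. -/
def ksq (k : Freq) : ℝ := ∑ i, (k i : ℝ) ^ 2

lemma ksq_nonneg (k : Freq) : 0 ≤ ksq k := Finset.sum_nonneg fun _ _ => sq_nonneg _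

lemma sq_le_ksq (k : Freq) (j : Fin 2) : (k j : ℝ) ^ 2 ≤ ksq k :=
  Finset.single_le_sum (f := fun i => (k i : ℝ) ^ 2) (fun _ _ => sq_nonneg _) (Finset.mem_univ j)

lemma ksq_neg (k : Freq) : ksq (-k) = ksq k := by simp [ksq]

lemma one_le_ksq {k : Freq} (hk : k ≠ 0) : 1 ≤ ksq k := by
  obtain ⟨i, hi⟩ := Function.ne_iff.1 hk
  refine le_trans ?_ (sq_le_ksq k i)
  have h1 : (1 : ℤ) ≤ (k i) ^ 2 := by
    have : 0 < (k i) ^ 2 := by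
      have : k i ≠ 0 := hi
      positivity
    omega
  exact_mod_cast h1

lemma memH1_iff (u : L2) : MemH1 u ↔ Summable fun k => ksq k * ‖fc u k‖ ^ 2 := by
  constructor
  · intro h
    have h1 : ∀ j, Summable fun k => ‖fc (weakD j u) k‖ ^ 2 := fun j => summable_norm_sq _
    refine (summable_sum (s := Finset.univ) fun j _ => h1 j).congr fun k => ?_
    simp_rw [fc_weakD h, norm_freq_smul, ksq, Finset.sum_mul]
  · intro h j
    obtain ⟨g, hg⟩ := exists_fc_eq (fun k => (Complex.I * k j) • fc u k) (fun k i => by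
      simp only [PiLp.smul_apply, smul_eq_mul, map_mul, Complex.conj_I, fc_neg_freq, Pi.neg_apply,
        Int.cast_neg, map_intCast]
      ring) (by
      refine h.of_nonneg_of_le (fun k => by positivity) fun k => ?_
      rw [norm_freq_smul]
      exact mul_le_mul_of_nonneg_right (sq_le_ksq k j) (by positivity))
    exact ⟨g, (hasWeakPartial_iff j u g).2 hg⟩

lemma hasSum_normV_sq {u : L2} (h : MemH1 u) :
    HasSum (fun k => ksq k * ‖fc u k‖ ^ 2) (normV u ^ 2) := by
  rw [normV, Real.sq_sqrt (Finset.sum_nonneg fun _ _ => by positivity)]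
  have := hasSum_sum (s := Finset.univ) fun j _ => hasSum_norm_sq (weakD j u)
  refine this.congr_fun fun k => ?_
  simp_rw [fc_weakD h, norm_freq_smul, ksq, Finset.sum_mul]

lemma memH2_iff (u : L2) : MemH2 u ↔ Summable fun k => ksq k ^ 2 * ‖fc u k‖ ^ 2 := by
  constructor
  · rintro ⟨h, h'⟩
    have h1 : ∀ j, Summable fun k => ksq k * ‖fc (weakD j u) k‖ ^ 2 := fun j =>
      (memH1_iff _).1 (h' j)
    refine (summable_sum (s := Finset.univ) fun j _ => h1 j).congr fun k => ?_
    simp_rw [fc_weakD h, norm_freq_smul]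
    rw [← Finset.mul_sum, ← Finset.sum_mul, ← ksq, sq (ksq k), mul_assoc]
  · intro h
    have h1 : MemH1 u := by
      rw [memH1_iff]
      refine h.of_nonneg_of_le (fun k => mul_nonneg (ksq_nonneg k) (by positivity)) fun k => ?_
      refine mul_le_mul_of_nonneg_right ?_ (by positivity)
      by_cases hk : k = 0
      · simp [hk, ksq]
      · nlinarith [one_le_ksq hk]
    refine ⟨h1, fun j => ?_⟩
    rw [memH1_iff]
    refine h.of_nonneg_of_le (fun k => mul_nonneg (ksq_nonneg k) (by positivity)) fun k => ?_
    rw [fc_weakD h1, norm_freq_smul, sq (ksq k), mul_assoc]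
    exact mul_le_mul_of_nonneg_left
      (mul_le_mul_of_nonneg_right (sq_le_ksq k j) (by positivity)) (ksq_nonneg k)

lemma fc_laplacian {u : L2} (h : MemH2 u) (k : Freq) :
    fc (laplacian u) k = (-(ksq k) : ℂ) • fc u k := by
  rw [laplacian, fc_sum]
  simp_rw [fc_weakD (h.2 _), fc_weakD h.1, smul_smul, ← Finset.sum_smul]
  congr 1
  rw [ksq]
  push_cast
  rw [← Finset.sum_neg_distrib]
  refine Finset.sum_congr rfl fun j _ => ?_
  ring_nf
  rw [Complex.I_sq]
  ring

/-! ### The space `H` -/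

/-- The gradient of a test function `φ` has coefficients `i k φ̂(k)`, so its pairing with `u` only
sees `k · û(k)`. The forward direction tests with cosines and sines. -/
lemma divFree_iff (u : L2) : DivFree u ↔ ∀ k : Freq, ∑ j, (k j : ℂ) * fc u k j = 0 := by
  have key : ∀ φ (hφ : IsTest φ), ∫ x, inner ℝ (grad φ x) (u x) ∂dx
      = ∑ j, ∫ x, partialD j φ x * (u x) j ∂dx := by
    intro φ hφ
    rw [← integral_finsetSum _ fun j _ => integrable_component_mul (hφ.continuous_partialD j) u j]
    refine integral_congr_ae (Eventually.of_forall fun x => ?_)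
    simp [PiLp.inner_apply, grad, mul_comm]
  constructor
  · intro h k
    have h1 := h _ (isTest_cos k)
    have h2 := h _ (isTest_sin k)
    rw [key _ (isTest_cos k)] at h1
    rw [key _ (isTest_sin k)] at h2
    simp_rw [partialD_cos, neg_mul, mul_assoc, integral_neg, integral_const_mul] at h1
    simp_rw [partialD_sin, mul_assoc, integral_const_mul] at h2
    rw [Finset.sum_neg_distrib, neg_eq_zero] at h1
    simp only [Fin.sum_univ_two] at h1 h2 ⊢
    have h1' := congrArg (fun r : ℝ => (r : ℂ)) h1
    have h2' := congrArg (fun r : ℝ => (r : ℂ)) h2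
    push_cast at h1' h2'
    simp_rw [fc_eq_cos_sin]
    linear_combination (2 * Real.pi : ℂ)⁻¹ * h2' - (2 * Real.pi : ℂ)⁻¹ * Complex.I * h1'
  · intro h φ hφ
    rw [key φ hφ]
    simp_rw [← inner_monoField _ (hφ.continuous_partialD _)]
    have h1 := hasSum_sum (s := Finset.univ) fun j _ =>
      hasSum_inner_complex (monoField j (hφ.continuous_partialD j)) u
    rw [← Complex.ofReal_sum] at h1
    have h2 := h1.unique (a₂ := 0) (by
      convert hasSum_zero using 2 with k
      -- The scalar coefficient of `φ` does not depend on the slot in which `φ` is placed, so it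
      -- factors out of the sum over `j`.
      have e : ∀ j l, fc (monoField j (hφ.continuous_partialD j)) k l
          = if l = j then (Complex.I * k j) * fc (monoField 0 hφ.continuous) k 0 else 0 := by
        intro j l
        rw [fc_of_hasWeakPartial (hasWeakPartial_monoField j j hφ), PiLp.smul_apply, smul_eq_mul]
        have e' : ∀ i l, fc (monoField i hφ.continuous) k l =
            if l = i then fc (monoField 0 hφ.continuous) k 0 else 0 := by
          have : ∀ i l, fc (monoField i hφ.continuous) k l = if l = i then
              ∫ x, (starRingEnd ℂ) (expo k x) * (φ x : ℂ) ∂dx else 0 := by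
            intro i l
            rw [fc_eq_integral]
            split_ifs with hl
            · refine integral_congr_ae ?_
              filter_upwards [monoField_ae i hφ.continuous] with x hx
              simp [hx, hl]
            · rw [← integral_zero Pt ℂ (μ := dx)]
              refine integral_congr_ae ?_
              filter_upwards [monoField_ae i hφ.continuous] with x hx
              simp [hx, hl]
          intro i l
          rw [this, this]; simp
        rw [e']
        split_ifs <;> simp
      simp only [PiLp.inner_apply, e, RCLike.inner_apply]
      have := h k
      simp only [Fin.sum_univ_two] at this ⊢
      simp only [if_true, Fin.isValue, zero_ne_one, one_ne_zero, if_false, map_zero, mul_zero,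
        add_zero, zero_add, map_mul, Complex.conj_I, map_intCast]
      linear_combination (-Complex.I * (starRingEnd ℂ) (fc (monoField 0 hφ.continuous) k 0)) * this)
    exact_mod_cast h2

lemma mean_eq_zero_iff (u : L2) : ∫ x, u x ∂dx = 0 ↔ fc u 0 = 0 := by
  have h : ∀ i, fc u 0 i = (2 * Real.pi : ℂ)⁻¹ * (((∫ x, u x ∂dx) i : ℝ) : ℂ) := fun i => by
    have := integral_smul_apply (φ := fun _ => 1) continuous_const u i
    simp only [one_smul, one_mul] at this
    rw [fc_eq_cos_sin, this]
    simp [phase]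
  constructor
  · intro h0
    ext i
    rw [h, h0]; simp
  · intro h0
    ext i
    have := h i
    rw [h0] at this
    simpa [Real.pi_ne_zero] using this

lemma mem_H_iff (u : L2) : u ∈ H ↔ (∀ k : Freq, ∑ j, (k j : ℂ) * fc u k j = 0) ∧ fc u 0 = 0 := by
  rw [← divFree_iff, ← mean_eq_zero_iff]
  rfl

/-! ### The Stokes operator and the Leray projector in Fourier variables -/

lemma leray_mem (F : L2) : leray F ∈ H := H.starProjection_apply_mem F

lemma leray_eq_self {u : L2} (hu : u ∈ H) : leray u = u := Submodule.starProjection_eq_self_iff.2 hu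

lemma inner_leray (F : L2) {w : L2} (hw : w ∈ H) : inner ℝ (leray F) w = inner ℝ F w := by
  conv_rhs => rw [← leray_eq_self hw]
  exact Submodule.inner_starProjection_left_eq_right H F w

lemma mem_H_of_fc {u v : L2} (hu : u ∈ H) (m : Freq → ℂ) (h : ∀ k, fc v k = m k • fc u k) :
    v ∈ H := by
  rw [mem_H_iff] at hu ⊢
  refine ⟨fun k => ?_, by rw [h, hu.2, smul_zero]⟩
  have := hu.1 k
  simp only [h, PiLp.smul_apply, smul_eq_mul]
  rw [← mul_zero (m k), ← this, Finset.mul_sum]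
  exact Finset.sum_congr rfl fun _ _ => by ring

lemma MemDA.mem_H {u : L2} (h : MemDA u) : u ∈ H := h.2.2

lemma MemDA.memH1 {u : L2} (h : MemDA u) : MemH1 u := h.2.1

lemma memDA_iff (u : L2) :
    MemDA u ↔ u ∈ H ∧ Summable fun k => ksq k ^ 2 * ‖fc u k‖ ^ 2 := by
  rw [← memH2_iff]
  exact ⟨fun h => ⟨h.mem_H, h.1⟩, fun h => ⟨h.2, h.2.1, h.1⟩⟩

lemma memV_iff (u : L2) : MemV u ↔ u ∈ H ∧ Summable fun k => ksq k * ‖fc u k‖ ^ 2 := by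
  rw [← memH1_iff, and_comm]
  rfl

/-- A scalar multiplier keeps each coefficient orthogonal to `k` and fixes the zero mode, so the
Laplacian of a field in `D(A)` lies in `H` and the projector acts trivially on it. -/
lemma fc_stokes {u : L2} (h : MemDA u) (k : Freq) : fc (stokes u) k = (ksq k : ℂ) • fc u k := by
  have h1 : laplacian u ∈ H := mem_H_of_fc h.mem_H _ (fc_laplacian h.1)
  rw [stokes, leray_eq_self h1, fc_neg, fc_laplacian h.1, neg_smul, neg_neg]

lemma stokes_mem {u : L2} (h : MemDA u) : stokes u ∈ H := mem_H_of_fc h.mem_H _ (fc_stokes h)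

lemma fc_zero_of_mem {u : L2} (h : u ∈ H) : fc u 0 = 0 := ((mem_H_iff u).1 h).2

lemma norm_ofReal_smul_sq (a : ℝ) (v : CVec) : ‖(a : ℂ) • v‖ ^ 2 = a ^ 2 * ‖v‖ ^ 2 := by
  rw [norm_smul, mul_pow, Complex.norm_real, Real.norm_eq_abs, sq_abs]

lemma hasSum_norm_stokes_sq {u : L2} (h : MemDA u) :
    HasSum (fun k => ksq k ^ 2 * ‖fc u k‖ ^ 2) (‖stokes u‖ ^ 2) := by
  refine (hasSum_norm_sq (stokes u)).congr_fun fun k => ?_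
  rw [fc_stokes h, norm_ofReal_smul_sq]

/-- Poincaré's inequality mode by mode: the mean vanishes, and every other frequency has `|k| ≥ 1`.
-/
lemma norm_sq_le_ksq_mul {u : L2} (h : u ∈ H) (k : Freq) :
    ‖fc u k‖ ^ 2 ≤ ksq k * ‖fc u k‖ ^ 2 := by
  by_cases hk : k = 0
  · simp [hk, fc_zero_of_mem h]
  · nlinarith [one_le_ksq hk, sq_nonneg ‖fc u k‖]

lemma norm_le_normV {u : L2} (h : MemV u) : ‖u‖ ≤ normV u := by
  refine le_of_sq_le_sq ?_ (Real.sqrt_nonneg _)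
  exact hasSum_le (norm_sq_le_ksq_mul h.2) (hasSum_norm_sq u) (hasSum_normV_sq h.1)

lemma normV_nonneg (u : L2) : 0 ≤ normV u := Real.sqrt_nonneg _

lemma normV_le_norm_stokes {u : L2} (h : MemDA u) : normV u ≤ ‖stokes u‖ := by
  refine le_of_sq_le_sq ?_ (norm_nonneg _)
  refine hasSum_le (fun k => ?_) (hasSum_normV_sq h.memH1) (hasSum_norm_stokes_sq h)
  rw [sq (ksq k), mul_assoc]
  exact mul_le_mul_of_nonneg_left (norm_sq_le_ksq_mul h.mem_H k) (ksq_nonneg k)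

lemma normV_sq_eq_inner {u : L2} (h : MemDA u) : normV u ^ 2 = inner ℝ u (stokes u) := by
  refine (hasSum_normV_sq h.memH1).unique ((hasSum_inner u (stokes u)).congr_fun fun k => ?_)
  rw [fc_stokes h, inner_smul_right, Complex.re_ofReal_mul, inner_self_eq_norm_sq_to_K]
  norm_cast

lemma inner_stokes_comm {u v : L2} (hu : MemDA u) (hv : MemDA v) :
    inner ℝ (stokes u) v = inner ℝ u (stokes v) := by
  refine (hasSum_inner _ _).unique ((hasSum_inner _ _).congr_fun fun k => ?_)
  rw [fc_stokes hu, fc_stokes hv, inner_smul_right, inner_smul_left, Complex.conj_ofReal]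

lemma normH2_sq {u : L2} (h : MemDA u) :
    normH2 u ^ 2 = ‖u‖ ^ 2 + normV u ^ 2 + ‖stokes u‖ ^ 2 := by
  rw [normH2, Real.sq_sqrt (by positivity), normV,
    Real.sq_sqrt (Finset.sum_nonneg fun _ _ => by positivity)]
  congr 1
  have h1 := hasSum_sum (s := Finset.univ) fun j _ => hasSum_sum (s := Finset.univ)
    fun l _ => hasSum_norm_sq (weakD l (weakD j u))
  refine h1.unique ((hasSum_norm_stokes_sq h).congr_fun fun k => ?_)
  simp_rw [fc_weakD (h.1.2 _), fc_weakD h.memH1, norm_freq_smul, ksq, Fin.sum_univ_two]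
  ring

lemma normH2_sq_le {u : L2} (h : MemDA u) : normH2 u ^ 2 ≤ 3 * ‖stokes u‖ ^ 2 := by
  rw [normH2_sq h]
  have h1 := norm_le_normV h.2
  have h2 := normV_le_norm_stokes h
  have := norm_nonneg u
  nlinarith [normV_nonneg u]

lemma normV_le_normH1 (u : L2) : normV u ≤ normH1 u :=
  Real.sqrt_le_sqrt (by have := sq_nonneg ‖u‖; linarith)

lemma norm_le_normH1 (u : L2) : ‖u‖ ≤ normH1 u :=
  Real.le_sqrt_of_sq_le (by
    have : 0 ≤ ∑ j, ‖weakD j u‖ ^ 2 := Finset.sum_nonneg fun _ _ => by positivity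
    linarith)

lemma MemV.add {u v : L2} (hu : MemV u) (hv : MemV v) : MemV (u + v) := by
  refine ⟨fun j => ?_, H.add_mem hu.2 hv.2⟩
  obtain ⟨g, hg⟩ := hu.1 j
  obtain ⟨g', hg'⟩ := hv.1 j
  refine ⟨g + g', (hasWeakPartial_iff _ _ _).2 fun k => ?_⟩
  rw [fc_add, fc_add, fc_of_hasWeakPartial hg, fc_of_hasWeakPartial hg', smul_add]

lemma MemV.smul {u : L2} (a : ℝ) (hu : MemV u) : MemV (a • u) := by
  refine ⟨fun j => ?_, H.smul_mem a hu.2⟩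
  obtain ⟨g, hg⟩ := hu.1 j
  refine ⟨a • g, (hasWeakPartial_iff _ _ _).2 fun k => ?_⟩
  rw [fc_smul, fc_smul, fc_of_hasWeakPartial hg, smul_comm]

lemma MemV.sub {u v : L2} (hu : MemV u) (hv : MemV v) : MemV (u - v) := by
  have := hu.add (hv.smul (-1))
  rwa [neg_one_smul, ← sub_eq_add_neg] at this

lemma weakD_add {u v : L2} (hu : MemH1 u) (hv : MemH1 v) (j : Fin 2) :
    weakD j (u + v) = weakD j u + weakD j v := by
  refine weakD_of_hasWeakPartial ((hasWeakPartial_iff _ _ _).2 fun k => ?_)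
  rw [fc_add, fc_add, fc_weakD hu, fc_weakD hv, smul_add]

lemma weakD_smul {u : L2} (a : ℝ) (hu : MemH1 u) (j : Fin 2) :
    weakD j (a • u) = a • weakD j u := by
  refine weakD_of_hasWeakPartial ((hasWeakPartial_iff _ _ _).2 fun k => ?_)
  rw [fc_smul, fc_smul, fc_weakD hu, smul_comm]

lemma summable_add_sq {w : Freq → ℝ} (hw : ∀ k, 0 ≤ w k) {u v : L2}
    (hu : Summable fun k => w k * ‖fc u k‖ ^ 2) (hv : Summable fun k => w k * ‖fc v k‖ ^ 2) :
    Summable fun k => w k * ‖fc (u + v) k‖ ^ 2 := by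
  refine ((hu.mul_left 2).add (hv.mul_left 2)).of_nonneg_of_le
    (fun k => mul_nonneg (hw k) (by positivity)) fun k => ?_
  rw [fc_add]
  have h1 : ‖fc u k + fc v k‖ ^ 2 ≤ 2 * ‖fc u k‖ ^ 2 + 2 * ‖fc v k‖ ^ 2 := by
    have := norm_add_le (fc u k) (fc v k)
    nlinarith [norm_nonneg (fc u k + fc v k), sq_nonneg (‖fc u k‖ - ‖fc v k‖)]
  nlinarith [hw k]

lemma MemDA.add {u v : L2} (hu : MemDA u) (hv : MemDA v) : MemDA (u + v) := by
  rw [memDA_iff] at *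
  exact ⟨H.add_mem hu.1 hv.1, summable_add_sq (fun k => by positivity) hu.2 hv.2⟩

lemma MemDA.smul {u : L2} (a : ℝ) (hu : MemDA u) : MemDA (a • u) := by
  rw [memDA_iff] at *
  refine ⟨H.smul_mem a hu.1, (hu.2.mul_left (a ^ 2)).congr fun k => ?_⟩
  rw [fc_smul, norm_ofReal_smul_sq]; ring

lemma MemDA.sub {u v : L2} (hu : MemDA u) (hv : MemDA v) : MemDA (u - v) := by
  have := hu.add (hv.smul (-1))
  rwa [neg_one_smul, ← sub_eq_add_neg] at this

lemma stokes_sub {u v : L2} (hu : MemDA u) (hv : MemDA v) :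
    stokes (u - v) = stokes u - stokes v := by
  refine fc_injective fun k => ?_
  rw [fc_sub, fc_stokes hu, fc_stokes hv, fc_stokes (hu.sub hv), fc_sub, smul_sub]

/-! ### Fourier multipliers and truncations -/

/-- The Fourier multiplier with a bounded even real symbol. -/
def multiplier (m : Freq → ℝ) (hm : ∀ k, m (-k) = m k) (C : ℝ) (hC : ∀ k, |m k| ≤ C) :
    L2 →L[ℝ] L2 :=
  have key : ∀ u : L2, ∃ v : L2, ∀ k, fc v k = (m k : ℂ) • fc u k := fun u =>
    exists_fc_eq _ (fun k j => by
      simp only [PiLp.smul_apply, smul_eq_mul, map_mul, fc_neg_freq, hm, Complex.conj_ofReal]) (by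
      refine ((summable_norm_sq u).mul_left (C ^ 2)).of_nonneg_of_le (fun k => by positivity)
        fun k => ?_
      rw [norm_ofReal_smul_sq, ← sq_abs]
      have := hC k
      gcongr)
  LinearMap.mkContinuous
    { toFun := fun u => (key u).choose
      map_add' := fun u v => fc_injective fun k => by
        rw [fc_add, (key _).choose_spec, (key _).choose_spec, (key _).choose_spec, fc_add, smul_add]
      map_smul' := fun a u => fc_injective fun k => by
        rw [RingHom.id_apply, fc_smul, (key _).choose_spec, (key _).choose_spec, fc_smul,
          smul_comm] }
    C (fun u => by
      have hC0 : 0 ≤ C := (abs_nonneg _).trans (hC 0)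
      refine le_of_sq_le_sq ?_ (by positivity)
      rw [mul_pow]
      refine hasSum_le (fun k => ?_) (hasSum_norm_sq _) ((hasSum_norm_sq u).mul_left (C ^ 2))
      have e : fc ((key u).choose) k = (m k : ℂ) • fc u k := (key u).choose_spec k
      change ‖fc ((key u).choose) k‖ ^ 2 ≤ _
      rw [e, norm_ofReal_smul_sq, ← sq_abs]
      have := hC k
      gcongr)

lemma fc_multiplier (m : Freq → ℝ) (hm : ∀ k, m (-k) = m k) (C : ℝ) (hC : ∀ k, |m k| ≤ C)
    (u : L2) (k : Freq) : fc (multiplier m hm C hC u) k = (m k : ℂ) • fc u k := by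
  have key : ∀ u : L2, ∃ v : L2, ∀ k, fc v k = (m k : ℂ) • fc u k := fun u =>
    exists_fc_eq _ (fun k j => by
      simp only [PiLp.smul_apply, smul_eq_mul, map_mul, fc_neg_freq, hm, Complex.conj_ofReal]) (by
      refine ((summable_norm_sq u).mul_left (C ^ 2)).of_nonneg_of_le (fun k => by positivity)
        fun k => ?_
      rw [norm_ofReal_smul_sq, ← sq_abs]
      have := hC k
      gcongr)
  exact (key u).choose_spec k

/-- The frequencies with components of absolute value at most `n`. -/
def box (n : ℕ) : Finset Freq := Finset.Icc (fun _ => -(n : ℤ)) (fun _ => (n : ℤ))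

lemma mem_box {n : ℕ} {k : Freq} : k ∈ box n ↔ ∀ i, |k i| ≤ n := by
  simp only [box, Finset.mem_Icc, Pi.le_def, ← forall_and, abs_le]

lemma neg_mem_box {n : ℕ} {k : Freq} : -k ∈ box n ↔ k ∈ box n := by
  simp [mem_box]

lemma box_mono : Monotone box := fun m n h k hk => by
  rw [mem_box] at *
  exact fun i => (hk i).trans (by exact_mod_cast h)

lemma tendsto_box : Tendsto box atTop atTop := by
  refine tendsto_atTop_finset_of_monotone box_mono fun k => ⟨∑ i, (k i).natAbs, ?_⟩
  rw [mem_box]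
  intro i
  rw [Int.abs_eq_natAbs]
  exact_mod_cast
    Finset.single_le_sum (f := fun i => (k i).natAbs) (fun _ _ => Nat.zero_le _) (Finset.mem_univ i)

open Classical in
/-- The multiplier with symbol `w` cut off to `box n`. -/
def cutMul (n : ℕ) (w : Freq → ℝ) (hw : ∀ k, w (-k) = w k) : L2 →L[ℝ] L2 :=
  multiplier (fun k => if k ∈ box n then w k else 0)
    (fun k => by simp only [neg_mem_box, hw]) (∑ k ∈ box n, |w k|) (fun k => by
      split_ifs with h
      · exact Finset.single_le_sum (f := fun k => |w k|) (fun _ _ => abs_nonneg _) h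
      · rw [abs_zero]; exact Finset.sum_nonneg fun _ _ => abs_nonneg _)

open Classical in
lemma fc_cutMul (n : ℕ) (w : Freq → ℝ) (hw : ∀ k, w (-k) = w k) (u : L2) (k : Freq) :
    fc (cutMul n w hw u) k = if k ∈ box n then (w k : ℂ) • fc u k else 0 := by
  rw [cutMul, fc_multiplier]
  split_ifs <;> simp

/-- Truncation to the frequencies in `box n`. -/
def trunc (n : ℕ) : L2 →L[ℝ] L2 := cutMul n (fun _ => 1) fun _ => rfl

open Classical in
lemma fc_trunc (n : ℕ) (u : L2) (k : Freq) :
    fc (trunc n u) k = if k ∈ box n then fc u k else 0 := by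
  rw [trunc, fc_cutMul]
  simp

lemma norm_sub_trunc_sq (n : ℕ) (u : L2) :
    ‖u - trunc n u‖ ^ 2 = ‖u‖ ^ 2 - ∑ k ∈ box n, ‖fc u k‖ ^ 2 := by
  classical
  refine (hasSum_norm_sq _).unique ?_
  have h := (hasSum_norm_sq u).sub (hasSum_sum_of_ne_finset_zero (s := box n)
    (f := fun k => if k ∈ box n then ‖fc u k‖ ^ 2 else 0) fun k hk => if_neg hk)
  rw [Finset.sum_congr rfl fun k hk => if_pos hk] at h
  refine h.congr_fun fun k => ?_
  rw [fc_sub, fc_trunc]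
  split_ifs <;> simp

lemma tendsto_trunc (u : L2) : Tendsto (fun n => trunc n u) atTop (𝓝 u) := by
  rw [tendsto_iff_norm_sub_tendsto_zero]
  have h1 : Tendsto (fun n => ‖u - trunc n u‖ ^ 2) atTop (𝓝 0) := by
    simp_rw [norm_sub_trunc_sq]
    have : Tendsto (fun n => ∑ k ∈ box n, ‖fc u k‖ ^ 2) atTop (𝓝 (‖u‖ ^ 2)) :=
      (hasSum_norm_sq u).comp tendsto_box
    have h := this.const_sub (‖u‖ ^ 2)
    rwa [sub_self] at h
  have h2 := h1.sqrt
  simp_rw [Real.sqrt_zero, Real.sqrt_sq (norm_nonneg _)] at h2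
  simpa only [norm_sub_rev] using h2

/-- The Galerkin space of solenoidal fields with frequencies in `box n`. -/
def galerkinSpace (n : ℕ) : Submodule ℝ L2 where
  carrier := {u | u ∈ H ∧ ∀ k, k ∉ box n → fc u k = 0}
  zero_mem' := ⟨H.zero_mem, fun k _ => fc_zero k⟩
  add_mem' := fun {u v} hu hv => ⟨H.add_mem hu.1 hv.1, fun k hk => by
    rw [fc_add, hu.2 k hk, hv.2 k hk, add_zero]⟩
  smul_mem' := fun a u hu => ⟨H.smul_mem a hu.1, fun k hk => by rw [fc_smul, hu.2 k hk, smul_zero]⟩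

lemma cutMul_mem (n : ℕ) (w : Freq → ℝ) (hw : ∀ k, w (-k) = w k) {u : L2} (hu : u ∈ H) :
    cutMul n w hw u ∈ galerkinSpace n := by
  classical
  refine ⟨mem_H_of_fc hu (fun k => if k ∈ box n then (w k : ℂ) else 0) fun k => ?_,
    fun k hk => by rw [fc_cutMul, if_neg hk]⟩
  rw [fc_cutMul]
  split_ifs <;> simp

lemma trunc_mem (n : ℕ) {u : L2} (hu : u ∈ H) : trunc n u ∈ galerkinSpace n := cutMul_mem _ _ _ hu

lemma trunc_eq_self {n : ℕ} {u : L2} (hu : u ∈ galerkinSpace n) : trunc n u = u := by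
  classical
  refine fc_injective fun k => ?_
  rw [fc_trunc]
  split_ifs with h
  · rfl
  · exact (hu.2 k h).symm

lemma galerkinSpace_mono {m n : ℕ} (h : m ≤ n) : galerkinSpace m ≤ galerkinSpace n :=
  fun _ hu => ⟨hu.1, fun k hk => hu.2 k fun h' => hk (box_mono h h')⟩

lemma inner_trunc (n : ℕ) (u : L2) {w : L2} (hw : w ∈ galerkinSpace n) :
    inner ℝ (trunc n u) w = inner ℝ u w := by
  classical
  refine (hasSum_inner _ _).unique ((hasSum_inner _ _).congr_fun fun k => ?_)
  rw [fc_trunc]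
  split_ifs with h
  · rfl
  · rw [hw.2 k h]; simp

lemma norm_trunc_le (n : ℕ) (u : L2) : ‖trunc n u‖ ≤ ‖u‖ := by
  classical
  refine le_of_sq_le_sq ?_ (norm_nonneg _)
  refine hasSum_le (fun k => ?_) (hasSum_norm_sq _) (hasSum_norm_sq u)
  rw [fc_trunc]
  split_ifs
  · rfl
  · simp

lemma summable_of_mem_galerkinSpace {n : ℕ} {u : L2} (h : u ∈ galerkinSpace n) (w : Freq → ℝ) :
    Summable fun k => w k * ‖fc u k‖ ^ 2 :=
  summable_of_ne_finset_zero (s := box n) fun k hk => by simp [h.2 k hk]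

lemma memDA_of_mem_galerkinSpace {n : ℕ} {u : L2} (h : u ∈ galerkinSpace n) : MemDA u :=
  (memDA_iff u).2 ⟨h.1, summable_of_mem_galerkinSpace h _⟩

lemma stokes_mem_galerkinSpace {n : ℕ} {u : L2} (h : u ∈ galerkinSpace n) :
    stokes u ∈ galerkinSpace n := by
  have hu := memDA_of_mem_galerkinSpace h
  exact ⟨stokes_mem hu, fun k hk => by rw [fc_stokes hu, h.2 k hk, smul_zero]⟩

/-- The Stokes operator cut off to `box n`. -/
def stokesCut (n : ℕ) : L2 →L[ℝ] L2 := cutMul n ksq ksq_neg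

lemma stokesCut_eq_trunc_stokes {u : L2} (h : MemDA u) (n : ℕ) :
    stokesCut n u = trunc n (stokes u) := by
  classical
  refine fc_injective fun k => ?_
  rw [stokesCut, fc_cutMul, fc_trunc, fc_stokes h]

lemma stokesCut_eq_stokes_trunc {u : L2} (h : u ∈ H) (n : ℕ) :
    stokesCut n u = stokes (trunc n u) := by
  classical
  refine fc_injective fun k => ?_
  rw [stokesCut, fc_cutMul, fc_stokes (memDA_of_mem_galerkinSpace (trunc_mem n h)), fc_trunc]
  split_ifs <;> simp

lemma stokesCut_eq_stokes {n : ℕ} {u : L2} (h : u ∈ galerkinSpace n) :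
    stokesCut n u = stokes u := by
  rw [stokesCut_eq_stokes_trunc h.1, trunc_eq_self h]

lemma sq_lt_ksq_of_notMem_box {n : ℕ} {k : Freq} (h : k ∉ box n) : (n : ℝ) ^ 2 ≤ ksq k := by
  rw [mem_box] at h
  push Not at h
  obtain ⟨i, hi⟩ := h
  refine le_trans ?_ (sq_le_ksq k i)
  rw [← sq_abs (k i : ℝ)]
  have : (n : ℝ) ≤ |(k i : ℝ)| := by exact_mod_cast hi.le
  gcongr

/-- Frequencies outside `box n` have `|k| ≥ n`. This is the source of the rate `1/n` in the
convergence of the Galerkin scheme. -/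
lemma norm_sub_trunc_le {u : L2} (h : MemV u) (n : ℕ) : n * ‖u - trunc n u‖ ≤ normV u := by
  classical
  refine le_of_sq_le_sq ?_ (normV_nonneg u)
  rw [mul_pow]
  refine hasSum_le (fun k => ?_) ((hasSum_norm_sq _).mul_left _) (hasSum_normV_sq h.1)
  rw [fc_sub, fc_trunc]
  split_ifs with hk
  · simp only [sub_self, norm_zero, zero_pow two_ne_zero, mul_zero]
    exact mul_nonneg (ksq_nonneg k) (by positivity)
  · rw [sub_zero]
    exact mul_le_mul_of_nonneg_right (sq_lt_ksq_of_notMem_box hk) (by positivity)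

/-! ### Absolute convergence of Fourier series of fields in `D(A)` -/

lemma summable_mul_of_sq {ι : Type*} {f g : ι → ℝ} (hf : ∀ i, 0 ≤ f i) (hg : ∀ i, 0 ≤ g i)
    (hf2 : Summable fun i => f i ^ 2) (hg2 : Summable fun i => g i ^ 2) :
    (Summable fun i => f i * g i) ∧
      ∑' i, f i * g i ≤ √(∑' i, f i ^ 2) * √(∑' i, g i ^ 2) := by
  have := Real.summable_and_inner_le_Lp_mul_Lq_tsum_of_nonneg (p := 2) (q := 2) (f := f) (g := g)
    (by constructor <;> norm_num) hf hg (by simpa using hf2) (by simpa using hg2)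
  refine ⟨this.1, this.2.trans (le_of_eq ?_)⟩
  rw [Real.sqrt_eq_rpow, Real.sqrt_eq_rpow]
  simp

/-- The exponent `4` exceeds the dimension `2`; the lattice sum is compared with the one for the sup
norm. The term at `k = 0` is zero because `0⁻¹ = 0`. -/
lemma summable_inv_ksq_sq : Summable fun k : Freq => ((ksq k)⁻¹) ^ 2 := by
  have h := EisensteinSeries.summable_one_div_norm_rpow (k := 4) (by norm_num)
  refine h.of_nonneg_of_le (fun k => by positivity) fun k => ?_
  by_cases hk : k = 0
  · rw [hk]
    simp [ksq]
  · have h1 : ‖k‖ ^ 2 ≤ ksq k := by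
      have h2 : ∀ i, ‖k i‖ ≤ √(ksq k) := fun i => by
        rw [Int.norm_eq_abs]
        exact Real.abs_le_sqrt (sq_le_ksq k i)
      have h3 : ‖k‖ ≤ √(ksq k) := (pi_norm_le_iff_of_nonneg (Real.sqrt_nonneg _)).2 h2
      calc ‖k‖ ^ 2 ≤ √(ksq k) ^ 2 := by gcongr
        _ = ksq k := Real.sq_sqrt (ksq_nonneg k)
    have h4 : 0 < ‖k‖ := norm_pos_iff.2 hk
    rw [Real.rpow_neg (norm_nonneg _), inv_pow]
    apply inv_anti₀ (by positivity)
    calc ‖k‖ ^ (4 : ℝ) = (‖k‖ ^ 2) ^ 2 := by rw [← pow_mul]; norm_cast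
      _ ≤ ksq k ^ 2 := by gcongr

/-- The constant of the embedding of `D(A)` into absolutely convergent Fourier series. -/
def wienerConst : ℝ := √(∑' k : Freq, ((ksq k)⁻¹) ^ 2)

lemma wienerConst_nonneg : 0 ≤ wienerConst := Real.sqrt_nonneg _

/-- The sum of the absolute values of the Fourier coefficients. -/
def wienerNorm (u : L2) : ℝ := ∑' k, ‖fc u k‖

lemma wienerNorm_nonneg (u : L2) : 0 ≤ wienerNorm u := tsum_nonneg fun _ => norm_nonneg _

/-- Cauchy–Schwarz for `|û(k)| = |k|⁻² · |k|²|û(k)|`, which also holds at `k = 0` since the mean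
vanishes. This plays the role of the embedding of `H²` into `L^∞`. -/
lemma summable_norm_fc {u : L2} (h : MemDA u) :
    (Summable fun k => ‖fc u k‖) ∧ wienerNorm u ≤ wienerConst * ‖stokes u‖ := by
  have h1 := hasSum_norm_stokes_sq h
  have h2 := summable_mul_of_sq (f := fun k : Freq => (ksq k)⁻¹) (g := fun k => ksq k * ‖fc u k‖)
    (fun k => inv_nonneg.2 (ksq_nonneg k)) (fun k => mul_nonneg (ksq_nonneg k) (norm_nonneg _))
    summable_inv_ksq_sq (h1.summable.congr fun k => (mul_pow _ _ 2).symm)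
  have h3 : ∀ k, (ksq k)⁻¹ * (ksq k * ‖fc u k‖) = ‖fc u k‖ := fun k => by
    by_cases hk : k = 0
    · simp [hk, fc_zero_of_mem h.mem_H]
    · rw [inv_mul_cancel_left₀]
      have := one_le_ksq hk
      positivity
  simp_rw [h3, mul_pow] at h2
  rw [h1.tsum_eq, Real.sqrt_sq (norm_nonneg _)] at h2
  exact h2

/-- The normalized exponential as a bounded continuous function. -/
def expoBCF (k : Freq) : BoundedContinuousFunction Pt ℂ :=
  BoundedContinuousFunction.ofNormedAddCommGroup (expo k) (expo_continuous k) (2 * Real.pi)⁻¹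
    fun x => (norm_expo k x).le

lemma norm_expoBCF_le (k : Freq) : ‖expoBCF k‖ ≤ (2 * Real.pi)⁻¹ :=
  BoundedContinuousFunction.norm_ofNormedAddCommGroup_le _ (by positivity) _

lemma toLp_expoBCF (k : Freq) :
    BoundedContinuousFunction.toLp 2 dx ℂ (expoBCF k) = expoL k := by
  refine Lp.ext ?_
  filter_upwards [BoundedContinuousFunction.coeFn_toLp (p := 2) dx ℂ (expoBCF k),
    (memLp_of_continuous (expo_continuous k)).coeFn_toLp] with x h1 h2
  rw [h1, expoL, h2]
  rfl

/-- The Fourier series converges uniformly by absolute convergence and in `L²` by completeness; both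
limits agree almost everywhere. -/
lemma component_hasSum (u : L2) (h : Summable fun k => ‖fc u k‖) (j : Fin 2) :
    ∃ W : BoundedContinuousFunction Pt ℂ, (∀ x, HasSum (fun k => fc u k j * expo k x) (W x)) ∧
      (∀ᵐ x ∂dx, ((u x) j : ℂ) = W x) := by
  have h1 : Summable fun k => fc u k j • expoBCF k := by
    refine Summable.of_norm_bounded (h.mul_right (2 * Real.pi)⁻¹) fun k => ?_
    rw [norm_smul]
    exact mul_le_mul (PiLp.norm_apply_le (fc u k) j) (norm_expoBCF_le k) (norm_nonneg _)
      (norm_nonneg _)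
  obtain ⟨W, hW⟩ := h1
  refine ⟨W, fun x => ?_, ?_⟩
  · exact hW.mapL (BoundedContinuousFunction.evalCLM ℂ x)
  · have h2 := hW.mapL (BoundedContinuousFunction.toLp 2 dx ℂ)
    have h3 : HasSum (fun k => fc u k j • expoL k) (component j u) := by
      have := expoBasis.hasSum_repr (component j u)
      refine this.congr_fun fun k => ?_
      rw [HilbertBasis.repr_apply_apply, expoBasis_apply, fc_apply]
    have h4 := h3.unique (h2.congr_fun fun k => by rw [map_smul, toLp_expoBCF])
    filter_upwards [component_ae j u, BoundedContinuousFunction.coeFn_toLp (p := 2) dx ℂ W]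
      with x h5 h6
    rw [← h5, h4, h6]

lemma expo_periodic (k : Freq) : Periodic (expo k) := fun i x => by
  rw [expo, expo, phase_add_single]
  congr 1
  push_cast
  rw [mul_add, Complex.exp_add]
  have : Complex.exp (Complex.I * (k i * (2 * Real.pi))) = 1 := by
    rw [show Complex.I * (k i * (2 * Real.pi)) = k i * (2 * Real.pi * Complex.I) by ring]
    exact Complex.exp_int_mul_two_pi_mul_I _
  rw [this, mul_one]

lemma exists_continuous_version (u : L2) (h : Summable fun k => ‖fc u k‖) :
    ∃ w : Pt → Vec, Continuous w ∧ Periodic w ∧ u =ᵐ[dx] w ∧ ∀ x, ‖w x‖ ≤ wienerNorm u := by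
  choose W hW hW' using component_hasSum u h
  have hb : ∀ j x, ‖(W j x).re‖ ≤ (2 * Real.pi)⁻¹ * wienerNorm u := fun j x => by
    refine (Complex.abs_re_le_norm _).trans ?_
    refine (hW j x).norm_le_of_bounded (h.hasSum.mul_left (2 * Real.pi)⁻¹) fun k => ?_
    rw [norm_mul, norm_expo, mul_comm]
    gcongr
    exact PiLp.norm_apply_le (fc u k) j
  refine ⟨fun x => WithLp.toLp 2 fun j => (W j x).re, ?_, ?_, ?_, fun x => ?_⟩
  · exact (PiLp.continuous_toLp 2 _).comp
      (continuous_pi fun j => Complex.continuous_re.comp (W j).continuous)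
  · intro i x
    have : ∀ j, W j (x + Pi.single i (2 * Real.pi)) = W j x := fun j =>
      (hW j _).unique ((hW j x).congr_fun fun k => by rw [expo_periodic])
    simp only [this]
  · filter_upwards [hW' 0, hW' 1] with x h0 h1
    ext j
    fin_cases j
    · simp [← h0]
    · simp [← h1]
  · refine le_of_sq_le_sq ?_ (wienerNorm_nonneg u)
    rw [EuclideanSpace.norm_sq_eq, Fin.sum_univ_two]
    have h0 := hb 0 x
    have h1 := hb 1 x
    -- With `1/2` in place of `(2π)⁻¹`, the two squared components add up to at most half of
    -- `wienerNorm u ^ 2`.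
    have hp : (2 * Real.pi)⁻¹ ≤ 1 / 2 := by
      rw [inv_le_comm₀ (by positivity) (by norm_num)]
      linarith [Real.pi_gt_three]
    have h2 : (2 * Real.pi)⁻¹ * wienerNorm u ≤ 1 / 2 * wienerNorm u :=
      mul_le_mul_of_nonneg_right hp (wienerNorm_nonneg u)
    have h3 : ‖(W 0 x).re‖ ^ 2 ≤ (1 / 2 * wienerNorm u) ^ 2 := by
      have := h0.trans h2
      gcongr
    have h4 : ‖(W 1 x).re‖ ^ 2 ≤ (1 / 2 * wienerNorm u) ^ 2 := by
      have := h1.trans h2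
      gcongr
    dsimp only
    nlinarith [sq_nonneg (wienerNorm u)]

/-! ### Square integrability of the advection term and bilinearity of `B`. -/

lemma memLp_smul_of_bounded {a : Pt → ℝ} (ha : AEStronglyMeasurable a dx) {C : ℝ}
    (hC : ∀ᵐ x ∂dx, ‖a x‖ ≤ C) (v : L2) : MemLp (fun x => a x • v x) 2 dx :=
  (Lp.memLp v).smul (p := ⊤) (memLp_top_of_bound ha C hC)

lemma aestronglyMeasurable_apply (u : L2) (i : Fin 2) :
    AEStronglyMeasurable (fun x => (u x) i) dx :=
  (EuclideanSpace.proj i : Vec →L[ℝ] ℝ).continuous.comp_aestronglyMeasurable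
    (Lp.aestronglyMeasurable u)

lemma ae_norm_apply_le {u : L2} (h : MemDA u) (i : Fin 2) :
    ∀ᵐ x ∂dx, ‖(u x) i‖ ≤ wienerNorm u := by
  obtain ⟨w, -, -, h1, h2⟩ := exists_continuous_version u (summable_norm_fc h).1
  filter_upwards [h1] with x hx
  rw [hx]
  exact (PiLp.norm_apply_le (w x) i).trans (h2 x)

lemma memLp_advection {u : L2} (h : MemDA u) (v : L2) : MemLp (advection u v) 2 dx := by
  have : advection u v = ∑ i, fun x => (u x) i • weakD i v x := by
    ext1 x
    simp [advection]
  rw [this]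
  exact memLp_finsetSum' _ fun i _ =>
    memLp_smul_of_bounded (aestronglyMeasurable_apply u i) (ae_norm_apply_le h i) _

lemma B_eq {u : L2} (h : MemDA u) (v : L2) : B u v = leray ((memLp_advection h v).toLp _) :=
  dif_pos _

lemma B_mem (u v : L2) : B u v ∈ H := by
  unfold B
  split_ifs
  exacts [leray_mem _, H.zero_mem]

lemma B_add_left {u u' : L2} (h : MemDA u) (h' : MemDA u') (v : L2) :
    B (u + u') v = B u v + B u' v := by
  rw [B_eq h, B_eq h', B_eq (h.add h'), ← map_add, ← MemLp.toLp_add]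
  congr 1
  refine MemLp.toLp_congr _ _ ?_
  filter_upwards [Lp.coeFn_add u u'] with x hx
  simp only [advection, hx, Pi.add_apply, PiLp.add_apply, add_smul, Finset.sum_add_distrib]

lemma B_smul_left {u : L2} (h : MemDA u) (a : ℝ) (v : L2) : B (a • u) v = a • B u v := by
  rw [B_eq h, B_eq (h.smul a), ← map_smul, ← MemLp.toLp_const_smul]
  congr 1
  refine MemLp.toLp_congr _ _ ?_
  filter_upwards [Lp.coeFn_smul a u] with x hx
  simp only [advection, hx, Pi.smul_apply, PiLp.smul_apply, smul_eq_mul, Finset.smul_sum, smul_smul]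

lemma B_add_right {u v v' : L2} (h : MemDA u) (hv : MemH1 v) (hv' : MemH1 v') :
    B u (v + v') = B u v + B u v' := by
  rw [B_eq h, B_eq h, B_eq h, ← map_add, ← MemLp.toLp_add]
  congr 1
  refine MemLp.toLp_congr _ _ ?_
  filter_upwards [Lp.coeFn_add (weakD 0 v) (weakD 0 v'), Lp.coeFn_add (weakD 1 v) (weakD 1 v')]
    with x h0 h1
  simp only [advection, weakD_add hv hv', Pi.add_apply, Fin.sum_univ_two, h0, h1, smul_add]
  abel

lemma B_smul_right {u v : L2} (h : MemDA u) (a : ℝ) (hv : MemH1 v) :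
    B u (a • v) = a • B u v := by
  rw [B_eq h, B_eq h, ← map_smul, ← MemLp.toLp_const_smul]
  congr 1
  refine MemLp.toLp_congr _ _ ?_
  filter_upwards [Lp.coeFn_smul a (weakD 0 v), Lp.coeFn_smul a (weakD 1 v)] with x h0 h1
  simp only [advection, weakD_smul a hv, Pi.smul_apply, Fin.sum_univ_two, h0, h1, smul_add,
    smul_comm a]

/-! ### The trilinear form in Fourier variables -/

lemma norm_dot_le (a b : CVec) : ‖∑ j, a j * b j‖ ≤ ‖a‖ * ‖b‖ := by
  have h : ∀ j, ‖(WithLp.toLp 2 fun j => (starRingEnd ℂ) (a j) : CVec) j‖ = ‖a j‖ := fun j =>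
    RCLike.norm_conj _
  have h1 := norm_inner_le_norm (𝕜 := ℂ) (WithLp.toLp 2 fun j => (starRingEnd ℂ) (a j) : CVec) b
  have h2 : ‖(WithLp.toLp 2 fun j => (starRingEnd ℂ) (a j) : CVec)‖ = ‖a‖ := by
    rw [EuclideanSpace.norm_eq, EuclideanSpace.norm_eq]
    simp_rw [h]
  rw [h2] at h1
  refine le_trans (le_of_eq ?_) h1
  congr 1
  rw [PiLp.inner_apply]
  refine Finset.sum_congr rfl fun j _ => ?_
  rw [RCLike.inner_apply, Complex.conj_conj, mul_comm]

/-- A frequency as a complex vector. -/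
def freqVec (k : Freq) : CVec := WithLp.toLp 2 fun j => (k j : ℂ)

lemma norm_freqVec (k : Freq) : ‖freqVec k‖ = √(ksq k) := by
  rw [EuclideanSpace.norm_eq, ksq]
  congr 1
  refine Finset.sum_congr rfl fun j _ => ?_
  simp [freqVec]

lemma sqrt_ksq_add_le (p q : Freq) : √(ksq (-p - q)) ≤ √(ksq p) + √(ksq q) := by
  rw [← norm_freqVec, ← norm_freqVec, ← norm_freqVec, ← norm_neg (freqVec p)]
  refine le_trans (le_of_eq ?_) (norm_sub_le _ _)
  congr 1
  ext j
  simp [freqVec]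

/-- The Fourier summand of `2π ∫ (u · ∇) v · w`. -/
def triTerm (u v w : L2) (x : Freq × Freq) : ℂ :=
  Complex.I * (∑ i, fc u x.1 i * x.2 i) * ∑ j, fc v x.2 j * fc w (-x.1 - x.2) j

lemma norm_triTerm_le (u v w : L2) (x : Freq × Freq) :
    ‖triTerm u v w x‖ ≤ ‖fc u x.1‖ * (√(ksq x.2) * ‖fc v x.2‖) * ‖fc w (-x.1 - x.2)‖ := by
  rw [triTerm, norm_mul, norm_mul, Complex.norm_I, one_mul]
  have h1 := norm_dot_le (fc u x.1) (freqVec x.2)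
  rw [norm_freqVec] at h1
  have h2 := norm_dot_le (fc v x.2) (fc w (-x.1 - x.2))
  calc _ ≤ (‖fc u x.1‖ * √(ksq x.2)) * (‖fc v x.2‖ * ‖fc w (-x.1 - x.2)‖) :=
        mul_le_mul h1 h2 (norm_nonneg _) (by positivity)
    _ = _ := by ring

/-- Young's inequality for one `ℓ¹` and two `ℓ²` factors: Cauchy–Schwarz in `q` is uniform in `p` by
invariance under the reflection `q ↦ -p - q`, and the sum over `p` is the `ℓ¹` norm. The bounds on
`B` differ only in which factor is taken in `ℓ¹`. -/
lemma summable_triple {x y z : Freq → ℝ} (hx : ∀ k, 0 ≤ x k) (hy : ∀ k, 0 ≤ y k)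
    (hz : ∀ k, 0 ≤ z k) (sx : Summable x) (sy : Summable fun k => y k ^ 2)
    (sz : Summable fun k => z k ^ 2) :
    (Summable fun a : Freq × Freq => x a.1 * y a.2 * z (-a.1 - a.2)) ∧
      ∑' a : Freq × Freq, x a.1 * y a.2 * z (-a.1 - a.2)
        ≤ (∑' k, x k) * (√(∑' k, y k ^ 2) * √(∑' k, z k ^ 2)) := by
  have h1 : ∀ p, (Summable fun q => y q * z (-p - q)) ∧
      ∑' q, y q * z (-p - q) ≤ √(∑' k, y k ^ 2) * √(∑' k, z k ^ 2) := fun p => by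
    have e := (Equiv.subLeft (-p)).tsum_eq fun k => z k ^ 2
    have := summable_mul_of_sq (f := y) (g := fun q => z (-p - q)) hy (fun q => hz _) sy
      ((Equiv.subLeft (-p)).summable_iff.2 sz)
    simp only [Equiv.subLeft_apply] at e
    rwa [e] at this
  have h2 : Summable fun a : Freq × Freq => x a.1 * y a.2 * z (-a.1 - a.2) := by
    rw [summable_prod_of_nonneg fun a => mul_nonneg (mul_nonneg (hx _) (hy _)) (hz _)]
    constructor
    · intro p
      simp_rw [mul_assoc]
      exact (h1 p).1.mul_left _
    · simp_rw [mul_assoc, tsum_mul_left]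
      exact (sx.mul_right _).of_nonneg_of_le
        (fun p => mul_nonneg (hx p) (tsum_nonneg fun q => mul_nonneg (hy _) (hz _)))
        fun p => mul_le_mul_of_nonneg_left (h1 p).2 (hx p)
  refine ⟨h2, ?_⟩
  rw [h2.tsum_prod, ← tsum_mul_right]
  simp_rw [mul_assoc, tsum_mul_left]
  have h3 := (sx.mul_right (√(∑' k, y k ^ 2) * √(∑' k, z k ^ 2)))
  refine Summable.tsum_le_tsum (fun p => mul_le_mul_of_nonneg_left (h1 p).2 (hx p)) ?_ h3
  exact h3.of_nonneg_of_le
    (fun p => mul_nonneg (hx p) (tsum_nonneg fun q => mul_nonneg (hy _) (hz _)))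
    fun p => mul_le_mul_of_nonneg_left (h1 p).2 (hx p)

/-- The permutation of triads `p + q + r = 0` exchanging `q` and `r`. -/
def triadSwap : Freq × Freq ≃ Freq × Freq where
  toFun a := (a.1, -a.1 - a.2)
  invFun a := (a.1, -a.1 - a.2)
  left_inv a := Prod.ext rfl (by change -a.1 - (-a.1 - a.2) = a.2; abel)
  right_inv a := Prod.ext rfl (by change -a.1 - (-a.1 - a.2) = a.2; abel)

/-- The cyclic permutation of triads `p + q + r = 0`. -/
def triadCycle : Freq × Freq ≃ Freq × Freq where
  toFun a := (a.2, -a.1 - a.2)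
  invFun a := (-a.1 - a.2, a.1)
  left_inv a := Prod.ext (by change -a.2 - (-a.1 - a.2) = a.1; abel) rfl
  right_inv a := by ext <;> simp

lemma memLp_apply (u : L2) (l : Fin 2) : MemLp (fun x => (u x) l) 2 dx :=
  (EuclideanSpace.proj l : Vec →L[ℝ] ℝ).comp_memLp' (Lp.memLp u)

/-- The inner sum over `q` is Parseval for `v_l` against the conjugate of `e_p` times `w_l`; the
factor `(2π)⁻¹` comes from `e_p e_q = (2π)⁻¹ e_{p+q}`. The outer sum integrates the absolutely
convergent series of `u` term by term. The sum stays iterated because `v` and `w` are only in `L²`.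
-/
lemma hasSum_component_inner {u v w : L2} (hu : MemDA u) (i l : Fin 2) :
    ∃ S : Freq → ℂ,
      (∀ p, HasSum (fun q => fc v q l * ((2 * Real.pi : ℂ)⁻¹ * fc w (-p - q) l)) (S p)) ∧
      HasSum (fun p => fc u p i * S p)
        ((∫ x, (u x) i * ((v x) l * (w x) l) ∂dx : ℝ) : ℂ) := by
  have hprod : Integrable (fun x => component l v x * component l w x) dx := by
    have := (Lp.memLp (component l w)).smul (r := 1) (Lp.memLp (component l v))
    exact memLp_one_iff_integrable.1 this
  refine ⟨fun p => ∫ x, expo p x * (component l v x * component l w x) ∂dx, fun p => ?_, ?_⟩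
  · have hm : MemLp (fun x => (starRingEnd ℂ) (expo p x) • component l w x) 2 dx :=
      (Lp.memLp (component l w)).smul (p := ⊤) (memLp_top_of_bound
        (Complex.continuous_conj.comp (expo_continuous p)).aestronglyMeasurable (2 * Real.pi)⁻¹
        (Eventually.of_forall fun x => by rw [Function.comp_apply, RCLike.norm_conj, norm_expo]))
    have h1 := expoBasis.hasSum_inner_mul_inner (hm.toLp _) (component l v)
    have h2 : inner ℂ (hm.toLp _) (component l v)
        = ∫ x, expo p x * (component l v x * component l w x) ∂dx := by
      rw [L2.inner_def]
      refine integral_congr_ae ?_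
      filter_upwards [hm.coeFn_toLp, component_ae l w] with x hx hw
      rw [RCLike.inner_apply, hx, smul_eq_mul, map_mul, Complex.conj_conj, hw, Complex.conj_ofReal]
      ring
    rw [h2] at h1
    refine h1.congr_fun fun q => ?_
    rw [expoBasis_apply, mul_comm, fc_apply v q l]
    congr 1
    rw [← inner_conj_symm, inner_expoL, ← integral_conj, fc_eq_integral, ← integral_const_mul]
    refine integral_congr_ae ?_
    filter_upwards [hm.coeFn_toLp, component_ae l w] with x hx hw
    rw [hx, ← expo_neg, hw, neg_sub', neg_neg, sub_neg_eq_add]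
    simp only [smul_eq_mul, map_mul, Complex.conj_conj, Complex.conj_ofReal, expo]
    have : phase (p + q) x = phase p x + phase q x := by
      simp [phase, Fin.sum_univ_two]; ring
    rw [this]
    push_cast
    rw [mul_add, Complex.exp_add]
    ring
  · have h1 := (summable_norm_fc hu).1
    obtain ⟨W, hW, hW'⟩ := component_hasSum u h1 i
    have hint : ∀ p, Integrable
        (fun x => (fc u p i * expo p x) * (component l v x * component l w x)) dx := fun p =>
      hprod.bdd_mul ((expo_continuous p).aestronglyMeasurable.const_mul _)
        (c := ‖fc u p i‖ * (2 * Real.pi)⁻¹)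
        (Eventually.of_forall fun x => by rw [norm_mul, norm_expo])
    have h2 := hasSum_integral_of_summable_integral_norm (μ := dx)
      (F := fun p x => (fc u p i * expo p x) * (component l v x * component l w x)) hint (by
        simp_rw [norm_mul, norm_expo, integral_const_mul]
        refine Summable.mul_right _ (Summable.mul_right _ ?_)
        exact h1.of_nonneg_of_le (fun _ => norm_nonneg _) fun p => PiLp.norm_apply_le (fc u p) i)
    have h3 : ∫ x, ∑' p, (fc u p i * expo p x) * (component l v x * component l w x) ∂dx
        = ((∫ x, (u x) i * ((v x) l * (w x) l) ∂dx : ℝ) : ℂ) := by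
      refine Eq.trans ?_ (integral_ofReal (𝕜 := ℂ))
      refine integral_congr_ae ?_
      filter_upwards [hW', component_ae l v, component_ae l w] with x e1 e2 e3
      rw [((hW x).mul_right _).tsum_eq, ← e1, e2, e3]
      push_cast
      rfl
    rw [h3] at h2
    refine h2.congr_fun fun p => ?_
    rw [← integral_const_mul]
    simp_rw [mul_assoc]

lemma summable_triTerm {u v w : L2} (hu : Summable fun k => ‖fc u k‖) (hv : MemH1 v) :
    Summable (triTerm u v w) ∧
      ‖∑' x, triTerm u v w x‖ ≤ wienerNorm u * (normV v * ‖w‖) := by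
  have h := summable_triple (x := fun k => ‖fc u k‖) (y := fun k => √(ksq k) * ‖fc v k‖)
    (z := fun k => ‖fc w k‖) (fun _ => norm_nonneg _) (fun _ => by positivity)
    (fun _ => norm_nonneg _) hu
    ((hasSum_normV_sq hv).summable.congr fun k => by rw [mul_pow, Real.sq_sqrt (ksq_nonneg k)])
    (summable_norm_sq w)
  simp_rw [mul_pow, Real.sq_sqrt (ksq_nonneg _)] at h
  rw [(hasSum_normV_sq hv).tsum_eq, (hasSum_norm_sq w).tsum_eq, Real.sqrt_sq (norm_nonneg _),
    Real.sqrt_sq (normV_nonneg _)] at h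
  have h2 : Summable fun x => ‖triTerm u v w x‖ :=
    h.1.of_nonneg_of_le (fun _ => norm_nonneg _) fun x => norm_triTerm_le u v w x
  exact ⟨h2.of_norm, (norm_tsum_le_tsum_norm h2).trans
    ((h2.tsum_le_tsum (norm_triTerm_le u v w) h.1).trans h.2)⟩

/-- The projector drops out since `w ∈ H`. Absolute convergence merges the iterated sums into one
sum over pairs, which may then be reindexed by any permutation of triads. -/
lemma inner_B_eq_tsum {u v w : L2} (hu : MemDA u) (hv : MemH1 v) (hw : w ∈ H) :
    ((inner ℝ (B u v) w : ℝ) : ℂ) = (2 * Real.pi : ℂ)⁻¹ * ∑' x, triTerm u v w x := by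
  have h0 : inner ℝ (B u v) w = ∑ i, ∑ l, ∫ x, (u x) i * ((weakD i v x) l * (w x) l) ∂dx := by
    have hint : ∀ i l, Integrable (fun x => (u x) i * ((weakD i v x) l * (w x) l)) dx := by
      intro i l
      have : Integrable (fun x => (weakD i v x) l * (w x) l) dx := by
        have := (memLp_apply w l).smul (r := 1) (memLp_apply (weakD i v) l)
        exact memLp_one_iff_integrable.1 this
      exact this.bdd_mul (aestronglyMeasurable_apply u i) (ae_norm_apply_le hu i)
    rw [B_eq hu, inner_leray _ hw, L2.inner_def]
    simp_rw [← integral_finsetSum _ fun l _ => hint _ l]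
    rw [← integral_finsetSum _ fun i _ => integrable_finsetSum _ fun l _ => hint i l]
    refine integral_congr_ae ?_
    filter_upwards [(memLp_advection hu v).coeFn_toLp] with x hx
    rw [hx, advection, sum_inner]
    refine Finset.sum_congr rfl fun i _ => ?_
    rw [real_inner_smul_left, PiLp.inner_apply, Finset.mul_sum]
    refine Finset.sum_congr rfl fun l _ => ?_
    rw [real_inner_comm]
    simp
  choose S hS hS' using fun i l => hasSum_component_inner (v := weakD i v) (w := w) hu i l
  have h1 := hasSum_sum (s := Finset.univ) fun i _ => hasSum_sum (s := Finset.univ)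
    fun l _ => hS' i l
  have h2 : ((inner ℝ (B u v) w : ℝ) : ℂ)
      = ∑ i, ∑ l, ((∫ x, (u x) i * ((weakD i v x) l * (w x) l) ∂dx : ℝ) : ℂ) := by
    rw [h0]; push_cast; rfl
  rw [← h2] at h1
  have h3 := ((summable_triTerm (w := w) (summable_norm_fc hu).1 hv).1.hasSum.mul_left
    ((2 * Real.pi : ℂ)⁻¹))
  refine h1.unique (h3.prod_fiberwise fun p => ?_)
  have h4 := hasSum_sum (s := Finset.univ) fun i _ => hasSum_sum (s := Finset.univ)
    fun l _ => (hS i l p).mul_left (fc u p i)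
  refine h4.congr_fun fun q => ?_
  simp only [triTerm, fc_weakD hv, PiLp.smul_apply, smul_eq_mul, Fin.sum_univ_two]
  ring

/-! ### Estimates and cancellations of the nonlinear term -/

lemma inv_two_pi_le_one : (2 * Real.pi)⁻¹ ≤ 1 := by
  apply inv_le_one_of_one_le₀
  linarith [Real.pi_gt_three]

lemma abs_inner_B_le_norm_tsum {u v w : L2} (hu : MemDA u) (hv : MemH1 v) (hw : w ∈ H) :
    |inner ℝ (B u v) w| ≤ ‖∑' x, triTerm u v w x‖ := by
  have h := congrArg norm (inner_B_eq_tsum hu hv hw)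
  rw [Complex.norm_real, Real.norm_eq_abs, norm_mul, norm_inv, norm_mul, Complex.norm_real,
    Real.norm_of_nonneg Real.pi_pos.le, Complex.norm_ofNat] at h
  rw [h]
  exact mul_le_of_le_one_left (norm_nonneg _) inv_two_pi_le_one

lemma abs_inner_B_le {u v w : L2} (hu : MemDA u) (hv : MemH1 v) (hw : w ∈ H) :
    |inner ℝ (B u v) w| ≤ wienerConst * ‖stokes u‖ * normV v * ‖w‖ := by
  refine (abs_inner_B_le_norm_tsum hu hv hw).trans
    ((summable_triTerm (summable_norm_fc hu).1 hv).2.trans ?_)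
  rw [← mul_assoc]
  have := (summable_norm_fc hu).2
  have := normV_nonneg v
  gcongr

/-- Duality: `B u v` itself is an admissible third argument. -/
lemma norm_B_le {u v : L2} (hu : MemDA u) (hv : MemH1 v) :
    ‖B u v‖ ≤ wienerConst * ‖stokes u‖ * normV v := by
  have h := abs_inner_B_le hu hv (B_mem u v)
  rw [real_inner_self_eq_norm_sq, abs_of_nonneg (by positivity), sq] at h
  by_cases h0 : ‖B u v‖ = 0
  · rw [h0]
    have := normV_nonneg v
    have := wienerConst_nonneg
    positivity
  · exact le_of_mul_le_mul_right h (lt_of_le_of_ne (norm_nonneg _) (Ne.symm h0))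

/-- The reindexing `e` moves the factor that is to be measured in `ℓ¹` into the first slot. -/
lemma norm_tsum_triTerm_le {u v w : L2} {x y z : Freq → ℝ} (e : Freq × Freq ≃ Freq × Freq)
    (hx : ∀ k, 0 ≤ x k) (hy : ∀ k, 0 ≤ y k)
    (hz : ∀ k, 0 ≤ z k) (sx : Summable x) (sy : Summable fun k => y k ^ 2)
    (sz : Summable fun k => z k ^ 2)
    (h : ∀ a, ‖triTerm u v w (e a)‖ ≤ x a.1 * y a.2 * z (-a.1 - a.2)) :
    ‖∑' a, triTerm u v w a‖ ≤ (∑' k, x k) * (√(∑' k, y k ^ 2) * √(∑' k, z k ^ 2)) := by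
  have h1 := summable_triple hx hy hz sx sy sz
  have h2 : Summable fun a => ‖triTerm u v w (e a)‖ :=
    h1.1.of_nonneg_of_le (fun _ => norm_nonneg _) h
  rw [← e.tsum_eq]
  exact (norm_tsum_le_tsum_norm h2).trans ((h2.tsum_le_tsum h h1.1).trans h1.2)

/-- The cyclic estimate with the absolutely convergent Fourier series in the last slot. -/
lemma abs_inner_B_le_of_last {u v w : L2} (hu : MemDA u) (hv : MemH1 v) (hw : MemDA w) :
    |inner ℝ (B u v) w| ≤ wienerConst * ‖stokes w‖ * normV v * ‖u‖ := by
  refine (abs_inner_B_le_norm_tsum hu hv hw.mem_H).trans ?_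
  have h := norm_tsum_triTerm_le (u := u) (v := v) (w := w) (x := fun k => ‖fc w k‖)
    (y := fun k => ‖fc u k‖) (z := fun k => √(ksq k) * ‖fc v k‖)
    triadCycle (fun _ => norm_nonneg _) (fun _ => norm_nonneg _)
    (fun _ => by positivity) (summable_norm_fc hw).1 (summable_norm_sq u)
    ((hasSum_normV_sq hv).summable.congr fun k => by rw [mul_pow, Real.sq_sqrt (ksq_nonneg k)])
    fun a => by
      refine (norm_triTerm_le u v w _).trans (le_of_eq ?_)
      have : -a.2 - (-a.1 - a.2) = a.1 := by abel
      simp only [triadCycle, Equiv.coe_fn_mk, this]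
      ring
  simp_rw [mul_pow, Real.sq_sqrt (ksq_nonneg _)] at h
  rw [(hasSum_normV_sq hv).tsum_eq, (hasSum_norm_sq u).tsum_eq, Real.sqrt_sq (norm_nonneg _),
    Real.sqrt_sq (normV_nonneg _)] at h
  refine h.trans ?_
  have h2 := (summable_norm_fc hw).2
  have := normV_nonneg v
  calc wienerNorm w * (‖u‖ * normV v) ≤ (wienerConst * ‖stokes w‖) * (‖u‖ * normV v) := by gcongr
    _ = _ := by ring

/-- For a trigonometric polynomial `v` the form `⟨B(u,v),w⟩` is continuous in `L²`. -/
lemma abs_inner_B_le_of_middle {n : ℕ} {v : L2} (hv : v ∈ galerkinSpace n) :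
    ∃ C, 0 ≤ C ∧ ∀ u w, MemDA u → w ∈ H → |inner ℝ (B u v) w| ≤ C * ‖u‖ * ‖w‖ := by
  refine ⟨∑' k, √(ksq k) * ‖fc v k‖, tsum_nonneg fun _ => by positivity, fun u w hu hw => ?_⟩
  refine (abs_inner_B_le_norm_tsum hu (memDA_of_mem_galerkinSpace hv).memH1 hw).trans ?_
  have h := norm_tsum_triTerm_le (u := u) (v := v) (w := w) (x := fun k => √(ksq k) * ‖fc v k‖)
    (y := fun k => ‖fc u k‖) (z := fun k => ‖fc w k‖)
    (Equiv.prodComm _ _) (fun _ => by positivity) (fun _ => norm_nonneg _)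
    (fun _ => norm_nonneg _)
    (summable_of_ne_finset_zero (s := box n) fun k hk => by simp [hv.2 k hk]) (summable_norm_sq u)
    (summable_norm_sq w)
    fun a => by
      refine (norm_triTerm_le u v w _).trans (le_of_eq ?_)
      have : -a.2 - a.1 = -a.1 - a.2 := by abel
      simp only [Equiv.prodComm_apply, Prod.fst_swap, Prod.snd_swap, this]
      ring
  rwa [(hasSum_norm_sq w).tsum_eq, (hasSum_norm_sq u).tsum_eq, Real.sqrt_sq (norm_nonneg _),
    Real.sqrt_sq (norm_nonneg _), ← mul_assoc] at h

/-- Exchanging `q` and `r = -p - q` replaces `û(p) · q` by `û(p) · r`, and these are opposite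
because `û(p) · (q + r) = -û(p) · p = 0`. -/
lemma inner_B_antisymm {u v w : L2} (hu : MemDA u) (hv : MemV v) (hw : MemV w) :
    inner ℝ (B u v) w = - inner ℝ (B u w) v := by
  have h : ∑' x, triTerm u v w x = - ∑' x, triTerm u w v x := by
    rw [← triadSwap.tsum_eq, ← tsum_neg]
    congr 1
    ext x
    have h0 := ((mem_H_iff u).1 hu.mem_H).1 x.1
    have h1 : -x.1 - (-x.1 - x.2) = x.2 := by abel
    simp only [triTerm, triadSwap, Equiv.coe_fn_mk, h1]
    simp only [Fin.sum_univ_two, Pi.sub_apply, Pi.neg_apply, Int.cast_sub, Int.cast_neg] at h0 ⊢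
    linear_combination (-Complex.I * (fc v (-x.1 - x.2) 0 * fc w x.2 0
      + fc v (-x.1 - x.2) 1 * fc w x.2 1)) * h0
  have h1 := inner_B_eq_tsum hu hv.1 hw.2
  have h2 := inner_B_eq_tsum hu hw.1 hv.2
  have h3 : ((inner ℝ (B u v) w : ℝ) : ℂ) = ((- inner ℝ (B u w) v : ℝ) : ℂ) := by
    rw [h1, h, Complex.ofReal_neg, h2]; ring
  exact_mod_cast h3

lemma inner_B_self {u v : L2} (hu : MemDA u) (hv : MemV v) : inner ℝ (B u v) v = 0 := by
  have := inner_B_antisymm hu hv hv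
  linarith

/-- In two dimensions `k · û(k) = 0` forces `û(k)` to be a multiple of `(-k₂, k₁)`. Up to a factor,
`a` is the coefficient of the stream function. -/
lemma exists_stream_coeff {u : L2} (hu : u ∈ H) (k : Freq) :
    ∃ a : ℂ, fc u k 0 = -(a * k 1) ∧ fc u k 1 = a * k 0 := by
  have h := ((mem_H_iff u).1 hu).1 k
  simp only [Fin.sum_univ_two] at h
  by_cases h0 : (k 0 : ℂ) = 0
  · by_cases h1 : (k 1 : ℂ) = 0
    · have : k = 0 := by
        ext i
        fin_cases i
        · exact_mod_cast h0
        · exact_mod_cast h1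
      refine ⟨0, ?_⟩
      rw [this, fc_zero_of_mem hu]
      simp
    · refine ⟨-fc u k 0 / k 1, by field_simp, ?_⟩
      rw [h0] at h ⊢
      have : fc u k 1 = 0 := by simpa [h1] using h
      rw [this]; simp
  · refine ⟨fc u k 1 / k 0, ?_, by field_simp⟩
    field_simp
    linear_combination h

/-- The enstrophy cancellation in two dimensions. -/
lemma inner_B_stokes {n : ℕ} {u : L2} (hu : u ∈ galerkinSpace n) :
    inner ℝ (B u u) (stokes u) = 0 := by
  have hd := memDA_of_mem_galerkinSpace hu
  have hs := stokes_mem hd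
  have h1 := inner_B_eq_tsum hd hd.memH1 hs
  have h2 : HasSum (triTerm u u (stokes u)) (∑' x, triTerm u u (stokes u) x) :=
    (summable_triTerm (summable_norm_fc hd).1 hd.memH1).1.hasSum
  -- Symmetrization over the six permutations of the triad: a transposition here, the three cyclic
  -- shifts next. In terms of the stream coefficients the symmetrized summand is identically zero as
  -- a polynomial.
  have h3 := h2.add ((Equiv.prodComm _ _).hasSum_iff.2 h2)
  have h4 := (h3.add (triadCycle.hasSum_iff.2 h3)).add
    (triadCycle.hasSum_iff.2 (triadCycle.hasSum_iff.2 h3))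
  have h5 : ∑' x, triTerm u u (stokes u) x = 0 := by
    have h6 := h4.unique (a₂ := 0) (by
      convert hasSum_zero using 2 with x
      obtain ⟨p, q⟩ := x
      obtain ⟨a, ha0, ha1⟩ := exists_stream_coeff hd.mem_H p
      obtain ⟨b, hb0, hb1⟩ := exists_stream_coeff hd.mem_H q
      obtain ⟨c, hc0, hc1⟩ := exists_stream_coeff hd.mem_H (-p - q)
      have e1 : -q - (-p - q) = p := by abel
      have e2 : -(-p - q) - p = q := by abel
      have e3 : -q - p = -p - q := by abel
      have e4 : -p - (-p - q) = q := by abel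
      have e5 : -(-p - q) - q = p := by abel
      simp only [triTerm, triadCycle, Function.comp_apply, Equiv.prodComm_apply, Equiv.coe_fn_mk,
        Prod.swap, e1, e2, e3, e4, e5, fc_stokes hd, PiLp.smul_apply, smul_eq_mul,
        Fin.sum_univ_two, ha0, ha1, hb0, hb1, hc0, hc1, ksq]
      simp only [Pi.sub_apply, Pi.neg_apply]
      push_cast
      ring)
    linear_combination h6 / 6
  rw [h5, mul_zero] at h1
  exact_mod_cast h1

/-- Of the weight `|r|⁴` of `A²u`, three powers go into `z`. The fourth meets the `|q|` of the
derivative, and `|q||r| ≤ |q|(|p| + |q|) ≤ (3/2)|q|² + (1/2)|p|²` puts two powers on a single factor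
of `u`, leaving the other in `ℓ¹`. The constant is `3/2 + 1/2 = 2`. -/
lemma abs_inner_B_stokes_stokes_le {n : ℕ} {u : L2} (hu : u ∈ galerkinSpace n) :
    |inner ℝ (B u u) (stokes (stokes u))|
      ≤ 2 * wienerConst * ‖stokes u‖ ^ 2 * normV (stokes u) := by
  have hd := memDA_of_mem_galerkinSpace hu
  have hs := stokes_mem_galerkinSpace hu
  have hds := memDA_of_mem_galerkinSpace hs
  refine (abs_inner_B_le_norm_tsum hd hd.memH1 (stokes_mem hds)).trans ?_
  let z : Freq → ℝ := fun k => √(ksq k) * ‖fc (stokes u) k‖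
  let y : Freq → ℝ := fun k => ksq k * ‖fc u k‖
  have hz : ∀ k, 0 ≤ z k := fun k => by positivity
  have hy : ∀ k, 0 ≤ y k := fun k => mul_nonneg (ksq_nonneg k) (norm_nonneg _)
  have sy : HasSum (fun k => y k ^ 2) (‖stokes u‖ ^ 2) :=
    (hasSum_norm_stokes_sq hd).congr_fun fun k => by rw [mul_pow]
  have sz : HasSum (fun k => z k ^ 2) (normV (stokes u) ^ 2) :=
    (hasSum_normV_sq hds.memH1).congr_fun fun k => by rw [mul_pow, Real.sq_sqrt (ksq_nonneg k)]
  have h1 := summable_triple (x := fun k => ‖fc u k‖) (fun k => norm_nonneg _) hy hz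
    (summable_norm_fc hd).1 sy.summable sz.summable
  rw [sy.tsum_eq, sz.tsum_eq, Real.sqrt_sq (norm_nonneg _), Real.sqrt_sq (normV_nonneg _)] at h1
  have h2 : Summable fun a : Freq × Freq => ‖fc u a.2‖ * y a.1 * z (-a.1 - a.2) := by
    refine ((Equiv.prodComm _ _).summable_iff.2 h1.1).congr fun a => ?_
    have : -a.2 - a.1 = -a.1 - a.2 := by abel
    simp [this]
  have h2' : ∑' a : Freq × Freq, ‖fc u a.2‖ * y a.1 * z (-a.1 - a.2)
      ≤ wienerNorm u * (‖stokes u‖ * normV (stokes u)) := by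
    refine le_trans (le_of_eq ?_) h1.2
    rw [← (Equiv.prodComm _ _).tsum_eq]
    congr 1
    ext a
    have : -a.2 - a.1 = -a.1 - a.2 := by abel
    simp [this]
  have key : ∀ a, ‖triTerm u u (stokes (stokes u)) a‖ ≤
      3 / 2 * (‖fc u a.1‖ * y a.2 * z (-a.1 - a.2))
        + 1 / 2 * (‖fc u a.2‖ * y a.1 * z (-a.1 - a.2)) := fun a => by
    refine (norm_triTerm_le _ _ _ a).trans ?_
    have e1 : ‖fc (stokes (stokes u)) (-a.1 - a.2)‖
        = √(ksq (-a.1 - a.2)) * z (-a.1 - a.2) := by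
      rw [fc_stokes hds, norm_smul, Complex.norm_real, Real.norm_of_nonneg (ksq_nonneg _)]
      simp only [z]
      rw [← mul_assoc, Real.mul_self_sqrt (ksq_nonneg _)]
    rw [e1]
    have e2 := sqrt_ksq_add_le a.1 a.2
    have e3 := Real.mul_self_sqrt (ksq_nonneg a.1)
    have e4 := Real.mul_self_sqrt (ksq_nonneg a.2)
    have e5 : √(ksq a.2) * √(ksq (-a.1 - a.2)) ≤ 3 / 2 * ksq a.2 + 1 / 2 * ksq a.1 := by
      have := mul_le_mul_of_nonneg_left e2 (Real.sqrt_nonneg (ksq a.2))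
      nlinarith [sq_nonneg (√(ksq a.1) - √(ksq a.2))]
    have e6 : 0 ≤ ‖fc u a.1‖ * ‖fc u a.2‖ * z (-a.1 - a.2) := mul_nonneg (by positivity) (hz _)
    have := mul_le_mul_of_nonneg_right e5 e6
    simp only [y]
    nlinarith
  have h3 := (h1.1.mul_left (3 / 2)).add (h2.mul_left (1 / 2))
  have h4 : Summable fun a => ‖triTerm u u (stokes (stokes u)) a‖ :=
    h3.of_nonneg_of_le (fun _ => norm_nonneg _) key
  have h5 := (norm_tsum_le_tsum_norm h4).trans (h4.tsum_le_tsum key h3)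
  rw [(h1.1.mul_left (3 / 2)).tsum_add (h2.mul_left (1 / 2)), tsum_mul_left, tsum_mul_left] at h5
  have h6 := (summable_norm_fc hd).2
  have h7 : ∑' a : Freq × Freq, ‖fc u a.1‖ * y a.2 * z (-a.1 - a.2)
      ≤ wienerNorm u * (‖stokes u‖ * normV (stokes u)) := h1.2
  have h8 : 0 ≤ ‖stokes u‖ * normV (stokes u) := mul_nonneg (norm_nonneg _) (normV_nonneg _)
  have h9 := mul_le_mul_of_nonneg_right h6 h8
  nlinarith

/-! ### Absolutely continuous paths and the integral form of Gronwall's inequality -/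

lemma absolutelyContinuous_of_dist_le {X Y : Type*} [PseudoMetricSpace X] [PseudoMetricSpace Y]
    {f : ℝ → X} {G : ℝ → Y} {a b : ℝ} (hG : AbsolutelyContinuousOnInterval G a b)
    (h : ∀ s ∈ uIcc a b, ∀ r ∈ uIcc a b, dist (f s) (f r) ≤ dist (G s) (G r)) :
    AbsolutelyContinuousOnInterval f a b := by
  rw [absolutelyContinuousOnInterval_iff] at *
  intro ε hε
  obtain ⟨δ, hδ, H⟩ := hG ε hε
  refine ⟨δ, hδ, fun E hE hs => lt_of_le_of_lt (Finset.sum_le_sum fun i hi => ?_) (H E hE hs)⟩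
  have := hE.1 i hi
  exact h _ this.1 _ this.2

/-- The increments of the norm are dominated by those of the scalar primitive of `‖g‖`. -/
lemma absolutelyContinuous_norm_primitive {E : Type*} [NormedAddCommGroup E] [NormedSpace ℝ E]
    [CompleteSpace E] {g : ℝ → E} {a b : ℝ} (hg : IntervalIntegrable g volume a b) (x : E) :
    AbsolutelyContinuousOnInterval (fun t => ‖x + ∫ s in a..t, g s‖) a b := by
  refine absolutelyContinuous_of_dist_le (G := fun t => ∫ s in a..t, ‖g s‖)
    (hg.norm.absolutelyContinuousOnInterval_intervalIntegral left_mem_uIcc) fun s hs r hr => ?_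
  have hs' : IntervalIntegrable g volume a s := hg.mono_set (uIcc_subset_uIcc_left hs)
  have hr' : IntervalIntegrable g volume a r := hg.mono_set (uIcc_subset_uIcc_left hr)
  rw [Real.dist_eq, Real.dist_eq, intervalIntegral.integral_interval_sub_left hs'.norm hr'.norm]
  refine (abs_norm_sub_norm_le _ _).trans ?_
  rw [add_sub_add_left_eq_sub, intervalIntegral.integral_interval_sub_left hs' hr']
  exact intervalIntegral.norm_integral_le_abs_integral_norm

/-- The square of an absolutely continuous function is the integral of its derivative, which is
`2⟨w,g⟩` at almost every time by Lebesgue differentiation. -/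
lemma norm_sq_primitive {E : Type*} [NormedAddCommGroup E] [InnerProductSpace ℝ E]
    [CompleteSpace E] {w g : ℝ → E} {T : ℝ} (hg : IntervalIntegrable g volume 0 T)
    (hw : ∀ t ∈ Icc 0 T, w t = w 0 + ∫ s in (0 : ℝ)..t, g s) :
    ∀ t ∈ Icc 0 T, ‖w t‖ ^ 2 = ‖w 0‖ ^ 2 + ∫ s in (0 : ℝ)..t, 2 * inner ℝ (w s) (g s) := by
  intro t ht
  have hgt : IntervalIntegrable g volume 0 t :=
    hg.mono_set (uIcc_subset_uIcc_left (by rw [uIcc_of_le (ht.1.trans ht.2)]; exact ht))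
  let W : ℝ → E := fun t => w 0 + ∫ s in (0 : ℝ)..t, g s
  have h1 := absolutelyContinuous_norm_primitive hgt (w 0)
  have h2 := (h1.mul h1).integral_deriv_eq_sub
  have h3 : ∫ s in (0 : ℝ)..t, deriv ((fun t => ‖W t‖) * fun t => ‖W t‖) s
      = ∫ s in (0 : ℝ)..t, 2 * inner ℝ (w s) (g s) := by
    refine intervalIntegral.integral_congr_ae ?_
    filter_upwards [hgt.ae_hasDerivAt_integral] with s hs hs'
    have h4 : HasDerivAt W (g s) s :=
      (hs (uIoc_subset_uIcc hs') 0 left_mem_uIcc).const_add (w 0)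
    have h5 : ((fun t => ‖W t‖) * fun t => ‖W t‖) = fun t => ‖W t‖ ^ 2 := by
      ext t; simp [sq]
    rw [h5, h4.norm_sq.deriv]
    rw [uIoc_of_le ht.1] at hs'
    rw [hw s ⟨hs'.1.le, hs'.2.trans ht.2⟩]
  have h6 : W t = w t := (hw t ht).symm
  have h7 : W 0 = w 0 := by simp [W]
  have h8 : ∫ s in (0 : ℝ)..t, 2 * inner ℝ (w s) (g s) = ‖W t‖ * ‖W t‖ - ‖W 0‖ * ‖W 0‖ := by
    rw [← h3]; exact h2
  rw [h8, h6, h7]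
  ring

/-- With `Y` the right side of the hypothesis and `A` the primitive of `h`, almost everywhere `(Y
e^{-A})' = h (y - Y) e^{-A} ≤ 0`. As `h` is merely integrable, this is integrated by absolute
continuity of the product. -/
lemma gronwall_integral {y h : ℝ → ℝ} {c T : ℝ} (hh : IntervalIntegrable h volume 0 T)
    (hh0 : ∀ t, 0 ≤ h t) (hhy : IntervalIntegrable (fun t => h t * y t) volume 0 T)
    (hy : ∀ t ∈ Icc 0 T, y t ≤ c + ∫ s in (0 : ℝ)..t, h s * y s) :
    ∀ t ∈ Icc 0 T, y t ≤ c * Real.exp (∫ s in (0 : ℝ)..t, h s) := by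
  intro t ht
  have hsub : uIcc 0 t ⊆ uIcc 0 T :=
    uIcc_subset_uIcc_left (by rw [uIcc_of_le (ht.1.trans ht.2)]; exact ht)
  have hht := hh.mono_set hsub
  have hhyt := hhy.mono_set hsub
  let A : ℝ → ℝ := fun t => ∫ s in (0 : ℝ)..t, h s
  let Y : ℝ → ℝ := fun t => c + ∫ s in (0 : ℝ)..t, h s * y s
  have hA0 : ∀ s ∈ uIcc 0 t, 0 ≤ A s := fun s hs => by
    rw [uIcc_of_le ht.1] at hs
    exact intervalIntegral.integral_nonneg hs.1 fun r _ => hh0 r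
  have hA : AbsolutelyContinuousOnInterval A 0 t :=
    hht.absolutelyContinuousOnInterval_intervalIntegral left_mem_uIcc
  have hexp : AbsolutelyContinuousOnInterval (fun t => Real.exp (-A t)) 0 t := by
    refine absolutelyContinuous_of_dist_le hA fun s hs r hr => ?_
    -- The function `e^{-a}` is 1-Lipschitz on `a ≥ 0`, so `e^{-A}` inherits absolute continuity
    -- from `A`.
    have key : ∀ a b : ℝ, 0 ≤ a → a ≤ b → |Real.exp (-a) - Real.exp (-b)| ≤ |a - b| := by
      intro a b ha hab
      rw [abs_of_nonneg (by rw [sub_nonneg]; exact Real.exp_le_exp.2 (by linarith)),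
        abs_of_nonpos (by linarith)]
      have h1 := Real.add_one_le_exp (a - b)
      have h2 : Real.exp (-b) = Real.exp (-a) * Real.exp (a - b) := by
        rw [← Real.exp_add]; congr 1; ring
      have h3 : Real.exp (-a) ≤ 1 := Real.exp_le_one_iff.2 (by linarith)
      have h4 := Real.exp_pos (-a)
      rw [h2]
      nlinarith
    rw [Real.dist_eq, Real.dist_eq]
    rcases le_total (A s) (A r) with hsr | hsr
    · exact key _ _ (hA0 s hs) hsr
    · rw [abs_sub_comm, abs_sub_comm (A s)]
      exact key _ _ (hA0 r hr) hsr
  have hY : AbsolutelyContinuousOnInterval Y 0 t := by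
    refine absolutelyContinuous_of_dist_le
      (hhyt.absolutelyContinuousOnInterval_intervalIntegral left_mem_uIcc) fun s _ r _ => ?_
    simp only [Y, dist_add_left]
    exact le_rfl
  have h1 := hY.integral_deriv_mul_eq_sub hexp
  have h2 : ∫ x in (0 : ℝ)..t, deriv Y x * Real.exp (-A x)
      + Y x * deriv (fun t => Real.exp (-A t)) x ≤ 0 := by
    have : ∫ x in (0 : ℝ)..t, deriv Y x * Real.exp (-A x)
        + Y x * deriv (fun t => Real.exp (-A t)) x
        = ∫ x in (0 : ℝ)..t, -(h x * (Y x - y x) * Real.exp (-A x)) := by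
      refine intervalIntegral.integral_congr_ae ?_
      filter_upwards [hht.ae_hasDerivAt_integral, hhyt.ae_hasDerivAt_integral] with s h3 h4 hs
      have h5 : HasDerivAt A (h s) s := h3 (uIoc_subset_uIcc hs) 0 left_mem_uIcc
      have h6 : HasDerivAt Y (h s * y s) s :=
        (h4 (uIoc_subset_uIcc hs) 0 left_mem_uIcc).const_add c
      rw [h6.deriv, h5.fun_neg.exp.deriv]
      ring
    rw [this, intervalIntegral.integral_neg, neg_nonpos]
    refine intervalIntegral.integral_nonneg ht.1 fun s hs => ?_
    have := hy s ⟨hs.1, hs.2.trans ht.2⟩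
    exact mul_nonneg (mul_nonneg (hh0 s) (sub_nonneg.2 this)) (Real.exp_pos _).le
  rw [h1] at h2
  have h3 : Y 0 = c := by simp [Y]
  have h4 : A 0 = 0 := by simp [A]
  rw [h3, h4, neg_zero, Real.exp_zero, mul_one, sub_nonpos] at h2
  refine (hy t ht).trans ?_
  change Y t ≤ c * Real.exp (A t)
  rwa [Real.exp_neg, ← div_eq_mul_inv, div_le_iff₀ (Real.exp_pos _)] at h2

/-! ### Global solutions of dissipative ordinary differential equations -/

/-- The field is cut off outside a large ball, so that it is bounded and globally Lipschitz and
Picard–Lindelöf applies on all of `[0,T]`. The dissipativity bound confines the solution to the ball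
where the cutoff equals one. -/
lemma exists_global_solution {E : Type*} [NormedAddCommGroup E] [InnerProductSpace ℝ E]
    [FiniteDimensional ℝ E] {F : E → E} (hF : ContDiff ℝ 1 F) {c : ℝ}
    (hc : ∀ x, inner ℝ x (F x) ≤ c) (x₀ : E) {T : ℝ} (hT : 0 < T) :
    ∃ x : ℝ → E, x 0 = x₀ ∧ ∀ t ∈ Icc 0 T, HasDerivWithinAt x (F (x t)) (Icc 0 T) t := by
  have : CompleteSpace E := FiniteDimensional.complete ℝ E
  -- A nonnegative bound survives multiplication by the cutoff, whose values lie in `[0,1]`.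
  let c' := max c 0
  have hc' : ∀ x, inner ℝ x (F x) ≤ c' := fun x => (hc x).trans (le_max_left _ _)
  have hc0 : 0 ≤ c' := le_max_right _ _
  let R := √(‖x₀‖ ^ 2 + 2 * c' * T) + 1
  have hR : 0 < R := by positivity
  let χ : ContDiffBump (0 : E) := ⟨R, R + 1, hR, by linarith⟩
  let G : E → E := fun x => χ x • F x
  have hG : ContDiff ℝ 1 G := (χ.contDiff).smul hF
  have hGs : HasCompactSupport G := χ.hasCompactSupport.smul_right
  obtain ⟨K, hK⟩ := hG.lipschitzWith_of_hasCompactSupport hGs (by simp)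
  obtain ⟨M, hM⟩ := hG.continuous.bounded_above_of_compact_support hGs
  have hM0 : 0 ≤ M := (norm_nonneg _).trans (hM 0)
  -- The radius `M * T` is as far as a path of speed at most `M` can move in time `T`.
  have hP : IsPicardLindelof (fun _ : ℝ => G) (⟨0, left_mem_Icc.2 hT.le⟩ : Icc 0 T) x₀
      (⟨M * T, by positivity⟩) 0 ⟨M, hM0⟩ K :=
    { lipschitzOnWith := fun t _ => hK.lipschitzOnWith
      continuousOn := fun x _ => continuousOn_const
      norm_le := fun t _ x _ => hM x
      mul_max_le := by
        simp only [sub_zero, NNReal.coe_zero]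
        rw [max_eq_left (by linarith)]
        exact le_rfl }
  obtain ⟨x, hx0, hx⟩ := hP.exists_eq_forall_mem_Icc_hasDerivWithinAt₀
  change x 0 = x₀ at hx0
  refine ⟨x, hx0, fun t ht => ?_⟩
  have hbound : ‖x t‖ ^ 2 ≤ ‖x₀‖ ^ 2 + 2 * c' * T := by
    have h1 : AntitoneOn (fun t => ‖x t‖ ^ 2 - 2 * c' * t) (Icc 0 T) := by
      have hder : ∀ t ∈ Icc 0 T, HasDerivWithinAt (fun t => ‖x t‖ ^ 2 - 2 * c' * t)
          (2 * inner ℝ (x t) (G (x t)) - 2 * c') (Icc 0 T) t := fun t ht => by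
        have h2 := ((hasDerivAt_id t).const_mul (2 * c')).hasDerivWithinAt (s := Icc 0 T)
        rw [mul_one] at h2
        exact (hx t ht).norm_sq.sub h2
      refine antitoneOn_of_hasDerivWithinAt_nonpos (convex_Icc 0 T)
        (f' := fun t => 2 * inner ℝ (x t) (G (x t)) - 2 * c')
        (fun t ht => (hder t ht).continuousWithinAt)
        (fun t ht => (hder t (interior_subset ht)).mono interior_subset) fun t _ => ?_
      have h3 : inner ℝ (x t) (G (x t)) ≤ c' := by
        simp only [G]
        rw [real_inner_smul_right]
        have h4 := χ.nonneg (x := x t)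
        have h5 := χ.le_one (x := x t)
        have h6 := hc' (x t)
        nlinarith
      linarith
    have h2 := h1 (left_mem_Icc.2 hT.le) ht ht.1
    simp only [hx0, mul_zero, sub_zero] at h2
    have : 2 * c' * t ≤ 2 * c' * T := mul_le_mul_of_nonneg_left ht.2 (by positivity)
    linarith
  have h1 : x t ∈ Metric.closedBall (0 : E) R := by
    rw [mem_closedBall_zero_iff]
    have := Real.le_sqrt_of_sq_le hbound
    simp only [R]
    linarith
  have h2 : G (x t) = F (x t) := by
    simp only [G]
    rw [χ.one_of_mem_closedBall h1, one_smul]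
  rw [← h2]
  exact hx t ht

/-! ### Galerkin approximations -/

instance finiteDimensional_galerkinSpace (n : ℕ) : FiniteDimensional ℝ (galerkinSpace n) := by
  let φ : galerkinSpace n →ₗ[ℝ] (box n → CVec) :=
    { toFun := fun u k => fc u k
      map_add' := fun u v => by ext1 k; exact fc_add _ _ _
      map_smul' := fun a u => by
        ext1 k
        simp only [RingHom.id_apply, Pi.smul_apply]
        rw [Submodule.coe_smul, fc_smul, Complex.coe_smul] }
  refine FiniteDimensional.of_injective φ fun u v h => ?_
  refine Subtype.ext (fc_injective fun k => ?_)
  by_cases hk : k ∈ box n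
  · exact congrFun h ⟨k, hk⟩
  · rw [u.2.2 k hk, v.2.2 k hk]

/-- The nonlinear term on the Galerkin space. -/
def galerkinB (n : ℕ) : galerkinSpace n →L[ℝ] galerkinSpace n →L[ℝ] L2 :=
  LinearMap.toContinuousLinearMap
    ((LinearMap.toContinuousLinearMap (𝕜 := ℝ) (E := galerkinSpace n) (F' := L2)).toLinearMap ∘ₗ
      LinearMap.mk₂ ℝ (fun u v : galerkinSpace n => B (u : L2) (v : L2))
        (fun u u' _ => B_add_left (memDA_of_mem_galerkinSpace u.2)
          (memDA_of_mem_galerkinSpace u'.2) _)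
        (fun a u _ => B_smul_left (memDA_of_mem_galerkinSpace u.2) a _)
        (fun u v v' => B_add_right (memDA_of_mem_galerkinSpace u.2)
          (memDA_of_mem_galerkinSpace v.2).memH1 (memDA_of_mem_galerkinSpace v'.2).memH1)
        (fun a u v => B_smul_right (memDA_of_mem_galerkinSpace u.2) a
          (memDA_of_mem_galerkinSpace v.2).memH1))

lemma galerkinB_apply {n : ℕ} (u v : galerkinSpace n) : galerkinB n u v = B (u : L2) v := rfl

/-- A bilinear map on a finite-dimensional space is continuous. -/
lemma continuousOn_B {n : ℕ} {w : ℝ → L2} {s : Set ℝ} (hw : ContinuousOn w s)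
    (h : ∀ t ∈ s, w t ∈ galerkinSpace n) : ContinuousOn (fun t => B (w t) (w t)) s := by
  have h1 : Continuous fun t : s => (⟨w t, h t t.2⟩ : galerkinSpace n) :=
    (continuousOn_iff_continuous_domRestrict.1 hw).subtype_mk _
  have h2 : Continuous fun t : s => galerkinB n ⟨w t, h t t.2⟩ ⟨w t, h t t.2⟩ :=
    ((galerkinB n).continuous.comp h1).clm_apply h1
  refine continuousOn_iff_continuous_domRestrict.2 (h2.congr fun t => ?_)
  rw [galerkinB_apply]
  rfl

lemma stokes_eq_stokesCut {n : ℕ} {u : L2} (h : u ∈ galerkinSpace n) :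
    stokes u = stokesCut n u := (stokesCut_eq_stokes h).symm

lemma abs_inner_stokes_le {u v : L2} (hu : MemDA u) (hv : MemV v) :
    |inner ℝ (stokes u) v| ≤ normV u * normV v := by
  have h1 := hasSum_inner (stokes u) v
  have h2 := hasSum_normV_sq hu.memH1
  have h3 := hasSum_normV_sq hv.1
  have h4 := summable_mul_of_sq (f := fun k => √(ksq k) * ‖fc u k‖)
    (g := fun k => √(ksq k) * ‖fc v k‖) (fun _ => by positivity) (fun _ => by positivity)
    (h2.summable.congr fun k => by rw [mul_pow, Real.sq_sqrt (ksq_nonneg k)])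
    (h3.summable.congr fun k => by rw [mul_pow, Real.sq_sqrt (ksq_nonneg k)])
  simp_rw [mul_pow, Real.sq_sqrt (ksq_nonneg _)] at h4
  rw [h2.tsum_eq, h3.tsum_eq, Real.sqrt_sq (normV_nonneg u), Real.sqrt_sq (normV_nonneg v)] at h4
  refine le_trans ?_ h4.2
  rw [← Real.norm_eq_abs]
  refine h1.norm_le_of_bounded h4.1.hasSum fun k => ?_
  refine (Complex.abs_re_le_norm _).trans ((norm_inner_le_norm _ _).trans (le_of_eq ?_))
  rw [fc_stokes hu, norm_smul, Complex.norm_real, Real.norm_of_nonneg (ksq_nonneg k)]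
  linear_combination (-‖fc u k‖ * ‖fc v k‖) * Real.mul_self_sqrt (ksq_nonneg k)

lemma normV_trunc_le {u : L2} (h : MemV u) (n : ℕ) : normV (trunc n u) ≤ normV u := by
  classical
  refine le_of_sq_le_sq ?_ (normV_nonneg u)
  refine hasSum_le (fun k => ?_)
    (hasSum_normV_sq (memDA_of_mem_galerkinSpace (trunc_mem n h.2)).memH1) (hasSum_normV_sq h.1)
  rw [fc_trunc]
  split_ifs
  · exact le_rfl
  · rw [norm_zero, zero_pow two_ne_zero, mul_zero]
    exact mul_nonneg (ksq_nonneg k) (by positivity)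

lemma stokes_trunc {u : L2} (h : MemDA u) (n : ℕ) : stokes (trunc n u) = trunc n (stokes u) := by
  rw [← stokesCut_eq_stokes_trunc h.mem_H, stokesCut_eq_trunc_stokes h]

/-- `x` is the Galerkin approximation of level `n` with initial value `trunc n θ`. -/
structure IsGalerkinSolution (ν T : ℝ) (f θ : L2) (n : ℕ) (x : ℝ → L2) : Prop where
  mem : ∀ t ∈ Icc 0 T, x t ∈ galerkinSpace n
  initial : x 0 = trunc n θ
  hasDeriv : ∀ t ∈ Icc 0 T, HasDerivWithinAt x
    (trunc n (f - B (x t) (x t)) - ν • stokes (x t)) (Icc 0 T) t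

lemma exists_galerkinSolution {ν T : ℝ} (hν : 0 < ν) (hT : 0 < T) {f θ : L2} (hf : f ∈ H)
    (hθ : θ ∈ H) (n : ℕ) : ∃ x, IsGalerkinSolution ν T f θ n x := by
  let truncE : H →L[ℝ] galerkinSpace n :=
    ((trunc n).comp H.subtypeL).codRestrict (galerkinSpace n) fun u => trunc_mem n u.2
  let S : galerkinSpace n →L[ℝ] galerkinSpace n :=
    ((stokesCut n).comp (galerkinSpace n).subtypeL).codRestrict (galerkinSpace n)
      fun u => cutMul_mem n ksq ksq_neg u.2.1
  let BH : galerkinSpace n → H := fun u => ⟨galerkinB n u u, B_mem _ _⟩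
  let F : galerkinSpace n → galerkinSpace n := fun u =>
    truncE (⟨f, hf⟩ - BH u) - ν • S u
  have hBH : ContDiff ℝ 1 BH := by
    have h1 : ContDiff ℝ 1 fun u : galerkinSpace n => galerkinB n u u :=
      (galerkinB n).contDiff.clm_apply contDiff_id
    -- Smoothness as a map into the subspace `H` is obtained by composing with the orthogonal
    -- projection, which fixes the values.
    have h2 : BH = fun u => H.orthogonalProjectionOnto (galerkinB n u u) := by
      ext1 u
      exact (Submodule.orthogonalProjectionOnto_mem_subspace_eq_self (BH u)).symm
    rw [h2]
    exact (ContinuousLinearMap.contDiff _).comp h1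
  have hF : ContDiff ℝ 1 F :=
    (truncE.contDiff.comp (contDiff_const.sub hBH)).sub (S.contDiff.const_smul ν)
  have hval : ∀ u : galerkinSpace n,
      (F u : L2) = trunc n (f - B (u : L2) u) - ν • stokes (u : L2) := fun u => by
    rw [stokes_eq_stokesCut u.2]
    rfl
  -- Since `⟨B(u,u),u⟩ = 0`, Poincaré gives `⟨u, F u⟩ ≤ ‖f‖‖u‖ - ν‖u‖²`, whose maximum over `‖u‖` is
  -- `‖f‖²/(4ν)`.
  obtain ⟨x, hx0, hx⟩ := exists_global_solution hF (c := ‖f‖ ^ 2 / (4 * ν)) (fun u => by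
    have hu := memDA_of_mem_galerkinSpace u.2
    have h1 : inner ℝ u (F u) = inner ℝ (u : L2) (F u : L2) := rfl
    rw [h1, hval, inner_sub_right, real_inner_comm, inner_trunc n _ u.2, inner_sub_left,
      inner_B_self hu hu.2, inner_smul_right, ← normV_sq_eq_inner hu, sub_zero]
    have h2 := real_inner_le_norm f (u : L2)
    have h3 := norm_le_normV hu.2
    have h4 : ‖(u : L2)‖ ^ 2 ≤ normV (u : L2) ^ 2 := by gcongr
    rw [le_div_iff₀ (by positivity)]
    have h5 := mul_le_mul_of_nonneg_left h4 hν.le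
    nlinarith [sq_nonneg (‖f‖ - 2 * ν * ‖(u : L2)‖)])
    (truncE ⟨θ, hθ⟩) hT
  refine ⟨fun t => x t, fun t _ => (x t).2, ?_, fun t ht => ?_⟩
  · rw [hx0]
    rfl
  · have := (galerkinSpace n).subtypeL.hasFDerivAt.comp_hasDerivWithinAt t (hx t ht)
    change HasDerivWithinAt (fun t => (x t : L2)) (F (x t) : L2) (Icc 0 T) t at this
    rwa [hval] at this

namespace IsGalerkinSolution

variable {ν T : ℝ} {f θ : L2} {n : ℕ} {x : ℝ → L2}

lemma memDA (h : IsGalerkinSolution ν T f θ n x) {t : ℝ} (ht : t ∈ Icc 0 T) : MemDA (x t) :=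
  memDA_of_mem_galerkinSpace (h.mem t ht)

lemma continuousOn (h : IsGalerkinSolution ν T f θ n x) : ContinuousOn x (Icc 0 T) :=
  fun t ht => (h.hasDeriv t ht).continuousWithinAt

lemma continuousOn_stokes (h : IsGalerkinSolution ν T f θ n x) :
    ContinuousOn (fun t => stokes (x t)) (Icc 0 T) :=
  ((stokesCut n).continuous.comp_continuousOn h.continuousOn).congr
    fun t ht => stokes_eq_stokesCut (h.mem t ht)

lemma continuousOn_deriv (h : IsGalerkinSolution ν T f θ n x) :
    ContinuousOn (fun t => trunc n (f - B (x t) (x t)) - ν • stokes (x t)) (Icc 0 T) :=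
  ((trunc n).continuous.comp_continuousOn
    (continuousOn_const.sub (continuousOn_B h.continuousOn h.mem))).sub
    (h.continuousOn_stokes.const_smul ν)

lemma le_of_deriv_le {y y' φ : ℝ → ℝ} (hy : ∀ t ∈ Icc 0 T, HasDerivWithinAt y (y' t) (Icc 0 T) t)
    (hφ : ContinuousOn φ (Icc 0 T)) (h : ∀ t ∈ Icc 0 T, y' t ≤ φ t) :
    ∀ t ∈ Icc 0 T, y t ≤ y 0 + ∫ s in (0 : ℝ)..t, φ s := by
  intro t ht
  have hsub : Icc 0 t ⊆ Icc 0 T := Icc_subset_Icc_right ht.2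
  have := intervalIntegral.sub_le_integral_of_hasDeriv_right_of_le ht.1
    (fun s hs => (hy s (hsub hs)).continuousWithinAt.mono hsub)
    (fun s hs => ((hy s (hsub (Ioo_subset_Icc_self hs))).hasDerivAt
      (Icc_mem_nhds hs.1 (hs.2.trans_le ht.2))).hasDerivWithinAt)
    ((hφ.mono hsub).integrableOn_compact isCompact_Icc)
    (fun s hs => h s (hsub (Ioo_subset_Icc_self hs)))
  linarith

/-- The function is `‖x t‖_V²`, written with the bounded symmetric operator `stokesCut n` so that it
can be differentiated. The nonlinear term drops out by `inner_B_stokes`. -/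
lemma hasDeriv_normV_sq (h : IsGalerkinSolution ν T f θ n x) {t : ℝ} (ht : t ∈ Icc 0 T) :
    HasDerivWithinAt (fun t => inner ℝ (x t) (stokesCut n (x t)))
      (2 * (inner ℝ (stokes (x t)) f - ν * ‖stokes (x t)‖ ^ 2)) (Icc 0 T) t := by
  have hd := h.memDA ht
  have h1 := (h.hasDeriv t ht).inner ℝ
    ((stokesCut n).hasFDerivAt.comp_hasDerivWithinAt t (h.hasDeriv t ht))
  have hm := h.mem t ht
  have key : ∀ z, inner ℝ (x t) (stokesCut n z) = inner ℝ (stokesCut n (x t)) z := fun z => by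
    classical
    refine (hasSum_inner _ _).unique ((hasSum_inner _ _).congr_fun fun k => ?_)
    rw [stokesCut, fc_cutMul, fc_cutMul]
    split_ifs
    · rw [inner_smul_left, inner_smul_right, Complex.conj_ofReal]
    · rw [inner_zero_left, inner_zero_right]
  refine h1.congr_deriv ?_
  rw [Function.comp_apply, key, ← stokes_eq_stokesCut hm, real_inner_comm (stokes (x t)),
    ← two_mul, inner_sub_right,
    real_inner_comm, inner_trunc n _ (stokes_mem_galerkinSpace hm), inner_sub_left,
    inner_B_stokes hm, real_inner_smul_right, real_inner_self_eq_norm_sq, real_inner_comm, sub_zero]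

/-- The enstrophy estimate. -/
lemma normV_sq_add_le (h : IsGalerkinSolution ν T f θ n x) (hν : 0 < ν) (hθ : MemV θ) :
    ∀ t ∈ Icc 0 T, normV (x t) ^ 2 + ν * ∫ s in (0 : ℝ)..t, ‖stokes (x s)‖ ^ 2
      ≤ normV θ ^ 2 + T * (‖f‖ ^ 2 / ν) := by
  intro t ht
  have hc : ContinuousOn (fun t => ‖stokes (x t)‖ ^ 2) (Icc 0 T) := h.continuousOn_stokes.norm.pow 2
  have h1 := le_of_deriv_le (fun t ht => h.hasDeriv_normV_sq ht)
    -- Young's inequality spends half of the dissipation `2ν‖Ax‖²` on the forcing and keeps the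
    -- other half.
    (φ := fun t => ‖f‖ ^ 2 / ν - ν * ‖stokes (x t)‖ ^ 2)
    (continuousOn_const.sub (continuousOn_const.mul hc)) (fun t _ => by
      have h2 := real_inner_le_norm (stokes (x t)) f
      have h3 : 2 * (‖stokes (x t)‖ * ‖f‖) ≤ ν * ‖stokes (x t)‖ ^ 2 + ‖f‖ ^ 2 / ν := by
        have : 0 ≤ (ν * ‖stokes (x t)‖ - ‖f‖) ^ 2 / ν := by positivity
        have e : (ν * ‖stokes (x t)‖ - ‖f‖) ^ 2 / ν
          = ν * ‖stokes (x t)‖ ^ 2 + ‖f‖ ^ 2 / ν - 2 * (‖stokes (x t)‖ * ‖f‖) := by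
          field_simp; ring
        linarith
      linarith) t ht
  have h0 : (0 : ℝ) ∈ Icc 0 T := ⟨le_rfl, ht.1.trans ht.2⟩
  have hi : IntervalIntegrable (fun t => ‖stokes (x t)‖ ^ 2) volume 0 t :=
    (hc.mono (by rw [uIcc_of_le ht.1]; exact Icc_subset_Icc_right ht.2)).intervalIntegrable
  rw [← stokes_eq_stokesCut (h.mem t ht), ← normV_sq_eq_inner (h.memDA ht),
    ← stokes_eq_stokesCut (h.mem 0 h0), ← normV_sq_eq_inner (h.memDA h0), h.initial,
    intervalIntegral.integral_sub (by simp) (hi.const_mul ν),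
    intervalIntegral.integral_const, intervalIntegral.integral_const_mul, smul_eq_mul,
    sub_zero] at h1
  have h4 := normV_trunc_le hθ n
  have h5 : normV (trunc n θ) ^ 2 ≤ normV θ ^ 2 := by
    have := normV_nonneg (trunc n θ)
    gcongr
  have h6 : t * (‖f‖ ^ 2 / ν) ≤ T * (‖f‖ ^ 2 / ν) :=
    mul_le_mul_of_nonneg_right ht.2 (by positivity)
  linarith

lemma integral_stokes_sq_nonneg {t : ℝ} (ht : 0 ≤ t) (x : ℝ → L2) :
    0 ≤ ∫ s in (0 : ℝ)..t, ‖stokes (x s)‖ ^ 2 :=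
  intervalIntegral.integral_nonneg ht fun _ _ => by positivity

lemma normV_sq_le (h : IsGalerkinSolution ν T f θ n x) (hν : 0 < ν) (hθ : MemV θ) {t : ℝ}
    (ht : t ∈ Icc 0 T) : normV (x t) ^ 2 ≤ normV θ ^ 2 + T * (‖f‖ ^ 2 / ν) := by
  have h1 := h.normV_sq_add_le hν hθ t ht
  have := mul_nonneg hν.le (integral_stokes_sq_nonneg ht.1 x)
  linarith

lemma integral_stokes_sq_le (h : IsGalerkinSolution ν T f θ n x) (hν : 0 < ν) (hθ : MemV θ) {t : ℝ}
    (ht : t ∈ Icc 0 T) :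
    ∫ s in (0 : ℝ)..t, ‖stokes (x s)‖ ^ 2 ≤ (normV θ ^ 2 + T * (‖f‖ ^ 2 / ν)) / ν := by
  have h1 := h.normV_sq_add_le hν hθ t ht
  rw [le_div_iff₀ hν]
  nlinarith [sq_nonneg (normV (x t))]

lemma hasDeriv_stokes_sq (h : IsGalerkinSolution ν T f θ n x) {t : ℝ} (ht : t ∈ Icc 0 T) :
    HasDerivWithinAt (fun t => ‖stokesCut n (x t)‖ ^ 2)
      (2 * (inner ℝ (stokes (stokes (x t))) f - inner ℝ (B (x t) (x t)) (stokes (stokes (x t)))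
        - ν * normV (stokes (x t)) ^ 2)) (Icc 0 T) t := by
  classical
  have h1 := ((stokesCut n).hasFDerivAt.comp_hasDerivWithinAt t (h.hasDeriv t ht)).norm_sq
  have hm := h.mem t ht
  have hs := stokes_mem_galerkinSpace hm
  have hss := stokes_mem_galerkinSpace hs
  have hds := memDA_of_mem_galerkinSpace hs
  have key : ∀ z, inner ℝ (stokes (x t)) (stokesCut n z) = inner ℝ (stokes (stokes (x t))) z := by
    intro z
    rw [stokes_eq_stokesCut hs]
    refine (hasSum_inner _ _).unique ((hasSum_inner _ _).congr_fun fun k => ?_)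
    rw [stokesCut, fc_cutMul, fc_cutMul]
    split_ifs
    · rw [inner_smul_left, inner_smul_right, Complex.conj_ofReal]
    · rw [inner_zero_left, inner_zero_right]
  refine h1.congr_deriv ?_
  rw [Function.comp_apply, ← stokes_eq_stokesCut hm, key, inner_sub_right, real_inner_comm,
    inner_trunc n _ hss,
    inner_sub_left, inner_smul_right, real_inner_comm (stokes (x t)) (stokes (stokes (x t))),
    ← normV_sq_eq_inner hds, real_inner_comm]

/-- The `D(A)` estimate for regular initial values. -/
lemma stokes_sq_le (h : IsGalerkinSolution ν T f θ n x) (hν : 0 < ν) (hθ : MemDA θ)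
    (hf : MemV f) {t : ℝ} (ht : t ∈ Icc 0 T) :
    ‖stokes (x t)‖ ^ 2 ≤ (‖stokes θ‖ ^ 2 + T * (normV f ^ 2 / ν)) *
      Real.exp (4 * wienerConst ^ 2 / ν * ((normV θ ^ 2 + T * (‖f‖ ^ 2 / ν)) / ν)) := by
  have hT : 0 ≤ T := ht.1.trans ht.2
  have h0 : (0 : ℝ) ∈ Icc 0 T := ⟨le_rfl, hT⟩
  have hc : ContinuousOn (fun t => ‖stokes (x t)‖ ^ 2) (Icc 0 T) := h.continuousOn_stokes.norm.pow 2
  have hint : ∀ {φ : ℝ → ℝ}, ContinuousOn φ (Icc 0 T) → ∀ t ∈ Icc 0 T,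
      IntervalIntegrable φ volume 0 t := fun hφ t ht =>
    (hφ.mono (by rw [uIcc_of_le ht.1]; exact Icc_subset_Icc_right ht.2)).intervalIntegrable
  have hc1 : ContinuousOn (fun t => 4 * wienerConst ^ 2 / ν * ‖stokes (x t)‖ ^ 2) (Icc 0 T) :=
    continuousOn_const.mul hc
  have hT' : T ∈ Icc 0 T := ⟨hT, le_rfl⟩
  have h1 : ∀ t ∈ Icc 0 T, ‖stokes (x t)‖ ^ 2 ≤ (‖stokes θ‖ ^ 2 + T * (normV f ^ 2 / ν))
      + ∫ s in (0 : ℝ)..t, (4 * wienerConst ^ 2 / ν * ‖stokes (x s)‖ ^ 2) * ‖stokes (x s)‖ ^ 2 := by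
    intro t ht
    have h2 := le_of_deriv_le (fun t ht => h.hasDeriv_stokes_sq ht)
      (φ := fun t => normV f ^ 2 / ν
        + (4 * wienerConst ^ 2 / ν * ‖stokes (x t)‖ ^ 2) * ‖stokes (x t)‖ ^ 2)
      (continuousOn_const.add (hc1.mul hc)) (fun t ht => by
        have hm := h.mem t ht
        have hds := memDA_of_mem_galerkinSpace (stokes_mem_galerkinSpace hm)
        have e1 := (le_abs_self _).trans (abs_inner_stokes_le hds hf)
        have e2 := (neg_le_abs _).trans (abs_inner_B_stokes_stokes_le hm)
        set N := normV (stokes (x t))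
        set a := ‖stokes (x t)‖ ^ 2
        -- The two squares share the dissipation `2νN²` equally between the forcing and the
        -- nonlinear term.
        have e3 : 0 ≤ (ν * N - normV f) ^ 2 / ν := by positivity
        have e4 : 0 ≤ (ν * N - 2 * wienerConst * a) ^ 2 / ν := by positivity
        have e5 : (ν * N - normV f) ^ 2 / ν + (ν * N - 2 * wienerConst * a) ^ 2 / ν
            = normV f ^ 2 / ν + (4 * wienerConst ^ 2 / ν * a) * a
              - 2 * (N * normV f + 2 * wienerConst * a * N - ν * N ^ 2) := by
          field_simp; ring
        linarith) t ht
    have hi : IntervalIntegrable (fun s => (4 * wienerConst ^ 2 / ν * ‖stokes (x s)‖ ^ 2)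
      * ‖stokes (x s)‖ ^ 2) volume 0 t := hint (hc1.mul hc) t ht
    rw [← stokes_eq_stokesCut (h.mem t ht), ← stokes_eq_stokesCut (h.mem 0 h0), h.initial,
      stokes_trunc hθ, intervalIntegral.integral_add intervalIntegrable_const hi,
      intervalIntegral.integral_const, smul_eq_mul, sub_zero] at h2
    have h3 := norm_trunc_le n (stokes θ)
    have h4 : ‖trunc n (stokes θ)‖ ^ 2 ≤ ‖stokes θ‖ ^ 2 := by gcongr
    have h5 : t * (normV f ^ 2 / ν) ≤ T * (normV f ^ 2 / ν) :=
      mul_le_mul_of_nonneg_right ht.2 (by positivity)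
    linarith
  -- The inequality is quadratic in `‖Ax‖²`, but one factor serves as the Gronwall weight, and its
  -- integral is bounded by the enstrophy estimate.
  refine (gronwall_integral (hint hc1 T hT') (fun t => by positivity)
    (hint (hc1.mul hc) T hT') h1 t ht).trans ?_
  rw [intervalIntegral.integral_const_mul]
  have := h.integral_stokes_sq_le hν hθ.2 ht
  gcongr

end IsGalerkinSolution

/-! ### Stability in `L²` -/

lemma uIcc_subset_of_mem {T t : ℝ} (ht : t ∈ Icc 0 T) : uIcc 0 t ⊆ uIcc 0 T :=
  uIcc_subset_uIcc_left (by rw [uIcc_of_le (ht.1.trans ht.2)]; exact ht)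

lemma memLp_of_continuousOn {E : Type*} [NormedAddCommGroup E] {φ : ℝ → E} {T : ℝ}
    (h : ContinuousOn φ (Icc 0 T)) : MemLp φ 2 (volume.restrict (Ioc 0 T)) := by
  obtain ⟨C, hC⟩ := isCompact_Icc.exists_bound_of_continuousOn h
  refine MemLp.of_bound ?_ C ?_
  · exact (h.aestronglyMeasurable_of_isCompact isCompact_Icc measurableSet_Icc).mono_set
      Ioc_subset_Icc_self
  · exact (ae_restrict_iff' measurableSet_Ioc).2
      (Eventually.of_forall fun t ht => hC t (Ioc_subset_Icc_self ht))

lemma intervalIntegrable_of_memLp {E : Type*} [NormedAddCommGroup E] {φ : ℝ → E} {T : ℝ}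
    (hT : 0 ≤ T) (h : MemLp φ 2 (volume.restrict (Ioc 0 T))) : IntervalIntegrable φ volume 0 T := by
  rw [intervalIntegrable_iff_integrableOn_Ioc_of_le hT]
  exact h.integrable (by norm_num)

lemma intervalIntegrable_norm_sq_of_memLp {E : Type*} [NormedAddCommGroup E] {φ : ℝ → E} {T : ℝ}
    (hT : 0 ≤ T) (h : MemLp φ 2 (volume.restrict (Ioc 0 T))) :
    IntervalIntegrable (fun t => ‖φ t‖ ^ 2) volume 0 T := by
  rw [intervalIntegrable_iff_integrableOn_Ioc_of_le hT]
  exact h.integrable_norm_pow (by norm_num)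

lemma intervalIntegrable_inner {E : Type*} [NormedAddCommGroup E] [InnerProductSpace ℝ E]
    {w g : ℝ → E} {T : ℝ} (hT : 0 ≤ T) (hw : ContinuousOn w (Icc 0 T))
    (hg : IntervalIntegrable g volume 0 T) :
    IntervalIntegrable (fun t => inner ℝ (w t) (g t)) volume 0 T := by
  rw [intervalIntegrable_iff_integrableOn_Ioc_of_le hT] at *
  obtain ⟨C, hC⟩ := isCompact_Icc.exists_bound_of_continuousOn hw
  have hm : AEStronglyMeasurable w (volume.restrict (Ioc 0 T)) :=
    (hw.aestronglyMeasurable_of_isCompact isCompact_Icc measurableSet_Icc).mono_set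
      Ioc_subset_Icc_self
  refine (hg.norm.const_mul C).mono' (hm.inner hg.aestronglyMeasurable) ?_
  refine (ae_restrict_iff' measurableSet_Ioc).2 (Eventually.of_forall fun t ht => ?_)
  exact (norm_inner_le_norm _ _).trans
    (mul_le_mul_of_nonneg_right (hC t (Ioc_subset_Icc_self ht)) (norm_nonneg _))

lemma HasTimeDerivative.intervalIntegrable {T : ℝ} (hT : 0 ≤ T) {u g : ℝ → L2}
    (h : HasTimeDerivative T u g) : IntervalIntegrable g volume 0 T :=
  intervalIntegrable_of_memLp hT h.2.1

lemma HasTimeDerivative.continuousOn {T : ℝ} (hT : 0 ≤ T) {u g : ℝ → L2}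
    (h : HasTimeDerivative T u g) : ContinuousOn u (Icc 0 T) := by
  have h1 := intervalIntegral.continuousOn_primitive_interval' (h.intervalIntegrable hT)
    left_mem_uIcc
  rw [uIcc_of_le hT] at h1
  exact (continuousOn_const.add h1).congr h.2.2

/-- Common to stability of strong solutions (`b = 0`) and convergence of the Galerkin scheme (`b`
the truncation error). With `w = v - u`, `B(v,v) - B(u,u) = B(w,u) + B(v,w)`; the last term is
orthogonal to `w`, and `⟨B(w,u),w⟩ = -⟨B(w,w),u⟩` is at most a constant times `‖Au‖‖w‖_V‖w‖`. Hence
the exponent involves `u` only. -/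
lemma norm_sq_sub_le {ν T : ℝ} (hν : 0 < ν) (hT : 0 ≤ T) {u v gu gv : ℝ → L2}
    (hu : HasTimeDerivative T u gu) (hv : HasTimeDerivative T v gv)
    (su : SquareIntegrableInDA T u) (sv : SquareIntegrableInDA T v) {b : ℝ → ℝ}
    (hb : ∀ t, 0 ≤ b t) (hbi : IntervalIntegrable b volume 0 T)
    (h : ∀ᵐ t ∂volume.restrict (Ioc 0 T), inner ℝ (v t - u t) (gv t - gu t)
      ≤ - ν * normV (v t - u t) ^ 2 - inner ℝ (B (v t) (v t) - B (u t) (u t)) (v t - u t) + b t) :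
    ∀ t ∈ Icc 0 T, ‖v t - u t‖ ^ 2 ≤ (‖v 0 - u 0‖ ^ 2 + 2 * ∫ s in (0 : ℝ)..T, b s) *
      Real.exp (wienerConst ^ 2 / (2 * ν) * ∫ s in (0 : ℝ)..t, ‖stokes (u s)‖ ^ 2) := by
  have igu := hu.intervalIntegrable hT
  have igv := hv.intervalIntegrable hT
  have cu := hu.continuousOn hT
  have cv := hv.continuousOn hT
  have cw : ContinuousOn (fun t => v t - u t) (Icc 0 T) := cv.sub cu
  have h1 := norm_sq_primitive (w := fun t => v t - u t) (igv.sub igu) (fun t ht => by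
    have hs := uIcc_subset_of_mem ht
    rw [intervalIntegral.integral_sub (igv.mono_set hs) (igu.mono_set hs), hu.2.2 t ht,
      hv.2.2 t ht]
    abel)
  have i1 : IntervalIntegrable (fun s => 2 * inner ℝ (v s - u s) (gv s - gu s)) volume 0 T :=
    (intervalIntegrable_inner hT cw (igv.sub igu)).const_mul 2
  let ρ : ℝ → ℝ := fun s => wienerConst ^ 2 / (2 * ν) * ‖stokes (u s)‖ ^ 2
  have hρ0 : ∀ s, 0 ≤ ρ s := fun s => by positivity
  have iρ : IntervalIntegrable ρ volume 0 T :=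
    (intervalIntegrable_norm_sq_of_memLp hT su.2).const_mul _
  have iρw : IntervalIntegrable (fun s => ρ s * ‖v s - u s‖ ^ 2) volume 0 T := by
    refine iρ.mul_continuousOn ?_
    rw [uIcc_of_le hT]
    exact cw.norm.pow 2
  have key : ∀ᵐ s ∂volume.restrict (Ioc 0 T), 2 * inner ℝ (v s - u s) (gv s - gu s)
      ≤ ρ s * ‖v s - u s‖ ^ 2 + 2 * b s := by
    filter_upwards [h, su.1, sv.1] with s hs hus hvs
    have hws := hvs.sub hus
    have e1 : B (v s) (v s) - B (u s) (u s) = B (v s - u s) (u s) + B (v s) (v s - u s) := by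
      have e2 : B (v s) (v s) = B (v s) (u s) + B (v s) (v s - u s) := by
        rw [← B_add_right hvs hus.memH1 hws.memH1, add_sub_cancel]
      have e3 : B (v s) (u s) = B (u s) (u s) + B (v s - u s) (u s) := by
        rw [← B_add_left hus hws, add_sub_cancel]
      rw [e2, e3]; abel
    rw [e1, inner_add_left, inner_B_self hvs hws.2, inner_B_antisymm hws hus.2 hws.2] at hs
    have e4 := (le_abs_self _).trans (abs_inner_B_le_of_last hws hws.memH1 hus)
    set N := normV (v s - u s)
    set a := ‖stokes (u s)‖
    set y := ‖v s - u s‖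
    -- The full dissipation `2νN²` absorbs the factor `‖w‖_V`, which fixes the constant in `ρ`.
    have e5 : 0 ≤ (2 * ν * N - wienerConst * a * y) ^ 2 / (2 * ν) := by positivity
    have e6 : (2 * ν * N - wienerConst * a * y) ^ 2 / (2 * ν)
        = 2 * ν * N ^ 2 - 2 * (wienerConst * a * N * y)
          + wienerConst ^ 2 / (2 * ν) * a ^ 2 * y ^ 2 := by
      field_simp; ring
    simp only [ρ]
    linarith
  have h2 : ∀ t ∈ Icc 0 T, ‖v t - u t‖ ^ 2 ≤ (‖v 0 - u 0‖ ^ 2 + 2 * ∫ s in (0 : ℝ)..T, b s)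
      + ∫ s in (0 : ℝ)..t, ρ s * ‖v s - u s‖ ^ 2 := by
    intro t ht
    have hs := uIcc_subset_of_mem ht
    have e1 := intervalIntegral.integral_mono_ae_restrict ht.1 (i1.mono_set hs)
      ((iρw.mono_set hs).add ((hbi.mono_set hs).const_mul 2)) (by
        rw [← restrict_Ioc_eq_restrict_Icc]
        exact ae_restrict_of_ae_restrict_of_subset (Ioc_subset_Ioc_right ht.2) key)
    rw [intervalIntegral.integral_add (iρw.mono_set hs) ((hbi.mono_set hs).const_mul 2),
      intervalIntegral.integral_const_mul 2 b] at e1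
    have e2 : ∫ s in (0 : ℝ)..t, b s ≤ ∫ s in (0 : ℝ)..T, b s :=
      intervalIntegral.integral_mono_interval le_rfl ht.1 ht.2
        (Eventually.of_forall hb) hbi
    have := h1 t ht
    linarith
  intro t ht
  have := gronwall_integral iρ hρ0 iρw h2 t ht
  rwa [intervalIntegral.integral_const_mul] at this

lemma IsStrongSolution.norm_sub_sq_le {ν T : ℝ} (hν : 0 < ν) (hT : 0 ≤ T) {f θ ϑ : L2}
    {u v : ℝ → L2} (hu : IsStrongSolution ν T f θ u) (hv : IsStrongSolution ν T f ϑ v) :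
    ∀ t ∈ Icc 0 T, ‖v t - u t‖ ^ 2 ≤ ‖ϑ - θ‖ ^ 2 *
      Real.exp (wienerConst ^ 2 / (2 * ν) * ∫ s in (0 : ℝ)..t, ‖stokes (u s)‖ ^ 2) := by
  obtain ⟨gu, hgu, equ⟩ := hu.equation
  obtain ⟨gv, hgv, eqv⟩ := hv.equation
  have := norm_sq_sub_le hν hT hgu hgv hu.squareIntegrableInDA hv.squareIntegrableInDA
    (b := fun _ => 0) (fun _ => le_rfl) (by simp) (by
      filter_upwards [equ, eqv, hu.squareIntegrableInDA.1, hv.squareIntegrableInDA.1]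
        with s e1 e2 hus hvs
      have e3 : gv s - gu s
          = -(ν • stokes (v s - u s)) - (B (v s) (v s) - B (u s) (u s)) := by
        rw [stokes_sub hvs hus, eq_sub_of_add_eq (eq_sub_of_add_eq e1),
          eq_sub_of_add_eq (eq_sub_of_add_eq e2), smul_sub]
        abel
      rw [e3, inner_sub_right, inner_neg_right, real_inner_smul_right,
        normV_sq_eq_inner (hvs.sub hus), real_inner_comm (v s - u s) (B (v s) (v s) - _)]
      linarith)
  simpa [hu.initial, hv.initial] using this

lemma IsStrongSolution.eqOn {ν T : ℝ} (hν : 0 < ν) (hT : 0 ≤ T) {f θ : L2}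
    {u v : ℝ → L2} (hu : IsStrongSolution ν T f θ u) (hv : IsStrongSolution ν T f θ v) :
    EqOn v u (Icc 0 T) := by
  intro t ht
  have := hu.norm_sub_sq_le hν hT hv t ht
  rw [sub_self, norm_zero, zero_pow two_ne_zero, zero_mul] at this
  rw [← sub_eq_zero, ← norm_eq_zero]
  exact pow_eq_zero_iff two_ne_zero |>.1 (le_antisymm this (by positivity))

/-! ### Convergence of the Galerkin approximations -/

namespace IsGalerkinSolution

variable {ν T : ℝ} {f θ : L2} {n : ℕ} {x : ℝ → L2}

lemma hasTimeDerivative (h : IsGalerkinSolution ν T f θ n x) (hf : f ∈ H) :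
    HasTimeDerivative T x (fun t => trunc n (f - B (x t) (x t)) - ν • stokes (x t)) := by
  refine ⟨?_, memLp_of_continuousOn h.continuousOn_deriv, fun t ht => ?_⟩
  · refine (ae_restrict_iff' measurableSet_Ioc).2 (Eventually.of_forall fun t ht => ?_)
    exact H.sub_mem (trunc_mem n (H.sub_mem hf (B_mem _ _))).1
      (H.smul_mem ν (stokes_mem (h.memDA (Ioc_subset_Icc_self ht))))
  · have hsub : Icc 0 t ⊆ Icc 0 T := Icc_subset_Icc_right ht.2
    have := intervalIntegral.integral_eq_sub_of_hasDeriv_right_of_le ht.1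
      (h.continuousOn.mono hsub)
      (fun s hs => ((h.hasDeriv s (hsub (Ioo_subset_Icc_self hs))).hasDerivAt
        (Icc_mem_nhds hs.1 (hs.2.trans_le ht.2))).hasDerivWithinAt)
      ((h.continuousOn_deriv.mono (by rwa [uIcc_of_le ht.1])).intervalIntegrable)
    rw [this]
    abel

lemma squareIntegrableInDA (h : IsGalerkinSolution ν T f θ n x) : SquareIntegrableInDA T x :=
  ⟨(ae_restrict_iff' measurableSet_Ioc).2
    (Eventually.of_forall fun _ ht => h.memDA (Ioc_subset_Icc_self ht)),
    memLp_of_continuousOn h.continuousOn_stokes⟩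

/-- The Galerkin approximations form a Cauchy sequence in `C([0,T]; L²)`. -/
lemma norm_sub_sq_le {m : ℕ} {x' : ℝ → L2} (h : IsGalerkinSolution ν T f θ n x)
    (h' : IsGalerkinSolution ν T f θ m x') (hnm : n ≤ m) (hn : 0 < n) (hν : 0 < ν) (hT : 0 ≤ T)
    (hf : f ∈ H) (hθ : MemV θ) {M : ℝ} (hM : 0 ≤ M)
    (hM2 : normV θ ^ 2 + T * (‖f‖ ^ 2 / ν) ≤ M ^ 2) :
    ∀ t ∈ Icc 0 T, ‖x' t - x t‖ ^ 2 ≤ (‖trunc m θ - trunc n θ‖ ^ 2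
      + 2 * (M / n * (T * (‖f‖ + wienerConst * M) + wienerConst * M * (M ^ 2 / ν)))) *
      Real.exp (wienerConst ^ 2 / (2 * ν) * (M ^ 2 / ν)) := by
  have hn' : (0 : ℝ) < n := by exact_mod_cast hn
  have hw := wienerConst_nonneg
  have hVle : ∀ {k : ℕ} {z : ℝ → L2}, IsGalerkinSolution ν T f θ k z → ∀ t ∈ Icc 0 T,
      normV (z t) ≤ M := fun hz t ht =>
    le_of_sq_le_sq ((hz.normV_sq_le hν hθ ht).trans hM2) hM
  have hSle : ∀ t ∈ Icc 0 T, ∫ s in (0 : ℝ)..t, ‖stokes (x s)‖ ^ 2 ≤ M ^ 2 / ν := fun t ht =>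
    (h.integral_stokes_sq_le hν hθ ht).trans (by gcongr)
  -- The coarse equation truncates `f - B(x,x)` at level `n`, which costs its pairing with the modes
  -- of `x'` outside `box n`. These have norm at most `M/n`. In the bound for `B(x,x)`, `‖Ax‖` is
  -- replaced by `1 + ‖Ax‖²`, whose integral is controlled.
  let b : ℝ → ℝ := fun t =>
    M / n * ((‖f‖ + wienerConst * M) + wienerConst * M * ‖stokes (x t)‖ ^ 2)
  have iS := intervalIntegrable_norm_sq_of_memLp hT h.squareIntegrableInDA.2
  have hb : ∀ t, 0 ≤ b t := fun t => by positivity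
  have hbi : IntervalIntegrable b volume 0 T :=
    (intervalIntegrable_const.add (iS.const_mul _)).const_mul _
  have hbint : ∫ s in (0 : ℝ)..T, b s
      ≤ M / n * (T * (‖f‖ + wienerConst * M) + wienerConst * M * (M ^ 2 / ν)) := by
    simp only [b]
    rw [intervalIntegral.integral_const_mul,
      intervalIntegral.integral_add intervalIntegrable_const (iS.const_mul _),
      intervalIntegral.integral_const, intervalIntegral.integral_const_mul, smul_eq_mul, sub_zero]
    have := hSle T ⟨hT, le_rfl⟩
    gcongr
  intro t ht
  have h1 := norm_sq_sub_le hν hT (h.hasTimeDerivative hf) (h'.hasTimeDerivative hf)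
    h.squareIntegrableInDA h'.squareIntegrableInDA hb hbi
    ((ae_restrict_iff' measurableSet_Ioc).2 (Eventually.of_forall fun s hs => by
      have hs := Ioc_subset_Icc_self hs
      have d := h.memDA hs
      have d' := h'.memDA hs
      have hwm : x' s - x s ∈ galerkinSpace m :=
        (galerkinSpace m).sub_mem (h'.mem s hs) (galerkinSpace_mono hnm (h.mem s hs))
      have ht : trunc n (x' s - x s) = trunc n (x' s) - x s := by
        rw [map_sub, trunc_eq_self (h.mem s hs)]
      have e1 : inner ℝ (trunc n (f - B (x s) (x s))) (x' s - x s)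
          = inner ℝ (f - B (x s) (x s)) (trunc n (x' s - x s)) := by
        have hm := trunc_mem n hwm.1
        rw [← inner_trunc n _ hm]
        have h0 : trunc n (f - B (x s) (x s)) ∈ galerkinSpace n :=
          trunc_mem n (H.sub_mem hf (B_mem _ _))
        rw [real_inner_comm, ← inner_trunc n _ h0, real_inner_comm]
      have e2 : inner ℝ (f - B (x s) (x s)) (x' s - x s)
          - inner ℝ (f - B (x s) (x s)) (trunc n (x' s - x s)) ≤ b s := by
        rw [← inner_sub_right, ht]
        have e3 : x' s - x s - (trunc n (x' s) - x s) = x' s - trunc n (x' s) := by abel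
        rw [e3]
        refine (real_inner_le_norm _ _).trans ?_
        have e4 := (norm_sub_trunc_le d'.2 n).trans (hVle h' s hs)
        have e5 : ‖x' s - trunc n (x' s)‖ ≤ M / n := by
          rw [le_div_iff₀ hn']; linarith
        have e6 := (norm_sub_le f (B (x s) (x s))).trans
          (add_le_add_right (norm_B_le d d.memH1) _)
        have e7 := hVle h s hs
        have e8 : wienerConst * ‖stokes (x s)‖ * normV (x s)
            ≤ wienerConst * M * (1 + ‖stokes (x s)‖ ^ 2) := by
          have e9 : ‖stokes (x s)‖ ≤ 1 + ‖stokes (x s)‖ ^ 2 := by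
            nlinarith [sq_nonneg (‖stokes (x s)‖ - 1)]
          calc _ ≤ wienerConst * (1 + ‖stokes (x s)‖ ^ 2) * M := by
                  have := normV_nonneg (x s)
                  gcongr
            _ = _ := by ring
        calc _ ≤ (‖f‖ + wienerConst * M * (1 + ‖stokes (x s)‖ ^ 2)) * (M / n) :=
              mul_le_mul (e6.trans (by linarith)) e5 (norm_nonneg _) (by positivity)
          _ = b s := by simp only [b]; ring
      have e3 : inner ℝ (stokes (x' s - x s)) (x' s - x s) = normV (x' s - x s) ^ 2 := by
        rw [normV_sq_eq_inner (d'.sub d), real_inner_comm]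
      have e4 : trunc m (f - B (x' s) (x' s)) - ν • stokes (x' s)
          - (trunc n (f - B (x s) (x s)) - ν • stokes (x s))
          = trunc m (f - B (x' s) (x' s)) - trunc n (f - B (x s) (x s))
            - ν • stokes (x' s - x s) := by
        rw [stokes_sub d' d, smul_sub]; abel
      rw [e4, real_inner_comm, inner_sub_left, inner_sub_left, inner_trunc m _ hwm, e1,
        real_inner_smul_left, e3, inner_sub_left (B (x' s) (x' s))]
      rw [inner_sub_left f] at e2 ⊢
      linarith)) t ht
  refine h1.trans ?_
  rw [h.initial, h'.initial]
  have := hSle t ht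
  have h0 : 0 ≤ ∫ s in (0 : ℝ)..T, b s := intervalIntegral.integral_nonneg hT fun s _ => hb s
  gcongr

end IsGalerkinSolution

/-! ### Regularity from truncations -/

lemma norm_cutMul_sq (n : ℕ) (w : Freq → ℝ) (hw : ∀ k, w (-k) = w k) (u : L2) :
    ‖cutMul n w hw u‖ ^ 2 = ∑ k ∈ box n, w k ^ 2 * ‖fc u k‖ ^ 2 := by
  classical
  refine (hasSum_norm_sq _).unique ?_
  rw [← Finset.sum_congr rfl fun k hk => ?_]
  · refine hasSum_sum_of_ne_finset_zero fun k hk => ?_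
    rw [fc_cutMul, if_neg hk, norm_zero, zero_pow two_ne_zero]
  · rw [fc_cutMul, if_pos hk, norm_ofReal_smul_sq]

lemma norm_stokesCut_sq (n : ℕ) (u : L2) :
    ‖stokesCut n u‖ ^ 2 = ∑ k ∈ box n, ksq k ^ 2 * ‖fc u k‖ ^ 2 := norm_cutMul_sq ..

/-- The square root of the Stokes operator cut off to `box n`. -/
def sqrtStokesCut (n : ℕ) : L2 →L[ℝ] L2 :=
  cutMul n (fun k => √(ksq k)) fun k => by rw [ksq_neg]

lemma norm_sqrtStokesCut_sq (n : ℕ) (u : L2) :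
    ‖sqrtStokesCut n u‖ ^ 2 = ∑ k ∈ box n, ksq k * ‖fc u k‖ ^ 2 := by
  rw [sqrtStokesCut, norm_cutMul_sq]
  simp_rw [Real.sq_sqrt (ksq_nonneg _)]

lemma inner_sqrtStokesCut (n : ℕ) (u v : L2) :
    inner ℝ (sqrtStokesCut n u) (sqrtStokesCut n v) = inner ℝ (stokesCut n u) v := by
  classical
  refine (hasSum_inner _ _).unique ((hasSum_inner _ _).congr_fun fun k => ?_)
  rw [sqrtStokesCut, stokesCut, fc_cutMul, fc_cutMul, fc_cutMul]
  split_ifs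
  · rw [inner_smul_left, inner_smul_right, inner_smul_left, ← mul_assoc, Complex.conj_ofReal,
      Complex.conj_ofReal, ← Complex.ofReal_mul, Real.mul_self_sqrt (ksq_nonneg k)]
  · simp

lemma summable_of_sum_box_le {a : Freq → ℝ} (ha : ∀ k, 0 ≤ a k) {C : ℝ}
    (h : ∀ n, ∑ k ∈ box n, a k ≤ C) : Summable a := by
  refine summable_of_sum_le (c := C) ha fun s => ?_
  obtain ⟨n, hn⟩ := (tendsto_box.eventually (eventually_ge_atTop s)).exists
  exact (Finset.sum_le_sum_of_subset_of_nonneg hn fun k _ _ => ha k).trans (h n)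

lemma norm_stokesCut_mono {m n : ℕ} (h : m ≤ n) (u : L2) : ‖stokesCut m u‖ ≤ ‖stokesCut n u‖ := by
  refine le_of_sq_le_sq ?_ (norm_nonneg _)
  rw [norm_stokesCut_sq, norm_stokesCut_sq]
  exact Finset.sum_le_sum_of_subset_of_nonneg (box_mono h) fun _ _ _ => by positivity

lemma tendsto_stokesCut {u : L2} (h : MemDA u) :
    Tendsto (fun n => stokesCut n u) atTop (𝓝 (stokes u)) := by
  simp_rw [stokesCut_eq_trunc_stokes h]
  exact tendsto_trunc _

lemma norm_stokesCut_le {u : L2} (h : MemDA u) (n : ℕ) : ‖stokesCut n u‖ ≤ ‖stokes u‖ := by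
  rw [stokesCut_eq_trunc_stokes h]
  exact norm_trunc_le _ _

/-- Each cutoff is bounded on `L²`, so bounds in this form pass to `L²` limits; the analogue for `V`
uses `sqrtStokesCut`. -/
lemma memDA_of_norm_stokesCut_le {u : L2} (hu : u ∈ H) {C : ℝ} (h : ∀ n, ‖stokesCut n u‖ ≤ C) :
    MemDA u ∧ ‖stokes u‖ ≤ C := by
  have h1 : MemDA u := (memDA_iff u).2 ⟨hu, summable_of_sum_box_le (C := C ^ 2)
    (fun k => by positivity) fun n => by
      rw [← norm_stokesCut_sq]
      exact pow_le_pow_left₀ (norm_nonneg _) (h n) 2⟩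
  exact ⟨h1, le_of_tendsto' (tendsto_stokesCut h1).norm h⟩

lemma tendsto_norm_sqrtStokesCut_sq {u : L2} (h : MemV u) :
    Tendsto (fun n => ‖sqrtStokesCut n u‖ ^ 2) atTop (𝓝 (normV u ^ 2)) := by
  simp_rw [norm_sqrtStokesCut_sq]
  exact (hasSum_normV_sq h.1).comp tendsto_box

lemma norm_sqrtStokesCut_sq_le {u : L2} (h : MemV u) (n : ℕ) :
    ‖sqrtStokesCut n u‖ ^ 2 ≤ normV u ^ 2 := by
  rw [norm_sqrtStokesCut_sq]
  exact sum_le_hasSum _ (fun k _ => mul_nonneg (ksq_nonneg k) (by positivity)) (hasSum_normV_sq h.1)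

lemma memV_of_norm_sqrtStokesCut_le {u : L2} (hu : u ∈ H) {C : ℝ}
    (h : ∀ n, ‖sqrtStokesCut n u‖ ^ 2 ≤ C) : MemV u ∧ normV u ^ 2 ≤ C := by
  have h1 : MemV u := (memV_iff u).2 ⟨hu, summable_of_sum_box_le (C := C)
    (fun k => mul_nonneg (ksq_nonneg k) (by positivity)) fun n => by
      rw [← norm_sqrtStokesCut_sq]
      exact h n⟩
  exact ⟨h1, le_of_tendsto' (tendsto_norm_sqrtStokesCut_sq h1) h⟩

/-! ### Continuity in `V` -/

/-- The modes in `box n` are kept exactly; on the others `|a - b|² ≤ 2|a|² + 2|b|²` leaves the tails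
of `u` and `v`. -/
lemma normV_sub_sq_le {u v : L2} (hu : MemV u) (hv : MemV v) (n : ℕ) :
    normV (u - v) ^ 2 ≤ ‖sqrtStokesCut n (u - v)‖ ^ 2
      + (2 * (normV u ^ 2 - ‖sqrtStokesCut n u‖ ^ 2)
        + 2 * (normV v ^ 2 - ‖sqrtStokesCut n v‖ ^ 2)) := by
  classical
  have key : ∀ z : L2, HasSum (fun k => if k ∈ box n then ksq k * ‖fc z k‖ ^ 2 else 0)
      (‖sqrtStokesCut n z‖ ^ 2) := fun z => by
    rw [norm_sqrtStokesCut_sq, ← Finset.sum_congr rfl fun k hk => if_pos hk]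
    exact hasSum_sum_of_ne_finset_zero fun k hk => if_neg hk
  refine hasSum_le (fun k => ?_) (hasSum_normV_sq (hu.sub hv).1) ((key _).add
    ((((hasSum_normV_sq hu.1).sub (key u)).mul_left 2).add
      (((hasSum_normV_sq hv.1).sub (key v)).mul_left 2)))
  split_ifs
  · simp
  · rw [fc_sub]
    have h1 : ‖fc u k - fc v k‖ ^ 2 ≤ 2 * ‖fc u k‖ ^ 2 + 2 * ‖fc v k‖ ^ 2 := by
      have h2 := norm_sub_le (fc u k) (fc v k)
      nlinarith [norm_nonneg (fc u k - fc v k), sq_nonneg (‖fc u k‖ - ‖fc v k‖)]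
    have := mul_le_mul_of_nonneg_left h1 (ksq_nonneg k)
    linarith

/-- The path `u` has a time derivative only in `L²`, so the identity is proved for `sqrtStokesCut n`
applied to `u`. The limit in `n` is dominated by `2‖Au‖‖g‖`, integrable as a product of two square
integrable functions. -/
lemma normV_sq_primitive {T : ℝ} (hT : 0 ≤ T) {u g : ℝ → L2} (hg : HasTimeDerivative T u g)
    (hs : SquareIntegrableInDA T u) (hV : ∀ t ∈ Icc 0 T, MemV (u t)) :
    IntervalIntegrable (fun s => 2 * inner ℝ (stokes (u s)) (g s)) volume 0 T ∧
    ∀ t ∈ Icc 0 T, normV (u t) ^ 2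
      = normV (u 0) ^ 2 + ∫ s in (0 : ℝ)..t, 2 * inner ℝ (stokes (u s)) (g s) := by
  have ig := hg.intervalIntegrable hT
  have hbound : IntervalIntegrable (fun s => 2 * (‖stokes (u s)‖ * ‖g s‖)) volume 0 T := by
    rw [intervalIntegrable_iff_integrableOn_Ioc_of_le hT]
    exact (hs.2.norm.integrable_mul hg.2.1.norm).const_mul 2
  have hle : ∀ a b : L2, ‖2 * inner ℝ a b‖ ≤ 2 * (‖a‖ * ‖b‖) := fun a b => by
    rw [norm_mul, Real.norm_ofNat]
    exact mul_le_mul_of_nonneg_left (norm_inner_le_norm _ _) zero_le_two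
  constructor
  · rw [intervalIntegrable_iff_integrableOn_Ioc_of_le hT] at hbound ⊢
    exact hbound.mono' ((hs.2.1.inner hg.2.1.1).const_mul 2)
      (Eventually.of_forall fun s => hle _ _)
  intro t ht
  have hsub := uIcc_subset_of_mem ht
  have h1 : ∀ n, ‖sqrtStokesCut n (u t)‖ ^ 2 = ‖sqrtStokesCut n (u 0)‖ ^ 2
      + ∫ s in (0 : ℝ)..t, 2 * inner ℝ (stokesCut n (u s)) (g s) := fun n => by
    have := norm_sq_primitive (w := fun t => sqrtStokesCut n (u t))
      (g := fun t => sqrtStokesCut n (g t))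
      ⟨(sqrtStokesCut n).integrable_comp ig.1, (sqrtStokesCut n).integrable_comp ig.2⟩
      (fun t ht => by
        rw [ContinuousLinearMap.intervalIntegral_comp_comm _
          (ig.mono_set (uIcc_subset_of_mem ht)), ← map_add, ← hg.2.2 t ht]) t ht
    simpa only [inner_sqrtStokesCut] using this
  have h0 : (0 : ℝ) ∈ Icc 0 T := ⟨le_rfl, hT⟩
  refine tendsto_nhds_unique (tendsto_norm_sqrtStokesCut_sq (hV t ht)) ?_
  simp_rw [h1]
  refine (tendsto_norm_sqrtStokesCut_sq (hV 0 h0)).add ?_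
  have hIoc : uIoc 0 t ⊆ Ioc 0 T := by
    rw [uIoc_of_le ht.1]
    exact Ioc_subset_Ioc_right ht.2
  have hDA : ∀ᵐ s ∂volume, s ∈ uIoc 0 t → MemDA (u s) := by
    filter_upwards [(ae_restrict_iff' measurableSet_Ioc).1 hs.1] with s h h' using h (hIoc h')
  refine intervalIntegral.tendsto_integral_filter_of_dominated_convergence
    (fun s => 2 * (‖stokes (u s)‖ * ‖g s‖)) ?_ ?_ (hbound.mono_set hsub) ?_
  · refine Eventually.of_forall fun n => ?_
    have hm : AEStronglyMeasurable (fun s => stokesCut n (u s)) (volume.restrict (Ioc 0 T)) :=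
      (memLp_of_continuousOn ((stokesCut n).continuous.comp_continuousOn (hg.continuousOn hT))).1
    exact ((hm.inner hg.2.1.1).const_mul 2).mono_set hIoc
  · refine Eventually.of_forall fun n => ?_
    filter_upwards [hDA] with s h h'
    refine (hle _ _).trans ?_
    have := norm_stokesCut_le (h h') n
    gcongr
  · filter_upwards [hDA] with s h h'
    exact ((tendsto_stokesCut (h h')).inner tendsto_const_nhds).const_mul 2

/-- Both `‖u(s)‖_V²` and its part in `box n` are continuous in `s`, so the tail is too. A tail that
is small at `t` therefore stays small nearby, and the low modes converge in `L²`. -/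
lemma continuousInV_of_hasTimeDerivative {T : ℝ} (hT : 0 ≤ T) {u g : ℝ → L2}
    (hg : HasTimeDerivative T u g) (hs : SquareIntegrableInDA T u)
    (hV : ∀ t ∈ Icc 0 T, MemV (u t)) : ContinuousInV T u := by
  obtain ⟨hi, heq⟩ := normV_sq_primitive hT hg hs hV
  have hc := hg.continuousOn hT
  have h1 : ContinuousOn (fun t => normV (u t) ^ 2) (Icc 0 T) := by
    have h2 := intervalIntegral.continuousOn_primitive_interval' hi left_mem_uIcc
    rw [uIcc_of_le hT] at h2
    exact (continuousOn_const.add h2).congr heq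
  have hcut : ∀ n, ContinuousOn (fun t => ‖sqrtStokesCut n (u t)‖ ^ 2) (Icc 0 T) := fun n =>
    ((sqrtStokesCut n).continuous.comp_continuousOn hc).norm.pow 2
  refine fun t ht => ⟨hV t ht, ?_⟩
  have hsq : Tendsto (fun s => normV (u s - u t) ^ 2) (𝓝[Icc 0 T] t) (𝓝 0) := by
    refine Metric.tendsto_nhds.2 fun ε hε => ?_
    -- The two tails enter with total weight `4`, so `ε/8` leaves a limit below `ε/2`.
    have h3 := (tendsto_norm_sqrtStokesCut_sq (hV t ht)).eventually
      (lt_mem_nhds (show normV (u t) ^ 2 - ε / 8 < normV (u t) ^ 2 by linarith))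
    obtain ⟨n, hn⟩ := h3.exists
    have h4 : Tendsto (fun s => ‖sqrtStokesCut n (u s - u t)‖ ^ 2
        + (2 * (normV (u s) ^ 2 - ‖sqrtStokesCut n (u s)‖ ^ 2)
        + 2 * (normV (u t) ^ 2 - ‖sqrtStokesCut n (u t)‖ ^ 2))) (𝓝[Icc 0 T] t)
        (𝓝 (‖sqrtStokesCut n (u t - u t)‖ ^ 2
        + (2 * (normV (u t) ^ 2 - ‖sqrtStokesCut n (u t)‖ ^ 2)
        + 2 * (normV (u t) ^ 2 - ‖sqrtStokesCut n (u t)‖ ^ 2)))) := by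
      have h5 : Tendsto (fun s => ‖sqrtStokesCut n (u s - u t)‖ ^ 2) (𝓝[Icc 0 T] t)
          (𝓝 (‖sqrtStokesCut n (u t - u t)‖ ^ 2)) :=
        (((sqrtStokesCut n).continuous.tendsto _).comp ((hc t ht).sub_const (u t))).norm.pow 2
      exact h5.add ((((h1 t ht).sub (hcut n t ht)).const_mul 2).add_const _)
    rw [sub_self, map_zero, norm_zero, zero_pow two_ne_zero, zero_add] at h4
    have h6 := h4.eventually (gt_mem_nhds (show _ < ε by linarith))
    filter_upwards [h6, self_mem_nhdsWithin] with s hs' hsT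
    rw [Real.dist_eq, sub_zero, abs_of_nonneg (sq_nonneg _)]
    exact (normV_sub_sq_le (hV s hsT) (hV t ht) n).trans_lt hs'
  simpa [Real.sqrt_sq (normV_nonneg _)] using hsq.sqrt

/-! ### Existence of strong solutions -/

/-- Needed for measurability of `B(u(s),u(s))` in time: the truncated versions are continuous in
`s`. -/
lemma tendsto_B_trunc {z : L2} (hz : MemDA z) :
    Tendsto (fun n => B (trunc n z) (trunc n z)) atTop (𝓝 (B z z)) := by
  rw [tendsto_iff_norm_sub_tendsto_zero]
  have h1 : Tendsto (fun n => 2 * wienerConst * ‖stokes z‖ * ‖stokes z - trunc n (stokes z)‖)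
      atTop (𝓝 0) := by
    have := ((tendsto_trunc (stokes z)).const_sub (stokes z)).norm.const_mul
      (2 * wienerConst * ‖stokes z‖)
    simpa using this
  refine squeeze_zero (fun _ => norm_nonneg _) (fun n => ?_) h1
  have hp := memDA_of_mem_galerkinSpace (trunc_mem n hz.mem_H)
  have hd := hz.sub hp
  have e1 : B z z = B (z - trunc n z) z + B (trunc n z) z := by
    rw [← B_add_left hd hp, sub_add_cancel]
  have e2 : B (trunc n z) z = B (trunc n z) (z - trunc n z) + B (trunc n z) (trunc n z) := by
    rw [← B_add_right hp hd.memH1 hp.memH1, sub_add_cancel]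
  have e3 : stokes z - trunc n (stokes z) = stokes (z - trunc n z) := by
    rw [stokes_sub hz hp, stokes_trunc hz]
  rw [e3, norm_sub_rev, e1, e2, ← add_assoc, add_sub_cancel_right]
  refine (norm_add_le _ _).trans ?_
  have h2 := norm_B_le hd hz.memH1
  have h3 := norm_B_le hp hd.memH1
  have h4 := normV_le_norm_stokes hz
  have h5 := normV_le_norm_stokes hd
  have h6 : ‖stokes (trunc n z)‖ ≤ ‖stokes z‖ := by
    rw [stokes_trunc hz]
    exact norm_trunc_le _ _
  have hw := wienerConst_nonneg
  have := normV_nonneg z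
  have := normV_nonneg (z - trunc n z)
  calc _ ≤ wienerConst * ‖stokes (z - trunc n z)‖ * normV z
        + wienerConst * ‖stokes (trunc n z)‖ * normV (z - trunc n z) := add_le_add h2 h3
    _ ≤ wienerConst * ‖stokes (z - trunc n z)‖ * ‖stokes z‖
        + wienerConst * ‖stokes z‖ * ‖stokes (z - trunc n z)‖ := by gcongr
    _ = _ := by ring

lemma integral_mem_H {T : ℝ} {g : ℝ → L2} (h : ∀ᵐ t ∂volume.restrict (Ioc 0 T), g t ∈ H)
    (hg : IntervalIntegrable g volume 0 T) {t : ℝ} (ht : t ∈ Icc 0 T) :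
    ∫ s in (0 : ℝ)..t, g s ∈ H := by
  have h1 : ∫ s in (0 : ℝ)..t, g s = leray (∫ s in (0 : ℝ)..t, g s) := by
    rw [← ContinuousLinearMap.intervalIntegral_comp_comm _ (hg.mono_set (uIcc_subset_of_mem ht))]
    refine intervalIntegral.integral_congr_ae ?_
    filter_upwards [(ae_restrict_iff' measurableSet_Ioc).1 h] with s hs hst
    rw [uIoc_of_le ht.1] at hst
    exact (leray_eq_self (hs (Ioc_subset_Ioc_right ht.2 hst))).symm
  rw [h1]
  exact leray_mem _

/-- Lets the residual of the equation be tested against its own truncations, which are trigonometric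
polynomials. -/
lemma eq_zero_of_inner_trunc {d : L2} (h : ∀ n, inner ℝ d (trunc n d) = 0) : d = 0 := by
  have h1 : Tendsto (fun n => inner ℝ d (trunc n d)) atTop (𝓝 (inner ℝ d d)) :=
    tendsto_const_nhds.inner (tendsto_trunc d)
  simp_rw [h] at h1
  exact inner_self_eq_zero.1 (tendsto_nhds_unique h1 tendsto_const_nhds)

/-! ### Passage to the limit in the Galerkin scheme. -/

section Limit

variable {ν T : ℝ} {f θ : L2} {x : ℕ → ℝ → L2} {u : ℝ → L2}

lemma exists_galerkin_limit (hν : 0 < ν) (hT : 0 ≤ T) (hf : f ∈ H) (hθ : MemV θ)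
    (hx : ∀ n, IsGalerkinSolution ν T f θ n (x n)) :
    ∃ u : ℝ → L2, TendstoUniformlyOn x u atTop (Icc 0 T) := by
  let M := √(normV θ ^ 2 + T * (‖f‖ ^ 2 / ν))
  have hM2 : normV θ ^ 2 + T * (‖f‖ ^ 2 / ν) = M ^ 2 := (Real.sq_sqrt (by positivity)).symm
  let c := T * (‖f‖ + wienerConst * M) + wienerConst * M * (M ^ 2 / ν)
  let e := Real.exp (wienerConst ^ 2 / (2 * ν) * (M ^ 2 / ν))
  let R : ℕ → ℝ := fun n => (‖θ - trunc n θ‖ ^ 2 + 2 * (M / n * c)) * e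
  have hR : Tendsto R atTop (𝓝 0) := by
    have h1 := (((tendsto_trunc θ).const_sub θ).norm.pow 2).add
      ((((tendsto_const_nhds (x := M)).div_atTop tendsto_natCast_atTop_atTop).mul_const c).const_mul
        2)
    simpa using h1.mul_const e
  have key : ∀ n m, 0 < n → n ≤ m → ∀ t ∈ Icc 0 T, ‖x m t - x n t‖ ^ 2 ≤ R n := by
    intro n m hn hnm t ht
    refine ((hx n).norm_sub_sq_le (hx m) hnm hn hν hT hf hθ (Real.sqrt_nonneg _) hM2.le
      t ht).trans ?_
    -- This removes `m` from the bound for the initial error, so that `R` depends on `n` only.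
    have h1 : trunc m θ - trunc n θ = trunc m (θ - trunc n θ) := by
      rw [map_sub, trunc_eq_self (galerkinSpace_mono hnm (trunc_mem n hθ.2))]
    have h2 := norm_trunc_le m (θ - trunc n θ)
    rw [h1]
    simp only [R, c, e, M]
    gcongr
  have hcs : UniformCauchySeqOn x atTop (Icc 0 T) := by
    refine Metric.uniformCauchySeqOn_iff.2 fun ε hε => ?_
    obtain ⟨N, hN⟩ := eventually_atTop.1
      ((hR.eventually (gt_mem_nhds (by positivity : (0 : ℝ) < ε ^ 2))).and (eventually_gt_atTop 0))
    have h2 : ∀ n ≥ N, ∀ m ≥ n, ∀ t ∈ Icc 0 T, dist (x m t) (x n t) < ε := fun n hn m hm t ht => by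
      rw [dist_eq_norm]
      exact lt_of_pow_lt_pow_left₀ 2 hε.le
        ((key n m (hN n hn).2 hm t ht).trans_lt (hN n hn).1)
    refine ⟨N, fun m hm n hn t ht => ?_⟩
    rcases le_total n m with h | h
    · exact h2 n hn m h t ht
    · rw [dist_comm]
      exact h2 m hm n h t ht
  have h3 : ∀ t, ∃ y, t ∈ Icc 0 T → Tendsto (fun n => x n t) atTop (𝓝 y) := fun t => by
    by_cases ht : t ∈ Icc 0 T
    · obtain ⟨y, hy⟩ := cauchySeq_tendsto_of_complete (hcs.cauchySeq ht)
      exact ⟨y, fun _ => hy⟩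
    · exact ⟨0, fun h => absurd h ht⟩
  choose u hu using h3
  exact ⟨u, hcs.tendstoUniformlyOn_of_tendsto hu⟩

lemma memV_of_galerkin_limit (hν : 0 < ν) (hθ : MemV θ)
    (hx : ∀ n, IsGalerkinSolution ν T f θ n (x n)) {t : ℝ} (ht : t ∈ Icc 0 T)
    (hu : Tendsto (fun n => x n t) atTop (𝓝 (u t))) :
    MemV (u t) ∧ normV (u t) ^ 2 ≤ normV θ ^ 2 + T * (‖f‖ ^ 2 / ν) := by
  refine memV_of_norm_sqrtStokesCut_le
    (isClosed_H.mem_of_tendsto hu (Eventually.of_forall fun n => ((hx n).mem t ht).1)) fun N => ?_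
  exact le_of_tendsto' ((((sqrtStokesCut N).continuous.tendsto _).comp hu).norm.pow 2) fun n =>
    (norm_sqrtStokesCut_sq_le ((hx n).memDA ht).2 N).trans ((hx n).normV_sq_le hν hθ ht)

lemma memDA_of_galerkin_limit (hν : 0 < ν) (hθ : MemDA θ) (hf : MemV f)
    (hx : ∀ n, IsGalerkinSolution ν T f θ n (x n)) {t : ℝ} (ht : t ∈ Icc 0 T)
    (hu : Tendsto (fun n => x n t) atTop (𝓝 (u t))) :
    MemDA (u t) ∧ ‖stokes (u t)‖ ≤ √((‖stokes θ‖ ^ 2 + T * (normV f ^ 2 / ν)) *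
      Real.exp (4 * wienerConst ^ 2 / ν * ((normV θ ^ 2 + T * (‖f‖ ^ 2 / ν)) / ν))) := by
  refine memDA_of_norm_stokesCut_le
    (isClosed_H.mem_of_tendsto hu (Eventually.of_forall fun n => ((hx n).mem t ht).1)) fun N => ?_
  exact le_of_tendsto' (((stokesCut N).continuous.tendsto _).comp hu).norm fun n =>
    (norm_stokesCut_le ((hx n).memDA ht) N).trans
      (Real.le_sqrt_of_sq_le ((hx n).stokes_sq_le hν hθ hf ht))

lemma continuousOn_galerkin_limit (hx : ∀ n, IsGalerkinSolution ν T f θ n (x n))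
    (hu : TendstoUniformlyOn x u atTop (Icc 0 T)) : ContinuousOn u (Icc 0 T) :=
  hu.continuousOn (Frequently.of_forall fun n => (hx n).continuousOn)

lemma norm_galerkin_le (hν : 0 < ν) (hθ : MemV θ)
    (hx : ∀ n, IsGalerkinSolution ν T f θ n (x n)) {t : ℝ} (ht : t ∈ Icc 0 T) (n : ℕ) :
    ‖x n t‖ ≤ √(normV θ ^ 2 + T * (‖f‖ ^ 2 / ν)) :=
  (norm_le_normV ((hx n).memDA ht).2).trans
    (Real.le_sqrt_of_sq_le ((hx n).normV_sq_le hν hθ ht))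

lemma integral_stokesCut_limit_le (hν : 0 < ν) (hT : 0 ≤ T) (hθ : MemV θ)
    (hx : ∀ n, IsGalerkinSolution ν T f θ n (x n))
    (hu : TendstoUniformlyOn x u atTop (Icc 0 T)) (N : ℕ) :
    ∫ s in (0 : ℝ)..T, ‖stokesCut N (u s)‖ ^ 2 ≤ (normV θ ^ 2 + T * (‖f‖ ^ 2 / ν)) / ν := by
  have hcut : ∀ n, ContinuousOn (fun s => ‖stokesCut N (x n s)‖ ^ 2) (Icc 0 T) := fun n =>
    ((stokesCut N).continuous.comp_continuousOn (hx n).continuousOn).norm.pow 2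
  have h1 : Tendsto (fun n => ∫ s in (0 : ℝ)..T, ‖stokesCut N (x n s)‖ ^ 2) atTop
      (𝓝 (∫ s in (0 : ℝ)..T, ‖stokesCut N (u s)‖ ^ 2)) := by
    refine intervalIntegral.tendsto_integral_filter_of_dominated_convergence
      (fun _ => (‖stokesCut N‖ * √(normV θ ^ 2 + T * (‖f‖ ^ 2 / ν))) ^ 2) ?_ ?_
      intervalIntegrable_const ?_
    · refine Eventually.of_forall fun n => ?_
      rw [uIoc_of_le hT]
      exact ((hcut n).aestronglyMeasurable_of_isCompact isCompact_Icc measurableSet_Icc).mono_set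
        Ioc_subset_Icc_self
    · refine Eventually.of_forall fun n => Eventually.of_forall fun s hs => ?_
      rw [uIoc_of_le hT] at hs
      rw [norm_pow, norm_norm]
      exact pow_le_pow_left₀ (norm_nonneg _) (((stokesCut N).le_opNorm _).trans
        (mul_le_mul_of_nonneg_left (norm_galerkin_le hν hθ hx (Ioc_subset_Icc_self hs) n)
          (norm_nonneg _))) 2
    · refine Eventually.of_forall fun s hs => ?_
      rw [uIoc_of_le hT] at hs
      exact (((stokesCut N).continuous.tendsto _).comp
        (hu.tendsto_at (Ioc_subset_Icc_self hs))).norm.pow 2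
  refine le_of_tendsto' h1 fun n => ?_
  refine le_trans ?_ ((hx n).integral_stokes_sq_le hν hθ ⟨hT, le_rfl⟩)
  refine intervalIntegral.integral_mono_on hT ((hcut n).intervalIntegrable_of_Icc hT)
    (((hx n).continuousOn_stokes.norm.pow 2).intervalIntegrable_of_Icc hT) fun s hs => ?_
  exact pow_le_pow_left₀ (norm_nonneg _) (norm_stokesCut_le ((hx n).memDA hs) N) 2

/-- Fatou's lemma for the dissipation. -/
lemma squareIntegrableInDA_of_stokesCut {E : ℝ} (hT : 0 ≤ T) (hc : ContinuousOn u (Icc 0 T))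
    (hH : ∀ t ∈ Icc 0 T, u t ∈ H)
    (hE : ∀ N, ∫ s in (0 : ℝ)..T, ‖stokesCut N (u s)‖ ^ 2 ≤ E) :
    SquareIntegrableInDA T u ∧ ∫ s in (0 : ℝ)..T, ‖stokes (u s)‖ ^ 2 ≤ E := by
  have hcut : ∀ N, MemLp (fun s => stokesCut N (u s)) 2 (volume.restrict (Ioc 0 T)) := fun N =>
    memLp_of_continuousOn ((stokesCut N).continuous.comp_continuousOn hc)
  have hE0 : 0 ≤ E := (intervalIntegral.integral_nonneg hT fun _ _ => by positivity).trans (hE 0)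
  let a : ℕ → ℝ → ENNReal := fun N s => ENNReal.ofReal (‖stokesCut N (u s)‖ ^ 2)
  have ham : ∀ N, AEMeasurable (a N) (volume.restrict (Ioc 0 T)) := fun N =>
    ((hcut N).1.norm.aemeasurable.pow_const 2).ennreal_ofReal
  -- The cutoff norms increase with `N`, so monotone convergence applies. Where the supremum is
  -- finite, `u s` lies in `D(A)`; this is almost everywhere.
  have hsup : ∫⁻ s in Ioc 0 T, ⨆ N, a N s ≤ ENNReal.ofReal E := by
    rw [lintegral_iSup' ham (Eventually.of_forall fun s m n hmn => ENNReal.ofReal_le_ofReal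
      (pow_le_pow_left₀ (norm_nonneg _) (norm_stokesCut_mono hmn _) 2))]
    refine iSup_le fun N => ?_
    rw [← ofReal_integral_eq_lintegral_ofReal ((hcut N).integrable_norm_pow two_ne_zero)
      (Eventually.of_forall fun _ => by positivity), ← intervalIntegral.integral_of_le hT]
    exact ENNReal.ofReal_le_ofReal (hE N)
  have hDA : ∀ᵐ s ∂volume.restrict (Ioc 0 T), MemDA (u s) := by
    filter_upwards [ae_lt_top' (AEMeasurable.iSup ham) (hsup.trans_lt ENNReal.ofReal_lt_top).ne,
      ae_restrict_mem measurableSet_Ioc] with s hs hsT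
    refine (memDA_of_norm_stokesCut_le (hH s (Ioc_subset_Icc_self hsT))
      (C := √((⨆ N, a N s).toReal)) fun N => Real.le_sqrt_of_sq_le ?_).1
    exact (ENNReal.ofReal_le_iff_le_toReal hs.ne).1 (le_iSup (fun N => a N s) N)
  have hmeas : AEStronglyMeasurable (fun s => stokes (u s)) (volume.restrict (Ioc 0 T)) :=
    aestronglyMeasurable_of_tendsto_ae atTop (fun N => (hcut N).1)
      (hDA.mono fun s hs => tendsto_stokesCut hs)
  have hlint : ∫⁻ s in Ioc 0 T, ENNReal.ofReal (‖stokes (u s)‖ ^ 2) ≤ ENNReal.ofReal E := by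
    refine (lintegral_mono_ae ?_).trans hsup
    filter_upwards [hDA] with s hs
    exact le_of_tendsto' (ENNReal.tendsto_ofReal ((tendsto_stokesCut hs).norm.pow 2))
      fun N => le_iSup (fun N => a N s) N
  have hsq : AEStronglyMeasurable (fun s => ‖stokes (u s)‖ ^ 2) (volume.restrict (Ioc 0 T)) :=
    hmeas.norm.pow 2
  refine ⟨⟨hDA, (memLp_two_iff_integrable_sq_norm hmeas).2 ⟨hsq, ?_⟩⟩, ?_⟩
  · rw [hasFiniteIntegral_iff_ofReal (Eventually.of_forall fun _ => by positivity)]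
    exact hlint.trans_lt ENNReal.ofReal_lt_top
  · rw [intervalIntegral.integral_of_le hT, integral_eq_lintegral_of_nonneg_ae
      (Eventually.of_forall fun _ => by positivity) hsq]
    exact ENNReal.toReal_le_of_le_ofReal hE0 hlint

lemma memLp_B {M : ℝ} (hc : ContinuousOn u (Icc 0 T)) (hs : SquareIntegrableInDA T u)
    (hH : ∀ t ∈ Icc 0 T, u t ∈ H) (hM : ∀ t ∈ Icc 0 T, normV (u t) ≤ M) :
    MemLp (fun s => B (u s) (u s)) 2 (volume.restrict (Ioc 0 T)) := by
  refine (hs.2.const_smul (wienerConst * M)).mono ?_ ?_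
  · refine aestronglyMeasurable_of_tendsto_ae atTop (fun n => ?_)
      (hs.1.mono fun s hs => tendsto_B_trunc hs)
    exact (memLp_of_continuousOn (continuousOn_B ((trunc n).continuous.comp_continuousOn hc)
      fun t ht => trunc_mem n (hH t ht))).1
  · filter_upwards [hs.1, ae_restrict_mem measurableSet_Ioc] with s h hsT
    have h1 := hM s (Ioc_subset_Icc_self hsT)
    have hw := wienerConst_nonneg
    have hM0 := (normV_nonneg _).trans h1
    rw [Pi.smul_apply, norm_smul, Real.norm_of_nonneg (by positivity)]
    calc _ ≤ wienerConst * ‖stokes (u s)‖ * normV (u s) := norm_B_le h h.memH1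
      _ ≤ wienerConst * ‖stokes (u s)‖ * M := by gcongr
      _ = _ := by ring

/-- The weak form of the equation, against trigonometric polynomials. -/
lemma inner_galerkin_limit (hν : 0 < ν) (hθ : MemV θ) (hf : f ∈ H)
    (hx : ∀ n, IsGalerkinSolution ν T f θ n (x n))
    (hu : TendstoUniformlyOn x u atTop (Icc 0 T)) (hs : SquareIntegrableInDA T u)
    {m : ℕ} {w : L2} (hw : w ∈ galerkinSpace m) {t : ℝ}
    (ht : t ∈ Icc 0 T) : inner ℝ (u t) w = inner ℝ θ w
      + ∫ s in (0 : ℝ)..t, inner ℝ (f - ν • stokes (u s) - B (u s) (u s)) w := by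
  have hT := ht.1.trans ht.2
  have hwd := memDA_of_mem_galerkinSpace hw
  obtain ⟨C, hC0, hC⟩ := abs_inner_B_le_of_middle hw
  let M := √(normV θ ^ 2 + T * (‖f‖ ^ 2 / ν))
  have hM0 : 0 ≤ M := Real.sqrt_nonneg _
  have hxM : ∀ n, ∀ s ∈ Icc 0 T, ‖x n s‖ ≤ M := fun n s hs => norm_galerkin_le hν hθ hx hs n
  have hIoc : uIoc 0 t ⊆ Ioc 0 T := by
    rw [uIoc_of_le ht.1]
    exact Ioc_subset_Ioc_right ht.2
  -- Moving `A` and the derivative in `B` onto the trigonometric polynomial `w` leaves an expression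
  -- that is continuous in `z` for the `L²` norm.
  have form : ∀ z, MemDA z → inner ℝ (f - ν • stokes z - B z z) w
      = inner ℝ f w - ν * inner ℝ z (stokes w) + inner ℝ (B z w) z := fun z hz => by
    rw [inner_sub_left, inner_sub_left, real_inner_smul_left, inner_stokes_comm hz hwd,
      inner_B_antisymm hz hz.2 hwd.2]
    ring
  have formn : ∀ n ≥ m, ∀ s ∈ Icc 0 T,
      inner ℝ (trunc n (f - B (x n s) (x n s)) - ν • stokes (x n s)) w
      = inner ℝ f w - ν * inner ℝ (x n s) (stokes w) + inner ℝ (B (x n s) w) (x n s) := by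
    intro n hn s hs
    rw [← form _ ((hx n).memDA hs), inner_sub_left, inner_trunc n _ (galerkinSpace_mono hn hw)]
    simp only [inner_sub_left]
    ring
  have h1 : ∀ n ≥ m, inner ℝ (x n t) w = inner ℝ θ w + ∫ s in (0 : ℝ)..t,
      inner ℝ (trunc n (f - B (x n s) (x n s)) - ν • stokes (x n s)) w := by
    intro n hn
    have hd := (hx n).hasTimeDerivative hf
    have hi := (hd.intervalIntegrable hT).mono_set (uIcc_subset_of_mem ht)
    rw [hd.2.2 t ht, inner_add_left, (hx n).initial, inner_trunc n _ (galerkinSpace_mono hn hw)]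
    congr 1
    have := ContinuousLinearMap.intervalIntegral_comp_comm (innerSL ℝ w) hi
    simp only [innerSL_apply_apply] at this
    rw [real_inner_comm, ← this]
    simp_rw [real_inner_comm w]
  have h2 : Tendsto (fun n => inner ℝ (x n t) w) atTop (𝓝 (inner ℝ (u t) w)) :=
    (hu.tendsto_at ht).inner tendsto_const_nhds
  refine tendsto_nhds_unique (h2.congr' ((eventually_ge_atTop m).mono h1)) ?_
  refine Tendsto.const_add _ ?_
  refine intervalIntegral.tendsto_integral_filter_of_dominated_convergence
    (fun _ => ‖f‖ * ‖w‖ + ν * (M * ‖stokes w‖) + C * M * M) ?_ ?_ intervalIntegrable_const ?_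
  · refine Eventually.of_forall fun n => ?_
    exact ((((hx n).continuousOn_deriv.inner continuousOn_const).aestronglyMeasurable_of_isCompact
      isCompact_Icc measurableSet_Icc).mono_set (hIoc.trans Ioc_subset_Icc_self))
  · filter_upwards [eventually_ge_atTop m] with n hn
    refine Eventually.of_forall fun s hs => ?_
    have hs := Ioc_subset_Icc_self (hIoc hs)
    have e := hxM n s hs
    rw [formn n hn s hs]
    refine (norm_add_le _ _).trans (add_le_add ((norm_sub_le _ _).trans (add_le_add ?_ ?_)) ?_)
    · exact norm_inner_le_norm _ _
    · rw [norm_mul, Real.norm_of_nonneg hν.le]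
      refine mul_le_mul_of_nonneg_left ((norm_inner_le_norm _ _).trans ?_) hν.le
      gcongr
    · refine (hC _ _ ((hx n).memDA hs) ((hx n).mem s hs).1).trans ?_
      gcongr
  · filter_upwards [(ae_restrict_iff' measurableSet_Ioc).1 hs.1] with s hsDA hs
    have hd := hsDA (hIoc hs)
    have hs := Ioc_subset_Icc_self (hIoc hs)
    have hlim := hu.tendsto_at hs
    have hlim0 : Tendsto (fun n => ‖x n s - u s‖) atTop (𝓝 0) :=
      tendsto_iff_norm_sub_tendsto_zero.1 hlim
    rw [form _ hd]
    have h3 : Tendsto (fun n => inner ℝ (B (x n s) w) (x n s)) atTop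
        (𝓝 (inner ℝ (B (u s) w) (u s))) := by
      rw [tendsto_iff_norm_sub_tendsto_zero]
      have h4 : Tendsto (fun n => C * M * ‖x n s - u s‖ + C * ‖u s‖ * ‖x n s - u s‖) atTop
          (𝓝 0) := by
        simpa using (hlim0.const_mul (C * M)).add (hlim0.const_mul (C * ‖u s‖))
      refine squeeze_zero (fun _ => norm_nonneg _) (fun n => ?_) h4
      have hdn := (hx n).memDA hs
      have hdd := hdn.sub hd
      have e1 : B (x n s) w = B (x n s - u s) w + B (u s) w := by
        rw [← B_add_left hdd hd, sub_add_cancel]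
      have e2 : inner ℝ (B (x n s) w) (x n s) - inner ℝ (B (u s) w) (u s)
          = inner ℝ (B (x n s - u s) w) (x n s) + inner ℝ (B (u s) w) (x n s - u s) := by
        rw [e1, inner_add_left, inner_sub_right]
        ring
      rw [e2]
      refine (norm_add_le _ _).trans (add_le_add ?_ (hC _ _ hd hdd.mem_H))
      refine (hC _ _ hdd hdn.mem_H).trans ?_
      have := hxM n s hs
      calc _ ≤ C * ‖x n s - u s‖ * M := by gcongr
        _ = _ := by ring
    have h5 := (((hlim.inner (tendsto_const_nhds (x := stokes w))).const_mul ν).const_sub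
      (inner ℝ f w)).add h3
    exact h5.congr' ((eventually_ge_atTop m).mono fun n hn => (formn n hn s hs).symm)

end Limit

/-- Existence of strong solutions, with the estimates inherited from the Galerkin approximations. -/
lemma exists_isStrongSolution {ν T : ℝ} (hν : 0 < ν) (hT : 0 < T) {f θ : L2} (hf : MemV f)
    (hθ : MemV θ) : ∃ u, IsStrongSolution ν T f θ u ∧
      (∀ t ∈ Icc 0 T, normV (u t) ^ 2 ≤ normV θ ^ 2 + T * (‖f‖ ^ 2 / ν)) ∧
      ∫ s in (0 : ℝ)..T, ‖stokes (u s)‖ ^ 2 ≤ (normV θ ^ 2 + T * (‖f‖ ^ 2 / ν)) / ν ∧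
      (MemDA θ → ∀ t ∈ Icc 0 T, MemDA (u t) ∧
        ‖stokes (u t)‖ ≤ √((‖stokes θ‖ ^ 2 + T * (normV f ^ 2 / ν)) *
          Real.exp (4 * wienerConst ^ 2 / ν * ((normV θ ^ 2 + T * (‖f‖ ^ 2 / ν)) / ν)))) := by
  choose x hx using fun n => exists_galerkinSolution (f := f) (θ := θ) hν hT hf.2 hθ.2 n
  obtain ⟨u, hu⟩ := exists_galerkin_limit hν hT.le hf.2 hθ hx
  have hV := fun t (ht : t ∈ Icc 0 T) => memV_of_galerkin_limit hν hθ hx ht (hu.tendsto_at ht)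
  have hH := fun t ht => (hV t ht).1.2
  have hc := continuousOn_galerkin_limit hx hu
  obtain ⟨hs, hsE⟩ := squareIntegrableInDA_of_stokesCut hT.le hc hH
    (integral_stokesCut_limit_le hν hT.le hθ hx hu)
  have h0 : u 0 = θ := by
    have h1 := hu.tendsto_at ⟨le_rfl, hT.le⟩
    simp_rw [(hx _).initial] at h1
    exact tendsto_nhds_unique h1 (tendsto_trunc θ)
  -- The equation itself defines the derivative; what remains is that `u` is its primitive.
  let g : ℝ → L2 := fun s => f - ν • stokes (u s) - B (u s) (u s)
  have hgH : ∀ᵐ t ∂volume.restrict (Ioc 0 T), g t ∈ H := hs.1.mono fun t ht =>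
    H.sub_mem (H.sub_mem hf.2 (H.smul_mem ν (stokes_mem ht))) (B_mem _ _)
  have hg2 : MemLp g 2 (volume.restrict (Ioc 0 T)) :=
    ((memLp_const f).sub (hs.2.const_smul ν)).sub (memLp_B hc hs hH
      fun t ht => Real.le_sqrt_of_sq_le (hV t ht).2)
  have hgi := intervalIntegrable_of_memLp hT.le hg2
  have hd : HasTimeDerivative T u g := by
    refine ⟨hgH, hg2, fun t ht => ?_⟩
    have hm : u t - θ - ∫ s in (0 : ℝ)..t, g s ∈ H :=
      H.sub_mem (H.sub_mem (hH t ht) hθ.2) (integral_mem_H hgH hgi ht)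
    rw [h0, ← sub_eq_zero, ← sub_sub]
    refine eq_zero_of_inner_trunc fun m => ?_
    have hw := trunc_mem m hm
    set w := trunc m (u t - θ - ∫ s in (0 : ℝ)..t, g s)
    have h1 := inner_galerkin_limit hν hθ hf.2 hx hu hs hw ht
    have h2 := ContinuousLinearMap.intervalIntegral_comp_comm (innerSL ℝ w)
      (hgi.mono_set (uIcc_subset_of_mem ht))
    simp only [innerSL_apply_apply] at h2
    simp_rw [real_inner_comm w] at h1
    rw [real_inner_comm, inner_sub_right, inner_sub_right, h1, ← h2]
    simp only [g]
    ring
  exact ⟨u, ⟨continuousInV_of_hasTimeDerivative hT.le hd hs fun t ht => (hV t ht).1, hs, h0, g, hd,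
    Eventually.of_forall fun t => by simp only [g]; abel⟩, fun t ht => (hV t ht).2, hsE,
    fun hθA t ht => memDA_of_galerkin_limit hν hθA hf hx ht (hu.tendsto_at ht)⟩

/-- Measurability comes from `normH2_sq`, which expresses the integrand almost everywhere through
`u` and `stokes u`. -/
lemma integrableOn_normH2_sq {T : ℝ} {u : ℝ → L2}
    (hc : ContinuousOn u (Icc 0 T)) (hs : SquareIntegrableInDA T u) :
    IntegrableOn (fun t => normH2 (u t) ^ 2) (Ioc 0 T) := by
  have hu := memLp_of_continuousOn hc
  have hm : AEStronglyMeasurable (fun t => ‖u t‖ ^ 2 + inner ℝ (u t) (stokes (u t))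
      + ‖stokes (u t)‖ ^ 2) (volume.restrict (Ioc 0 T)) :=
    ((hu.1.norm.pow 2).add (hu.1.inner hs.2.1)).add (hs.2.1.norm.pow 2)
  have he : (fun t => ‖u t‖ ^ 2 + inner ℝ (u t) (stokes (u t)) + ‖stokes (u t)‖ ^ 2)
      =ᵐ[volume.restrict (Ioc 0 T)] fun t => normH2 (u t) ^ 2 := by
    filter_upwards [hs.1] with t ht
    rw [normH2_sq ht, normV_sq_eq_inner ht]
  refine ((hs.2.integrable_norm_pow two_ne_zero).const_mul 3).mono' (hm.congr he) ?_
  filter_upwards [hs.1] with t ht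
  rw [Real.norm_of_nonneg (by positivity)]
  exact normH2_sq_le ht

lemma integral_normH2_sq_le {T : ℝ} (hT : 0 ≤ T) {u : ℝ → L2}
    (hc : ContinuousOn u (Icc 0 T)) (hs : SquareIntegrableInDA T u) :
    ∫ s in (0 : ℝ)..T, normH2 (u s) ^ 2 ≤ 3 * ∫ s in (0 : ℝ)..T, ‖stokes (u s)‖ ^ 2 := by
  rw [← intervalIntegral.integral_const_mul, intervalIntegral.integral_of_le hT,
    intervalIntegral.integral_of_le hT]
  exact integral_mono_ae (integrableOn_normH2_sq hc hs)
    ((hs.2.integrable_norm_pow two_ne_zero).const_mul 3) (hs.1.mono fun t ht => normH2_sq_le ht)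

end NSTorus
end

/-! ### The explicit constants and the assembly of the theorem. -/

theorem proposition2p1 :
    -- the constants `c_U(U, ‖f‖_{L²}, ν, T)`, `c(m, ‖f‖_{H¹}, ν, T)`, `K(U, ‖f‖_{L²}, ν, T)`
    ∃ cU c K : ℝ → ℝ → ℝ → ℝ → ℝ,
      ∀ (ν T : ℝ) (f : L2), 0 < ν → 0 < T → MemV f →
        -- A) existence and uniqueness of strong solutions
        (∀ θ : L2, MemV θ →
          ∃ u : ℝ → L2, IsStrongSolution ν T f θ u ∧
            ∀ v : ℝ → L2, IsStrongSolution ν T f θ v → Set.EqOn v u (Set.Icc 0 T)) ∧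
        -- A) the bound in `C([0,T], V)` and `L²((0,T], H²)`
        (∀ (U : ℝ) (θ : L2) (u : ℝ → L2), 0 < U → MemV θ → normV θ ≤ U →
          IsStrongSolution ν T f θ u →
            IntegrableOn (fun t => normH2 (u t) ^ 2) (Set.Ioc 0 T) ∧
            ∀ t ∈ Set.Icc 0 T,
              normV (u t) + ∫ s in (0 : ℝ)..T, normH2 (u s) ^ 2 ≤ cU U ‖f‖ ν T) ∧
        -- A) the uniform bound in space and time, for `|u(t,x)|` with its continuous version
        (∀ m : ℝ, 0 < m → 0 < c m (normH1 f) ν T ∧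
          ∀ (θ : L2) (u : ℝ → L2), MemDA θ → ‖stokes θ‖ ≤ m → IsStrongSolution ν T f θ u →
            ∀ t ∈ Set.Icc 0 T, ∃ w : Pt → Vec, Continuous w ∧ NSTorus.Periodic w ∧
              u t =ᵐ[dx] w ∧ ∀ x, ‖w x‖ ≤ c m (normH1 f) ν T) ∧
        -- B) forward Lipschitz stability
        (∀ (U : ℝ) (θ ϑ : L2) (u v : ℝ → L2), 0 < U → MemV θ → normV θ ≤ U → MemV ϑ →
          IsStrongSolution ν T f θ u → IsStrongSolution ν T f ϑ v →
            ∀ t ∈ Set.Icc 0 T, ‖u t - v t‖ ≤ K U ‖f‖ ν T * ‖θ - ϑ‖) := by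
  have hw := wienerConst_nonneg
  -- The enstrophy bound gives both terms of `cU`, with the factor `3` from `normH2_sq_le`. In `c`,
  -- `wienerConst` turns the `D(A)` bound into a sup bound and `+ 1` secures positivity. `K` is the
  -- square root of the Gronwall factor for the squared norm.
  refine ⟨fun U F ν T => √(U ^ 2 + T * (F ^ 2 / ν)) + 3 * ((U ^ 2 + T * (F ^ 2 / ν)) / ν),
    fun m F ν T => wienerConst * √((m ^ 2 + T * (F ^ 2 / ν)) *
      Real.exp (4 * wienerConst ^ 2 / ν * ((m ^ 2 + T * (F ^ 2 / ν)) / ν))) + 1,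
    fun U F ν T => √(Real.exp (wienerConst ^ 2 / (2 * ν) * ((U ^ 2 + T * (F ^ 2 / ν)) / ν))),
    fun ν T f hν hT hf => ?_⟩
  have hL2 : ∀ {u g : ℝ → L2} {t : ℝ}, t ∈ Icc 0 T → EqOn u g (Icc 0 T) →
      ∫ s in (0 : ℝ)..t, ‖stokes (u s)‖ ^ 2 = ∫ s in (0 : ℝ)..t, ‖stokes (g s)‖ ^ 2 :=
    fun ht h => intervalIntegral.integral_congr fun s hs => by
      rw [uIcc_of_le ht.1] at hs
      simp only [h (Icc_subset_Icc_right ht.2 hs)]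
  have hTT : T ∈ Icc 0 T := ⟨hT.le, le_rfl⟩
  refine ⟨fun θ hθ => ?_, fun U θ u hU hθ hθU hu => ?_, fun m hm => ⟨by positivity,
    fun θ u hθ hθm hu t ht => ?_⟩, fun U θ ϑ u v hU hθ hθU hϑ hu hv t ht => ?_⟩
  · obtain ⟨u, hu, -⟩ := exists_isStrongSolution hν hT hf hθ
    exact ⟨u, hu, fun v hv => hu.eqOn hν hT.le hv⟩
  -- The given solution coincides on `[0,T]` with the Galerkin limit `g`, for which the estimates
  -- are known.
  · obtain ⟨g, hg, hgV, hgA, -⟩ := exists_isStrongSolution hν hT hf hθ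
    have he := hg.eqOn hν hT.le hu
    obtain ⟨_, hd, -⟩ := hu.equation
    have hc := hd.continuousOn hT.le
    have hs := hu.squareIntegrableInDA
    refine ⟨integrableOn_normH2_sq hc hs, fun t ht => add_le_add ?_ ?_⟩
    · rw [he ht]
      refine Real.le_sqrt_of_sq_le ((hgV t ht).trans ?_)
      have := normV_nonneg θ
      gcongr
    · refine (integral_normH2_sq_le hT.le hc hs).trans ?_
      rw [hL2 hTT he]
      have := normV_nonneg θ
      refine mul_le_mul_of_nonneg_left (hgA.trans ?_) zero_le_three
      gcongr
  · obtain ⟨g, hg, -, -, hgD⟩ := exists_isStrongSolution hν hT hf hθ.2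
    rw [hg.eqOn hν hT.le hu ht]
    obtain ⟨hD, hb⟩ := hgD hθ t ht
    obtain ⟨hsum, hle⟩ := summable_norm_fc hD
    obtain ⟨w, h1, h2, h3, h4⟩ := exists_continuous_version (g t) hsum
    refine ⟨w, h1, h2, h3, fun x => (h4 x).trans (hle.trans ?_)⟩
    have e1 := normV_le_normH1 f
    have e2 := norm_le_normH1 f
    have e3 := (normV_le_norm_stokes hθ).trans hθm
    have := normV_nonneg θ
    have := normV_nonneg f
    refine (mul_le_mul_of_nonneg_left (hb.trans ?_) hw).trans (lt_add_one _).le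
    gcongr
  -- Only the dissipation of `u` enters the exponent, so no bound on the initial value of `v` is
  -- needed.
  · obtain ⟨g, hg, -, hgA, -⟩ := exists_isStrongSolution hν hT hf hθ
    have he := hg.eqOn hν hT.le hu
    have h1 := hu.norm_sub_sq_le hν hT.le hv t ht
    have h2 : ∫ s in (0 : ℝ)..t, ‖stokes (u s)‖ ^ 2 ≤ ∫ s in (0 : ℝ)..T, ‖stokes (u s)‖ ^ 2 :=
      intervalIntegral.integral_mono_interval le_rfl ht.1 ht.2
        (Eventually.of_forall fun _ => by positivity)
        (intervalIntegrable_norm_sq_of_memLp hT.le hu.squareIntegrableInDA.2)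
    rw [hL2 hTT he] at h2
    have := normV_nonneg θ
    have h3 : (normV θ ^ 2 + T * (‖f‖ ^ 2 / ν)) / ν ≤ (U ^ 2 + T * (‖f‖ ^ 2 / ν)) / ν := by gcongr
    have h4 := h2.trans (hgA.trans h3)
    rw [norm_sub_rev, norm_sub_rev θ]
    refine le_of_sq_le_sq ?_ (by positivity)
    rw [mul_pow, Real.sq_sqrt (Real.exp_pos _).le, mul_comm (Real.exp _)]
    refine h1.trans ?_
    gcongr
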